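/- **Setting.** Let $\dot x=P(x,y;\lambda)$, $\dot y=Q(x,y;\lambda)$ be a family of planar systems, with vector field $\mathcal X_\lambda$, and let $E\subset\mathbb R^d$ be open. Assume that $P,Q$ are analytic in $(x,y,\lambda)$ near $(0,0,\lambda^*)$ for every $\lambda^*\in E$, and that for every $\lambda\in E$ the origin is a monodromic singularity: it is an equilibrium, and for every $\varepsilon>0$ all orbits starting close enough to it make a full turn around it, in forward and in backward time, inside the punctured disc of radius $\varepsilon$. Write $P=\sum a_{ij}x^iy^{j-1}$, $Q=\sum b_{ij}x^{i-1}y^j$. The Newton diagram $\mathbf N(\mathcal X_\lambda)$ is the union of the compact edges of the convex hull of $\bigcup\{(i,j)+\mathbb R_{\ge0}^2:(a_{ij},b_{ij})\ne(0,0)\}$. A weight is a pair $(p,q)$ of coprime positive integers such that $pi+qj$ is constant on one of these edges, that edge being the face where $pi+qj$ is minimal. Assume that $\mathbf N(\mathcal X_\lambda)$ is the same for all $\lambda\in E$, and fix a weight $(p,q)$. Let $r$ be the minimum of $p(i-1)+q(j-1)$ over the support. In the coordinates $(x,y)=(\rho^p\cos\varphi,\rho^q\sin\varphi)$, and after division by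 $\rho^r$, the system becomes $\dot\rho=R(\varphi,\rho)$, $\dot\varphi=\Theta(\varphi,\rho)$. Put $\mathcal F=R/\Theta$ and $\Omega_\lambda=\{\varphi:\Theta(\varphi,0)=0\}$. Assume that $0\notin\Omega_\lambda$ for all $\lambda\in E$, and that every $\lambda^*\in E$ has a neighbourhood and an $\varepsilon>0$ such that $\Theta\neq0$ on $0<\rho<\varepsilon$ for all $\lambda$ in that neighbourhood. Let $m\in\mathbb Z$, and assume that $d\rho/d\varphi=\mathcal F(\varphi,\rho)$ has over $E$ a Laurent inverse integrating factor $V(\varphi,\rho;\lambda)$ of multiplicity $m$ depending analytically on $\lambda$. That is: * On a cylinder $0<\rho<\varepsilon$, where $\varepsilon$ can be chosen locally uniformly in $\lambda$, $V$ is $2\pi$-periodic in $\varphi$, of class $C^1$, not locally null, and satisfies $\partial_\varphi V+\mathcal F\,\partial_\rho V=V\,\partial_\rho\mathcal F$. * For $\varphi\notin\Omega_\lambda$ one has a convergent expansion $V=\sum_{i\ge m}v_i(\varphi;\lambda)\rho^i$ for small $\rho>0$, where the $v_i(\cdot;\lambda)$ are $C^1$ off $\Omega_\lambda$ and $v_m(\cdot;\lambda)$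 is not identically zero on any open set of angles off $\Omega_\lambda$. * For every $\lambda^*\in E$ and every fixed $\varphi\notin\Omega_{\lambda^*}$, $\rho^{-m}V(\varphi,\rho;\lambda)$ extends to an analytic function of $(\rho,\lambda)$ near $(0,\lambda^*)$. Let $\Pi(\rho_0)=\Pi(\rho_0;\lambda)=\Phi(2\pi;\rho_0)$ be the Poincaré map, where $\Phi(\cdot;\rho_0)$ is the solution of $d\rho/d\varphi=\mathcal F$ with $\Phi(0;\rho_0)=\rho_0>0$ small. Saying that $\Pi$ is analytic at $\rho=0$ means that it is, for small $\rho>0$, the restriction of a function analytic at $0$. **Theorem.** For every $\lambda\in E$ the map $\Pi$ is well defined for small $\rho_0>0$ and has an asymptotic power series expansion $\Pi(\rho)\sim\sum_{i\ge1}\eta_i(\lambda)\rho^i$ as $\rho\to0^+$. The $\eta_i$ are analytic on $E$. At every $\lambda^*\in E$ the Bautin ideal $\mathcal B=\langle\eta_1-1,\eta_2,\eta_3,\dots\rangle$ in the ring of germs at $\lambda^*$ of analytic functions is principal; $\mathcal B=\langle\eta_1-1\rangle$ if $m=1$, and $\mathcal B=\langle\eta_m\rangle$ if $m\ge2$. Moreover,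 for every $\lambda^*\in E$: 1. If $m>1$ and $\operatorname{Res}(1/V(0,\rho;\lambda^*),0)=0$, then $\Pi(\cdot;\lambda^*)$ is analytic at $\rho=0$. 2. If $\Pi(\cdot;\lambda^*)$ is analytic at $\rho=0$, then the cyclicity of the origin at $\lambda^*$ within the family over $E$ is $0$: for some neighbourhood $U$ of the origin and all $\lambda\in E$ close to $\lambda^*$, the system has no limit cycle contained in $U$. 3. If $m=1$, then $\Pi(\cdot;\lambda^*)$ is analytic at $\rho=0$. -/

import Mathlib

open Filter Topology Set

noncomputable section

/-- The parameter space `ℝ^d`. -/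
abbrev Param (d : ℕ) : Type := EuclideanSpace ℝ (Fin d)

/-- A family `x' = P(x, y; l)`, `y' = Q(x, y; l)` of planar systems; a point is `(x, y, l)`.
Only the germs of `P`, `Q` at the points `(0, 0, l)` matter. -/
structure PlanarFamily (d : ℕ) where
  P : ℝ × ℝ × Param d → ℝ
  Q : ℝ × ℝ × Param d → ℝ

/-- The Taylor coefficient of `x ^ i * y ^ j` at the origin. -/
def taylorCoeff (f : ℝ → ℝ → ℝ) (i j : ℕ) : ℝ :=
  iteratedDeriv j (fun y => iteratedDeriv i (fun x => f x y) 0) 0 / ((i.factorial : ℝ) * (j.factorial : ℝ))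

namespace PlanarFamily

variable {d : ℕ}

/-- The vector field with parameter `l`. -/
def field (X : PlanarFamily d) (l : Param d) (z : ℝ × ℝ) : ℝ × ℝ :=
  (X.P (z.1, z.2, l), X.Q (z.1, z.2, l))

/-- `P` and `Q` are analytic in `(x, y, l)` near `(0, 0, l₀)`. -/
def AnalyticNear (X : PlanarFamily d) (l₀ : Param d) : Prop :=
  AnalyticAt ℝ X.P (0, 0, l₀) ∧ AnalyticAt ℝ X.Q (0, 0, l₀)

/-! ### Monodromic singularities -/

/-- The origin is a monodromic singularity: it is an equilibrium, and for every `ε` all orbits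
starting close enough to the origin make a full turn around it, in forward (`σ = 1`) and in
backward (`σ = -1`) time, within the punctured disc of radius `ε`. The orbit is written in
(Euclidean) polar coordinates `r > 0` and `θ` (a continuous determination of the angle). -/
def IsMonodromic (X : PlanarFamily d) (l : Param d) : Prop :=
  X.field l (0, 0) = (0, 0) ∧
  ∀ ε > 0, ∃ δ > 0, ∀ r₀ ∈ Ioo (0 : ℝ) δ, ∀ θ₀ : ℝ, ∀ σ ∈ ({1, -1} : Set ℝ),
    ∃ T > 0, ∃ r θ : ℝ → ℝ,
      ContinuousOn r (Icc 0 T) ∧ ContinuousOn θ (Icc 0 T) ∧ r 0 = r₀ ∧ θ 0 = θ₀ ∧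
      |θ T - θ₀| = 2 * Real.pi ∧
      ∀ t ∈ Icc 0 T, r t ∈ Ioo 0 ε ∧
        HasDerivWithinAt (fun s => (r s * Real.cos (θ s), r s * Real.sin (θ s)))
          (σ • X.field l (r t * Real.cos (θ t), r t * Real.sin (θ t))) (Icc 0 T) t

/-- The monodromic parameter space. -/
def monodromicSet (X : PlanarFamily d) : Set (Param d) := {l | X.IsMonodromic l}

/-! ### The Newton diagram -/

/-- The support, for the expansions `P = ∑ a i j * x ^ i * y ^ (j - 1)` and
`Q = ∑ b i j * x ^ (i - 1) * y ^ j`: the pairs with `(a i j, b i j) ≠ (0, 0)`. -/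
def support (X : PlanarFamily d) (l : Param d) : Set (ℕ × ℕ) :=
  {s | (1 ≤ s.2 ∧ taylorCoeff (fun x y => X.P (x, y, l)) s.1 (s.2 - 1) ≠ 0) ∨
       (1 ≤ s.1 ∧ taylorCoeff (fun x y => X.Q (x, y, l)) (s.1 - 1) s.2 ≠ 0)}

/-- The convex hull of the union of the quadrants with vertex in the support. -/
def newtonRegion (X : PlanarFamily d) (l : Param d) : Set (ℝ × ℝ) :=
  convexHull ℝ (⋃ s ∈ X.support l, {z : ℝ × ℝ | (s.1 : ℝ) ≤ z.1 ∧ (s.2 : ℝ) ≤ z.2})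

/-- The face of the Newton region on which `w.1 * i + w.2 * j` is minimal. -/
def newtonFace (X : PlanarFamily d) (l : Param d) (w : ℕ × ℕ) : Set (ℝ × ℝ) :=
  {z ∈ X.newtonRegion l | ∀ z' ∈ X.newtonRegion l,
    (w.1 : ℝ) * z.1 + (w.2 : ℝ) * z.2 ≤ (w.1 : ℝ) * z'.1 + (w.2 : ℝ) * z'.2}

/-- The weights: coprime positive `(p, q)` whose face is an edge (more than one point). -/
def weights (X : PlanarFamily d) (l : Param d) : Set (ℕ × ℕ) :=
  {w | 0 < w.1 ∧ 0 < w.2 ∧ Nat.Coprime w.1 w.2 ∧ (X.newtonFace l w).Nontrivial}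

/-- The Newton diagram: the union of the compact edges of the Newton region. -/
def newtonDiagram (X : PlanarFamily d) (l : Param d) : Set (ℝ × ℝ) :=
  ⋃ w ∈ X.weights l, X.newtonFace l w

/-- The `(p, q)`-quasihomogeneous degree `r` of the leading part: a monomial of the support at
`(i, j)` has degree `p * (i - 1) + q * (j - 1)`. -/
def leadingDegree (X : PlanarFamily d) (l : Param d) (w : ℕ × ℕ) : ℤ :=
  (sInf ((fun s : ℕ × ℕ => w.1 * s.1 + w.2 * s.2) '' X.support l) : ℕ) - (w.1 : ℤ) - (w.2 : ℤ)

/-! ### Weighted polar blow-up -/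

/-- `P` along `(x, y) = (ρ ^ p * cos φ, ρ ^ q * sin φ)`. -/
def polarP (X : PlanarFamily d) (w : ℕ × ℕ) (l : Param d) (φ ρ : ℝ) : ℝ :=
  X.P (ρ ^ w.1 * Real.cos φ, ρ ^ w.2 * Real.sin φ, l)

/-- `Q` along `(x, y) = (ρ ^ p * cos φ, ρ ^ q * sin φ)`. -/
def polarQ (X : PlanarFamily d) (w : ℕ × ℕ) (l : Param d) (φ ρ : ℝ) : ℝ :=
  X.Q (ρ ^ w.1 * Real.cos φ, ρ ^ w.2 * Real.sin φ, l)

/-- The Jacobian of the weighted polar blow-up. -/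
def polarJac (w : ℕ × ℕ) (φ ρ : ℝ) : ℝ :=
  ρ ^ (w.1 + w.2 - 1) * ((w.1 : ℝ) * Real.cos φ ^ 2 + (w.2 : ℝ) * Real.sin φ ^ 2)

/-- The radial speed, after division by `ρ ^ r`; used for `ρ > 0`. -/
def radialSpeed (X : PlanarFamily d) (w : ℕ × ℕ) (l : Param d) (φ ρ : ℝ) : ℝ :=
  (ρ ^ w.2 * Real.cos φ * X.polarP w l φ ρ + ρ ^ w.1 * Real.sin φ * X.polarQ w l φ ρ) /
    polarJac w φ ρ * ρ ^ (-X.leadingDegree l w)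

/-- The angular speed `Θ`, after division by `ρ ^ r`; used for `ρ > 0`. -/
def angularSpeed (X : PlanarFamily d) (w : ℕ × ℕ) (l : Param d) (φ ρ : ℝ) : ℝ :=
  ((w.1 : ℝ) * ρ ^ (w.1 - 1) * Real.cos φ * X.polarQ w l φ ρ -
      (w.2 : ℝ) * ρ ^ (w.2 - 1) * Real.sin φ * X.polarP w l φ ρ) /
    polarJac w φ ρ * ρ ^ (-X.leadingDegree l w)

/-- The right-hand side of `dρ/dφ = F(φ, ρ)`. -/
def polarF (X : PlanarFamily d) (w : ℕ × ℕ) (l : Param d) (φ ρ : ℝ) : ℝ :=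
  X.radialSpeed w l φ ρ / X.angularSpeed w l φ ρ

/-- The characteristic directions (as a `2π`-periodic set of angles): `Θ(φ, 0) = 0`, where
`Θ(φ, 0)` is the limit of `Θ(φ, ρ)` as `ρ → 0⁺`. -/
def charDirections (X : PlanarFamily d) (w : ℕ × ℕ) (l : Param d) : Set ℝ :=
  {φ | Tendsto (fun ρ => X.angularSpeed w l φ ρ) (𝓝[>] 0) (𝓝 0)}

/-- Near `l₀` the family has no points of zero angular speed with `ρ > 0`, on a cylinder
`0 < ρ < ε` that is common to the parameters close to `l₀`. -/
def NonCriticalNear (X : PlanarFamily d) (w : ℕ × ℕ) (l₀ : Param d) : Prop :=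
  ∃ ε > 0, ∀ᶠ l in 𝓝 l₀, ∀ φ : ℝ, ∀ ρ ∈ Ioo (0 : ℝ) ε, X.angularSpeed w l φ ρ ≠ 0

/-! ### Inverse integrating factors -/

/-- The cylinder `0 < ρ < ε` without the zeros of `Θ` (the angle is lifted to `ℝ`). -/
def punctCylinder (X : PlanarFamily d) (w : ℕ × ℕ) (l : Param d) (ε : ℝ) : Set (ℝ × ℝ) :=
  {z | z.2 ∈ Ioo (0 : ℝ) ε ∧ X.angularSpeed w l z.1 z.2 ≠ 0}

/-- `V` is an inverse integrating factor of `dρ/dφ = F(φ, ρ)` on `punctCylinder`. -/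
structure IsInverseIntegratingFactor (X : PlanarFamily d) (w : ℕ × ℕ) (l : Param d) (ε : ℝ)
    (V : ℝ → ℝ → ℝ) : Prop where
  periodic : ∀ z ∈ X.punctCylinder w l ε, V (z.1 + 2 * Real.pi) z.2 = V z.1 z.2
  contDiffOn : ContDiffOn ℝ 1 (fun z : ℝ × ℝ => V z.1 z.2) (X.punctCylinder w l ε)
  not_locally_null : ∀ U : Set (ℝ × ℝ), IsOpen U → U.Nonempty → U ⊆ X.punctCylinder w l ε →
    ∃ z ∈ U, V z.1 z.2 ≠ 0
  pde : ∀ z ∈ X.punctCylinder w l ε,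
    deriv (fun φ => V φ z.2) z.1 + deriv (fun ρ => V z.1 ρ) z.2 * X.polarF w l z.1 z.2 =
      deriv (fun ρ => X.polarF w l z.1 ρ) z.2 * V z.1 z.2

/-- `V(φ, ρ; l) = ∑_{i ≥ m} v_i(φ; l) ρ ^ i` is, over the parameter set `E`, a Laurent inverse
integrating factor of multiplicity `m` that depends analytically on the parameters. -/
structure IsLaurentFactor (X : PlanarFamily d) (w : ℕ × ℕ) (E : Set (Param d)) (m : ℤ)
    (V : Param d → ℝ → ℝ → ℝ) (v : ℤ → Param d → ℝ → ℝ) : Prop where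
  factor : ∀ l₀ ∈ E, ∃ ε > 0, ∀ᶠ l in 𝓝 l₀, X.IsInverseIntegratingFactor w l ε (V l)
  coeff_contDiffOn : ∀ l ∈ E, ∀ i : ℤ, m ≤ i → ContDiffOn ℝ 1 (v i l) (X.charDirections w l)ᶜ
  expansion : ∀ l ∈ E, ∀ φ ∉ X.charDirections w l, ∀ᶠ ρ in 𝓝[>] (0 : ℝ),
    HasSum (fun k : ℕ => v (m + k) l φ * ρ ^ (m + k : ℤ)) (V l φ ρ)
  /-- the leading coefficient is not locally null -/
  leading : ∀ l ∈ E, ∀ φ ∉ X.charDirections w l, ∃ᶠ s in 𝓝 φ, v m l s ≠ 0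
  /-- for a fixed angle, `ρ ^ (-m) * V` is analytic in `(ρ, l)` up to `ρ = 0` -/
  analytic : ∀ l₀ ∈ E, ∀ φ ∉ X.charDirections w l₀, ∃ W : ℝ × Param d → ℝ,
    AnalyticAt ℝ W (0, l₀) ∧
    ∀ᶠ z : ℝ × Param d in 𝓝 (0, l₀), 0 < z.1 → V z.2 φ z.1 = z.1 ^ m * W z

/-! ### The Poincaré map -/

/-- `Φ` is a (positive) solution of `dρ/dφ = F(φ, ρ)` on `[0, 2π]` with `Φ 0 = ρ₀`. -/
def IsTurn (X : PlanarFamily d) (w : ℕ × ℕ) (l : Param d) (ρ₀ : ℝ) (Φ : ℝ → ℝ) : Prop :=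
  Φ 0 = ρ₀ ∧ ∀ φ ∈ Icc 0 (2 * Real.pi), 0 < Φ φ ∧ X.angularSpeed w l φ (Φ φ) ≠ 0 ∧
    HasDerivWithinAt Φ (X.polarF w l φ (Φ φ)) (Icc 0 (2 * Real.pi)) φ

open Classical in
/-- The Poincaré map `ρ₀ ↦ Φ(2π; ρ₀)` (with value `0` where there is no such solution). -/
def poincareMap (X : PlanarFamily d) (w : ℕ × ℕ) (l : Param d) (ρ₀ : ℝ) : ℝ :=
  if h : ∃ Φ : ℝ → ℝ, X.IsTurn w l ρ₀ Φ then h.choose (2 * Real.pi) else 0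

/-- For all small `ρ₀ > 0` the solution that defines the Poincaré map exists, and its value at
`2π` does not depend on choices. -/
def PoincareWellDefined (X : PlanarFamily d) (w : ℕ × ℕ) (l : Param d) : Prop :=
  ∀ᶠ ρ₀ in 𝓝[>] (0 : ℝ), (∃ Φ : ℝ → ℝ, X.IsTurn w l ρ₀ Φ) ∧
    ∀ Φ : ℝ → ℝ, X.IsTurn w l ρ₀ Φ → Φ (2 * Real.pi) = X.poincareMap w l ρ₀

/-! ### Limit cycles and cyclicity -/

/-- `Γ` is a (non-constant) periodic orbit. -/
def IsPeriodicOrbit (X : PlanarFamily d) (l : Param d) (Γ : Set (ℝ × ℝ)) : Prop :=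
  ∃ γ : ℝ → ℝ × ℝ, ∃ T > 0, (∀ t, HasDerivAt γ (X.field l (γ t)) t) ∧
    Function.Periodic γ T ∧ (∃ t, γ t ≠ γ 0) ∧ range γ = Γ

/-- A limit cycle: a periodic orbit that is isolated among the periodic orbits. -/
def IsLimitCycle (X : PlanarFamily d) (l : Param d) (Γ : Set (ℝ × ℝ)) : Prop :=
  X.IsPeriodicOrbit l Γ ∧
    ∃ U : Set (ℝ × ℝ), IsOpen U ∧ Γ ⊆ U ∧ ∀ Γ' ⊆ U, X.IsPeriodicOrbit l Γ' → Γ' = Γ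

/-- The cyclicity of the origin at `l₀` within the family over `E`: the largest number of limit
cycles in arbitrarily small neighbourhoods of the origin for parameters of `E` arbitrarily close
to `l₀`. -/
def cyclicity (X : PlanarFamily d) (E : Set (Param d)) (l₀ : Param d) : ℕ∞ :=
  ⨅ U ∈ 𝓝 ((0, 0) : ℝ × ℝ), ⨅ N ∈ 𝓝 l₀, ⨆ l ∈ N ∩ E, {Γ | X.IsLimitCycle l Γ ∧ Γ ⊆ U}.encard

end PlanarFamily

/-- `f` has the formal power series expansion `∑_{i ≥ 1} c_i ρ ^ i` as `ρ → 0⁺`. -/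
def HasFormalExpansion (f : ℝ → ℝ) (c : ℕ → ℝ) : Prop :=
  ∀ N : ℕ, (fun ρ => f ρ - ∑ i ∈ Finset.Icc 1 N, c i * ρ ^ i) =O[𝓝[>] (0 : ℝ)]
    fun ρ => ρ ^ (N + 1)

/-- A function given for small `ρ > 0` is analytic at `ρ = 0`, that is, it is there the
restriction of an analytic function. -/
def IsAnalyticAtZero (f : ℝ → ℝ) : Prop :=
  ∃ g : ℝ → ℝ, AnalyticAt ℝ g 0 ∧ ∀ᶠ ρ in 𝓝[>] (0 : ℝ), f ρ = g ρ

/-- The Laurent series `∑_{k ≥ 0} c (m + k) * T ^ (m + k)`. -/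
def laurentFrom (m : ℤ) (c : ℤ → ℝ) : LaurentSeries ℝ :=
  HahnSeries.single m (1 : ℝ) * HahnSeries.ofPowerSeries ℤ ℝ (PowerSeries.mk fun k => c (m + k))

/-- The residue at `0`. -/
def laurentResidue (f : LaurentSeries ℝ) : ℝ := f.coeff (-1)

/-! ### Germs of analytic functions and the Bautin ideal -/

/-- The ring of germs at `a` of real analytic functions. -/
def analyticGerms {d : ℕ} (a : Param d) : Subring (Germ (𝓝 a) ℝ) where
  carrier := {g | ∃ f : Param d → ℝ, AnalyticAt ℝ f a ∧ g = (f : Germ (𝓝 a) ℝ)}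
  mul_mem' := by
    rintro _ _ ⟨f, hf, rfl⟩ ⟨g, hg, rfl⟩
    exact ⟨f * g, hf.mul hg, rfl⟩
  one_mem' := ⟨fun _ => 1, analyticAt_const, rfl⟩
  add_mem' := by
    rintro _ _ ⟨f, hf, rfl⟩ ⟨g, hg, rfl⟩
    exact ⟨f + g, hf.add hg, rfl⟩
  zero_mem' := ⟨fun _ => 0, analyticAt_const, rfl⟩
  neg_mem' := by
    rintro _ ⟨f, hf, rfl⟩
    exact ⟨-f, hf.neg, rfl⟩

/-- The ideal generated by the germs at `a` of the functions in `S` (all analytic at `a`). -/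
def germIdeal {d : ℕ} (a : Param d) (S : Set (Param d → ℝ)) : Ideal (analyticGerms a) :=
  Ideal.span {g | ∃ f ∈ S, (g : Germ (𝓝 a) ℝ) = (f : Germ (𝓝 a) ℝ)}

/-- The Bautin ideal `⟨η₁ - 1, η₂, η₃, …⟩` at `a`. -/
def bautinIdeal {d : ℕ} (η : ℕ → Param d → ℝ) (a : Param d) : Ideal (analyticGerms a) :=
  germIdeal a ({fun l => η 1 l - 1} ∪ {f | ∃ j, 2 ≤ j ∧ f = η j})

end

/-! An inverse integrating factor turns the return map into a translation. The equation for V says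
that the one-form (dρ - F dφ)/V is closed, so the integral of dρ/V between two solutions does not
depend on the angle (`IsFactorOn.integral_eq`). Because V is 2π-periodic, it follows that T = ∫
ds/V(0,s), taken from ρ to Π(ρ), has the same value for every small ρ > 0
(`IsFactorOn.exists_period`).

Write V(0,ρ;λ) = ρ^m W(ρ,λ) with W analytic and W(0,λ) ≠ 0. If m ≤ 0, then 1/V is bounded near ρ = 0
while ρ and Π(ρ) both tend to 0; hence T = 0 and Π is the identity (`translation_eq_zero`). If m ≥
1, then Π is the time-T map of the analytic field ρ^m W ∂_ρ, which vanishes at ρ = 0, so Π(ρ;λ) =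
G(ρ,T(λ),λ) with G analytic (`AnalyticAt.exists_translation`, `IsTranslationNear.exists_analytic`).
In all cases Π is analytic at ρ = 0.

The period T is analytic in λ, since it can be computed from one fixed positive initial radius,
where solutions depend analytically on the parameter (`analyticAt_period`). As G(ρ,0,λ) = ρ, each of
η_1 - 1, η_2, η_3, … is divisible by T. Conversely η_1 = exp(T W(0,λ)) when m = 1, and η_m = T
W(0,λ) when m ≥ 2, so η_1 - 1, respectively η_m, is T times a unit. Thus the Bautin ideal is
generated by T (`IsTranslationNear.exists_expansion`, `IsTranslationNear.bautinIdeal`). A periodic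
orbit near the origin makes some number k ≥ 1 of turns, whence kT = 0 and T = 0. Then all nearby
orbits are closed and none is isolated (`PlanarFamily.IsRegularAt.closed_of_closed`,
`PlanarFamily.not_isLimitCycle`).

Three preparations carry the rest. (a) W(0,λ) ≠ 0, although the leading coefficient v_m is only
assumed not to vanish on an open set of angles. At an angle that is not characteristic, dρ/dφ = F
extends analytically to ρ = 0 in the form ρG. Its solutions carry V and ρ to neighbouring angles
with bounded factors, so a zero of v_m would spread to an interval (`IsFactorOn.leading_ne_zero`).
Near characteristic directions only radii ρ > 0 are ever used. (b) Orbits in the plane correspond to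
graphs ρ = Φ(φ): monodromy provides full turns (`PlanarFamily.IsMonodromic.exists_turn`), closed
graphs provide periodic orbits, and small periodic orbits provide closed graphs. (c) Analytic
dependence on initial values and parameters comes from the implicit function theorem in the Banach
space C([0,1],E), continued along a compact time interval (`AnalyticAt.exists_local_flow`,
`hasAnalyticFlow`). -/

/-! ### Superposition operators on spaces of continuous functions -/

open Classical in
/-- The superposition operator `y ↦ f ∘ y` (zero where `f ∘ y` is not continuous). -/
noncomputable def superpositionMap {E F : Type*} [TopologicalSpace E]
    [TopologicalSpace F] [Zero F] (K : Type*) [TopologicalSpace K] (f : E → F) (y : C(K, E)) :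
    C(K, F) :=
  if h : Continuous (f ∘ y) then ⟨f ∘ y, h⟩ else 0

theorem superpositionMap_apply {K E F : Type*} [TopologicalSpace K] [TopologicalSpace E]
    [TopologicalSpace F] [Zero F] {f : E → F} {y : C(K, E)} (h : ∀ t, ContinuousAt f (y t))
        (t : K) :
    superpositionMap K f y t = f (y t) := by
  have : Continuous (f ∘ y) :=
    continuous_iff_continuousAt.2 fun t => (h t).comp y.continuous.continuousAt
  simp [superpositionMap, this]

section Superposition

variable {K E F : Type*} [TopologicalSpace K] [CompactSpace K]
  [NormedAddCommGroup E] [NormedSpace ℝ E] [NormedAddCommGroup F] [NormedSpace ℝ F]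

/-- The pointwise action of a continuous multilinear map on continuous functions. -/
noncomputable def ContinuousMultilinearMap.onContinuousMap (K : Type*) [TopologicalSpace K]
    [CompactSpace K] {n : ℕ} (M : ContinuousMultilinearMap ℝ (fun _ : Fin n => E) F) :
    ContinuousMultilinearMap ℝ (fun _ : Fin n => C(K, E)) C(K, F) :=
  MultilinearMap.mkContinuous
    { toFun := fun y => ⟨fun t => M (fun i => y i t),
        M.cont.comp (continuous_pi fun i => (y i).continuous)⟩
      map_update_add' := by
        intro _ y i a b
        ext t
        have h : ∀ c : C(K, E), (fun j => (Function.update y i c) j t) =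
            Function.update (fun j => y j t) i (c t) := by
          intro c; funext j
          by_cases hj : j = i
          · subst hj; simp
          · simp [hj]
        simp [h]
      map_update_smul' := by
        intro _ y i c a
        ext t
        have h : ∀ c : C(K, E), (fun j => (Function.update y i c) j t) =
            Function.update (fun j => y j t) i (c t) := by
          intro c; funext j
          by_cases hj : j = i
          · subst hj; simp
          · simp [hj]
        simp [h] }
    ‖M‖ (by
      intro y
      refine (ContinuousMap.norm_le _ (by positivity)).2 fun t => ?_
      refine (M.le_opNorm _).trans ?_
      gcongr with i
      exact (y i).norm_coe_le_norm t)

theorem ContinuousMultilinearMap.norm_onContinuousMap_le {n : ℕ}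
    (M : ContinuousMultilinearMap ℝ (fun _ : Fin n => E) F) :
    ‖M.onContinuousMap K‖ ≤ ‖M‖ :=
  MultilinearMap.mkContinuous_norm_le _ (norm_nonneg _) _

/-- Each Taylor coefficient of `f` acts pointwise on continuous functions without increase of norm,
so the same power series converges in C(K, F) on a ball of the same radius. Evaluation at a point of
`K` identifies its sum. -/
theorem AnalyticAt.superposition [CompleteSpace F] {f : E → F} {x₀ : E} (hf : AnalyticAt ℝ f x₀) :
    AnalyticAt ℝ (superpositionMap K f) (ContinuousMap.const K x₀) := by
  obtain ⟨p, r, hp⟩ := hf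
  refine ⟨fun n => (p n).onContinuousMap K, r, ?_, hp.r_pos, ?_⟩
  · refine hp.r_le.trans (FormalMultilinearSeries.radius_le_of_le ?_)
    intro n
    exact (p n).norm_onContinuousMap_le
  · intro y hy
    have hy' : (‖y‖₊ : ENNReal) < r := by simpa [enorm_eq_nnnorm] using hy
    have hrad : (‖y‖₊ : ENNReal) < p.radius := hy'.trans_le hp.r_le
    have hsum : Summable fun n => ((p n).onContinuousMap K) fun _ => y := by
      refine Summable.of_norm_bounded (p.summable_norm_mul_pow hrad) fun n => ?_
      refine (((p n).onContinuousMap K).le_opNorm _).trans ?_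
      simp only [Finset.prod_const, Finset.card_univ, Fintype.card_fin, coe_nnnorm]
      gcongr
      exact (p n).norm_onContinuousMap_le
    have hball : ∀ t, y t ∈ Metric.eball (0 : E) r := by
      intro t
      have h1 : (‖y t‖₊ : ENNReal) ≤ ‖y‖₊ := by
        exact_mod_cast y.norm_coe_le_norm t
      simpa [enorm_eq_nnnorm] using h1.trans_lt hy'
    have hcont : ∀ t, ContinuousAt f ((ContinuousMap.const K x₀ + y) t) := by
      intro t
      have := hp.analyticAt_of_mem (y := x₀ + y t) (by
        have := hball t
        simpa [edist_eq_enorm_sub] using this)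
      simpa using this.continuousAt
    have hval : superpositionMap K f (ContinuousMap.const K x₀ + y) =
        ∑' n, ((p n).onContinuousMap K) fun _ => y := by
      ext t
      rw [superpositionMap_apply hcont]
      have h1 := (hsum.hasSum.map (ContinuousMap.evalCLM ℝ t)
          (ContinuousMap.evalCLM ℝ t).continuous)
      have h2 := hp.hasSum (hball t)
      exact h2.unique h1
    rw [hval]
    exact hsum.hasSum

end Superposition

/-! ### Local flows of analytic vector fields -/

section Flow

variable {E : Type*} [NormedAddCommGroup E] [NormedSpace ℝ E] [CompleteSpace E]

/-- The primitive vanishing at `0`, as a continuous linear operator. -/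
noncomputable def primitiveCLM (E : Type*) [NormedAddCommGroup E] [NormedSpace ℝ E]
    [CompleteSpace E] : C(Icc (0 : ℝ) 1, E) →L[ℝ] C(Icc (0 : ℝ) 1, E) :=
  LinearMap.mkContinuous
    { toFun := fun y => ⟨fun t => ∫ s in (0 : ℝ)..t, y (projIcc 0 1 zero_le_one s),
        (intervalIntegral.continuous_primitive
          (fun a b => (y.continuous.comp continuous_projIcc).intervalIntegrable a b) 0).comp
          continuous_subtype_val⟩
      map_add' := by
        intro y z; ext t
        simp only [ContinuousMap.coe_mk, ContinuousMap.add_apply]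
        exact intervalIntegral.integral_add
          ((y.continuous.comp continuous_projIcc).intervalIntegrable _ _)
          ((z.continuous.comp continuous_projIcc).intervalIntegrable _ _)
      map_smul' := by
        intro c y; ext t
        simp [intervalIntegral.integral_smul] }
    1 (by
      intro y
      refine (ContinuousMap.norm_le _ (by positivity)).2 fun t => ?_
      refine (intervalIntegral.norm_integral_le_of_norm_le_const (C := ‖y‖)
        fun s _ => y.norm_coe_le_norm _).trans ?_
      have h1 : |(t : ℝ) - 0| ≤ 1 := by
        rw [sub_zero, abs_of_nonneg t.2.1]; exact t.2.2
      nlinarith [norm_nonneg y])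

theorem primitiveCLM_apply (y : C(Icc (0 : ℝ) 1, E)) (t : Icc (0 : ℝ) 1) :
    primitiveCLM E y t = ∫ s in (0 : ℝ)..t, y (projIcc 0 1 zero_le_one s) := rfl

open scoped ContDiff in
/-- The flow of an analytic vector field is analytic for short times. -/
theorem AnalyticAt.exists_local_flow {f : E → E} {x₀ : E} (hf : AnalyticAt ℝ f x₀) {U : Set E}
    (hU : U ∈ 𝓝 x₀) :
    ∃ G : ℝ × E → E, AnalyticAt ℝ G (0, x₀) ∧ ∀ᶠ z in 𝓝 ((0, x₀) : ℝ × E), ∃ y : ℝ → E,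
      y 0 = z.2 ∧ y 1 = G z ∧ ∀ t ∈ Icc (0 : ℝ) 1, y t ∈ U ∧
        HasDerivWithinAt y (z.1 • f (y t)) (Icc 0 1) t := by
  let c : E →L[ℝ] C(Icc (0 : ℝ) 1, E) := ContinuousLinearMap.const ℝ (Icc (0 : ℝ) 1)
  -- The integral equation for y' = τ f(y), y(0) = x, on the unit interval. With the time τ as a
  -- parameter, the derivative in `y` at τ = 0 is the identity, so the implicit function theorem
  -- applies for any `f`.
  let H : (ℝ × E) × C(Icc (0 : ℝ) 1, E) → C(Icc (0 : ℝ) 1, E) := fun z =>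
    z.2 - c z.1.2 - z.1.1 • primitiveCLM E (superpositionMap (Icc (0 : ℝ) 1) f z.2)
  let u : (ℝ × E) × C(Icc (0 : ℝ) 1, E) := ((0, x₀), c x₀)
  have hs : AnalyticAt ℝ (superpositionMap (Icc (0 : ℝ) 1) f) (c x₀) := hf.superposition
  have hH : AnalyticAt ℝ H u := by
    have h1 : AnalyticAt ℝ (fun z : (ℝ × E) × C(Icc (0 : ℝ) 1, E) => superpositionMap (Icc (0 :
        ℝ) 1) f z.2) u :=
      hs.comp_of_eq analyticAt_snd rfl
    have h2 := ((primitiveCLM E).analyticAt (superpositionMap (Icc (0 :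
        ℝ) 1) f (c x₀))).comp_of_eq h1 rfl
    have h3 : AnalyticAt ℝ (fun z : (ℝ × E) × C(Icc (0 : ℝ) 1, E) => z.1.1) u :=
      analyticAt_fst.comp_of_eq analyticAt_fst rfl
    have h4 : AnalyticAt ℝ (fun z : (ℝ × E) × C(Icc (0 : ℝ) 1, E) => c z.1.2) u :=
      (c.analyticAt x₀).comp_of_eq (analyticAt_snd.comp_of_eq (y := (0, x₀)) analyticAt_fst rfl) rfl
    exact (analyticAt_snd.sub h4).sub (h3.smul h2)
  have hHc : ContDiffAt ℝ ω H u := hH.contDiffAt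
  have hpart : fderiv ℝ H u ∘L .inr ℝ (ℝ × E) C(Icc (0 :
      ℝ) 1, E) = ContinuousLinearMap.id ℝ C(Icc (0 : ℝ) 1, E) := by
    have h1 : HasFDerivAt (fun y : C(Icc (0 : ℝ) 1, E) => H ((0, x₀), y))
        (fderiv ℝ H u ∘L .inr ℝ (ℝ × E) C(Icc (0 : ℝ) 1, E)) (c x₀) :=
      HasFDerivAt.comp (c x₀) hH.differentiableAt.hasFDerivAt (hasFDerivAt_prodMk_right _ _)
    have h2 : HasFDerivAt (fun y : C(Icc (0 : ℝ) 1, E) => H ((0, x₀), y))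
        (ContinuousLinearMap.id ℝ C(Icc (0 : ℝ) 1, E)) (c x₀) := by
      have : (fun y : C(Icc (0 : ℝ) 1, E) => H ((0, x₀), y)) = fun y => y - c x₀ := by
        funext y; simp [H]
      rw [this]
      exact (hasFDerivAt_id _).sub_const _
    exact h1.unique h2
  have hinv : (fderiv ℝ H u ∘L .inr ℝ (ℝ × E) C(Icc (0 : ℝ) 1, E)).IsInvertible := by
    rw [hpart]
    exact ⟨ContinuousLinearEquiv.refl ℝ _, rfl⟩
  have hω : (ω : WithTop ℕ∞) ≠ 0 := by simp
  let Y := hHc.implicitFunction hω hinv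
  have hYa : AnalyticAt ℝ Y (0, x₀) :=
    (hHc.contDiffAt_implicitFunction hω hinv).analyticAt
  have hY0 : Y (0, x₀) = c x₀ := hHc.implicitFunction_apply_self hω hinv
  have hYeq : ∀ᶠ z in 𝓝 ((0, x₀) : ℝ × E), H (z, Y z) = H u :=
    hHc.eventually_apply_implicitFunction hω hinv
  have hHu : H u = 0 := by simp [H, u]
  -- `superpositionMap` has its intended value only where `f ∘ y` is continuous; keeping the curve
  -- in this set guarantees that.
  have hnhd : U ∩ {x | AnalyticAt ℝ f x} ∈ 𝓝 x₀ := inter_mem hU hf.eventually_analyticAt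
  obtain ⟨δ, hδ, hball⟩ := Metric.mem_nhds_iff.1 hnhd
  have hclose : ∀ᶠ z in 𝓝 ((0, x₀) : ℝ × E), Y z ∈ Metric.ball (c x₀) δ := by
    have := hYa.continuousAt.tendsto
    rw [hY0] at this
    exact this (Metric.ball_mem_nhds _ hδ)
  have one_mem : (1 : ℝ) ∈ Icc (0 : ℝ) 1 := by simp
  have zero_mem : (0 : ℝ) ∈ Icc (0 : ℝ) 1 := by simp
  refine ⟨fun z => Y z ⟨1, one_mem⟩, ?_, ?_⟩
  · exact ((ContinuousMap.evalCLM ℝ (⟨1, one_mem⟩ : Icc (0 : ℝ) 1)).analyticAt _).comp_of_eq hYa rfl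
  filter_upwards [hYeq, hclose] with z hz hzc
  rw [hHu] at hz
  have hmem : ∀ t, Y z t ∈ U ∩ {x | AnalyticAt ℝ f x} := by
    intro t
    apply hball
    rw [Metric.mem_ball] at hzc ⊢
    exact (ContinuousMap.dist_apply_le_dist t).trans_lt hzc
  have hcont : ∀ t, ContinuousAt f (Y z t) := fun t => (hmem t).2.continuousAt
  have hsup : ∀ t, superpositionMap (Icc (0 :
      ℝ) 1) f (Y z) t = f (Y z t) := superpositionMap_apply hcont
  have heq : ∀ t : Icc (0 : ℝ) 1, Y z t = z.2 +
      z.1 • ∫ s in (0 : ℝ)..t, f (Y z (projIcc 0 1 zero_le_one s)) := by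
    intro t
    have := congrArg (fun g : C(Icc (0 : ℝ) 1, E) => g t) hz
    simp only [H, ContinuousMap.sub_apply, ContinuousMap.smul_apply, primitiveCLM_apply, hsup,
      ContinuousMap.zero_apply] at this
    have hc : c z.2 t = z.2 := rfl
    rw [hc, sub_sub, sub_eq_zero] at this
    exact this
  have hfc : Continuous fun s => f (Y z (projIcc 0 1 zero_le_one s)) :=
    continuous_iff_continuousAt.2 fun s => (hcont _).comp
      (f := fun s => Y z (projIcc 0 1 zero_le_one s))
      ((Y z).continuous.comp continuous_projIcc).continuousAt
  refine ⟨fun t => z.2 + z.1 • ∫ s in (0 : ℝ)..t, f (Y z (projIcc 0 1 zero_le_one s)), ?_, ?_, ?_⟩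
  · simp
  · exact (heq ⟨1, one_mem⟩).symm
  · intro t ht
    have h1 := heq ⟨t, ht⟩
    simp only at h1 ⊢
    rw [← h1]
    refine ⟨(hmem _).1, ?_⟩
    have h2 := (hfc.integral_hasStrictDerivAt 0 t).hasDerivAt
    have h3 := ((h2.const_smul z.1).const_add z.2).hasDerivWithinAt (s := Icc 0 1)
    rw [projIcc_of_mem zero_le_one ht] at h3
    exact h3

end Flow

section Flow

variable {E : Type*} [NormedAddCommGroup E] [NormedSpace ℝ E]

/-! ### Uniqueness, concatenation and flows over compact time intervals -/

/-- The set of agreement is closed, and the local Lipschitz property makes it open to the right.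
Regularity is needed only along `y₁`, so `y₂` may be any competitor, with no a priori bound on its
values. -/
theorem ODE_solution_unique_of_contDiffAt {f : E → E} {a b : ℝ} {y₁ y₂ : ℝ → E}
    (h₁ : ∀ t ∈ Icc a b, HasDerivWithinAt y₁ (f (y₁ t)) (Icc a b) t)
    (h₂ : ∀ t ∈ Icc a b, HasDerivWithinAt y₂ (f (y₂ t)) (Icc a b) t)
    (hf : ∀ t ∈ Icc a b, ContDiffAt ℝ 1 f (y₁ t)) (h₀ : y₁ a = y₂ a) :
    EqOn y₁ y₂ (Icc a b) := by
  have c₁ : ContinuousOn y₁ (Icc a b) := fun t ht => (h₁ t ht).continuousWithinAt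
  have c₂ : ContinuousOn y₂ (Icc a b) := fun t ht => (h₂ t ht).continuousWithinAt
  have hcl : IsClosed ({t | y₁ t = y₂ t} ∩ Icc a b) := by
    have h := isClosed_Icc.isClosed_eq c₁ c₂
    convert h using 1
    ext t; simp [and_comm]
  refine hcl.Icc_subset_of_forall_mem_nhdsWithin h₀ ?_
  rintro x ⟨hx, hxab⟩
  obtain ⟨K, U, hU, hK⟩ := (hf x (Ico_subset_Icc_self hxab)).exists_lipschitzOnWith
  have hIcc : Icc a b ∈ 𝓝[≥] x := Icc_mem_nhdsGE_of_mem hxab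
  have t₁ : ∀ᶠ t in 𝓝[≥] x, y₁ t ∈ U :=
    ((c₁ x (Ico_subset_Icc_self hxab)).mono_of_mem_nhdsWithin hIcc) hU
  have t₂ : ∀ᶠ t in 𝓝[≥] x, y₂ t ∈ U := by
    refine ((c₂ x (Ico_subset_Icc_self hxab)).mono_of_mem_nhdsWithin hIcc) ?_
    have : y₁ x = y₂ x := hx
    rwa [← this]
  obtain ⟨u, hu, hsub⟩ := mem_nhdsGE_iff_exists_Icc_subset.1 ((t₁.and t₂).and hIcc)
  have hxu : x < u := hu
  have key : EqOn y₁ y₂ (Icc x u) := by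
    refine ODE_solution_unique_of_mem_Icc_right (v := fun _ => f) (s := fun _ => U)
      (fun t _ => hK) (c₁.mono fun t ht => (hsub ht).2) (fun t ht => ?_)
      (fun t ht => (hsub (Ico_subset_Icc_self ht)).1.1) (c₂.mono fun t ht => (hsub ht).2)
      (fun t ht => ?_) (fun t ht => (hsub (Ico_subset_Icc_self ht)).1.2) hx
    all_goals
      have htab : t ∈ Icc a b := (hsub (Ico_subset_Icc_self ht)).2
      have huab : u ∈ Icc a b := (hsub (right_mem_Icc.2 hxu.le)).2
      have hm : Icc a b ∈ 𝓝[≥] t := Icc_mem_nhdsGE_of_mem ⟨htab.1, ht.2.trans_le huab.2⟩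
    · exact (h₁ t htab).mono_of_mem_nhdsWithin hm
    · exact (h₂ t htab).mono_of_mem_nhdsWithin hm
  filter_upwards [Ioc_mem_nhdsGT hxu] with t ht
  exact key (Ioc_subset_Icc_self ht)

theorem hasDerivWithinAt_ite_le {f : E → E} {a b c : ℝ} (hab : a ≤ b) (hbc : b ≤ c)
    {y₁ y₂ : ℝ → E} (h : y₁ b = y₂ b)
    (h₁ : ∀ t ∈ Icc a b, HasDerivWithinAt y₁ (f (y₁ t)) (Icc a b) t)
    (h₂ : ∀ t ∈ Icc b c, HasDerivWithinAt y₂ (f (y₂ t)) (Icc b c) t) :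
    ∀ t ∈ Icc a c, HasDerivWithinAt (fun s => if s ≤ b then y₁ s else y₂ s)
      (f (if t ≤ b then y₁ t else y₂ t)) (Icc a c) t := by
  intro t ht
  have e₁ : ∀ s ∈ Icc a b, (if s ≤ b then y₁ s else y₂ s) = y₁ s := fun s hs => if_pos hs.2
  have e₂ : ∀ s ∈ Icc b c, (if s ≤ b then y₁ s else y₂ s) = y₂ s := by
    intro s hs
    rcases hs.1.eq_or_lt with h' | h'
    · subst h'; simp [h]
    · simp [h']
  rw [← Icc_union_Icc_eq_Icc hab hbc]
  refine HasDerivWithinAt.union ?_ ?_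
  · by_cases htb : t ≤ b
    · have := (h₁ t ⟨ht.1, htb⟩).congr e₁ (e₁ t ⟨ht.1, htb⟩)
      rwa [e₁ t ⟨ht.1, htb⟩]
    · refine HasFDerivWithinAt.of_notMem_closure ?_
      rw [isClosed_Icc.closure_eq]
      exact fun h => htb h.2
  · by_cases htb : b ≤ t
    · have := (h₂ t ⟨htb, ht.2⟩).congr e₂ (e₂ t ⟨htb, ht.2⟩)
      rwa [e₂ t ⟨htb, ht.2⟩]
    · refine HasFDerivWithinAt.of_notMem_closure ?_
      rw [isClosed_Icc.closure_eq]
      exact fun h => htb h.1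

/-- `HasAnalyticFlow f O γ a b`: near `γ a` the flow of `f` from time `a` to time `b` is
analytic, with trajectories in `O`. -/
def HasAnalyticFlow (f : E → E) (O : Set E) (γ : ℝ → E) (a b : ℝ) : Prop :=
  ∃ g : E → E, AnalyticAt ℝ g (γ a) ∧ g (γ a) = γ b ∧ ∀ᶠ x in 𝓝 (γ a), ∃ y : ℝ → E,
    y a = x ∧ y b = g x ∧ ∀ t ∈ Icc a b, y t ∈ O ∧ HasDerivWithinAt y (f (y t)) (Icc a b) t

theorem HasAnalyticFlow.refl {f : E → E} {O : Set E} (hO : IsOpen O) {γ : ℝ → E} {a : ℝ}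
    (ha : γ a ∈ O) : HasAnalyticFlow f O γ a a := by
  refine ⟨id, analyticAt_id, rfl, ?_⟩
  filter_upwards [hO.mem_nhds ha] with x hx
  refine ⟨fun _ => x, rfl, rfl, fun t ht => ⟨hx, ?_⟩⟩
  have : t = a := by simpa using ht
  subst this
  simp only [Icc_self]
  exact HasFDerivWithinAt.of_subsingleton subsingleton_singleton

theorem HasAnalyticFlow.trans {f : E → E} {O : Set E} {γ : ℝ → E} {a b c : ℝ}
    (hab : a ≤ b) (hbc : b ≤ c) (h₁ : HasAnalyticFlow f O γ a b)
    (h₂ : HasAnalyticFlow f O γ b c) : HasAnalyticFlow f O γ a c := by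
  obtain ⟨g₁, ha₁, he₁, hy₁⟩ := h₁
  obtain ⟨g₂, ha₂, he₂, hy₂⟩ := h₂
  refine ⟨g₂ ∘ g₁, ha₂.comp_of_eq ha₁ he₁, by simp [he₁, he₂], ?_⟩
  have ht : Tendsto g₁ (𝓝 (γ a)) (𝓝 (γ b)) := by
    have := ha₁.continuousAt.tendsto
    rwa [he₁] at this
  filter_upwards [hy₁, ht.eventually hy₂] with x ⟨y₁, h10, h11, h1⟩ ⟨y₂, h20, h21, h2⟩
  have hb : y₁ b = y₂ b := by rw [h11, h20]
  refine ⟨fun s => if s ≤ b then y₁ s else y₂ s, by simp [hab, h10], ?_, fun t ht => ⟨?_, ?_⟩⟩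
  · rcases hbc.eq_or_lt with h' | h'
    · subst h'; simp only [le_refl, if_true, Function.comp]; rw [hb, h21]
    · simp [h', h21]
  · by_cases htb : t ≤ b
    · simp only [htb, if_true]; exact (h1 t ⟨ht.1, htb⟩).1
    · simp only [htb, if_false]; exact (h2 t ⟨(not_le.1 htb).le, ht.2⟩).1
  · exact hasDerivWithinAt_ite_le hab hbc hb (fun t ht => (h1 t ht).2)
      (fun t ht => (h2 t ht).2) t ht

/-- The short-time flow is analytic jointly in time and initial value near `(0, γ t)`, so a single
`δ` serves all pairs of times close to `t`. A Lebesgue-type subdivision then covers the compact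
interval. -/
theorem exists_nhds_hasAnalyticFlow [CompleteSpace E] {f : E → E} {O : Set E} (hO : IsOpen O)
    (hf : AnalyticOnNhd ℝ f O) {a b : ℝ} {γ : ℝ → E} (hγO : ∀ t ∈ Icc a b, γ t ∈ O)
    (hγ : ∀ t ∈ Icc a b, HasDerivWithinAt γ (f (γ t)) (Icc a b) t) {t : ℝ} (ht : t ∈ Icc a b) :
    ∃ δ > 0, ∀ t₀ ∈ Icc a b, ∀ t₁ ∈ Icc a b, t₀ ≤ t₁ → |t₀ - t| < δ → |t₁ - t| < δ →
      HasAnalyticFlow f O γ t₀ t₁ := by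
  obtain ⟨G, hG, hy⟩ := (hf _ (hγO t ht)).exists_local_flow (hO.mem_nhds (hγO t ht))
  obtain ⟨r, hr, hball⟩ := Metric.eventually_nhds_iff.1 (hG.eventually_analyticAt.and hy)
  obtain ⟨δ, hδ, hδr⟩ := Metric.continuousWithinAt_iff.1 (hγ t ht).continuousWithinAt r hr
  -- Two times within `r / 2` of `t` differ by less than `r`; `δ` keeps the starting point close to
  -- `γ t`.
  refine ⟨min δ (r / 2), by positivity, fun t₀ h₀ t₁ h₁ h01 hd₀ hd₁ => ?_⟩
  rcases h01.eq_or_lt with h' | h'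
  · subst h'; exact HasAnalyticFlow.refl hO (hγO _ h₀)
  set τ := t₁ - t₀ with hτ
  have hτ0 : 0 < τ := sub_pos.2 h'
  have hsub : Icc t₀ t₁ ⊆ Icc a b := Icc_subset_Icc h₀.1 h₁.2
  have hτr : |τ| < r := by
    have h1 := hd₀.trans_le (min_le_right _ _)
    have h2 := hd₁.trans_le (min_le_right _ _)
    rw [abs_lt] at h1 h2 ⊢
    constructor <;> linarith
  have hγr : dist (γ t₀) (γ t) < r := hδr h₀ (by
    rw [Real.dist_eq]; exact hd₀.trans_le (min_le_left _ _))
  have hev : ∀ᶠ x in 𝓝 (γ t₀), dist ((τ, x) : ℝ × E) (0, γ t) < r := by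
    filter_upwards [(isOpen_lt (continuous_id.dist continuous_const)
      continuous_const).mem_nhds hγr] with x hx
    rw [Prod.dist_eq]
    exact max_lt (by simpa using hτr) hx
  have hsol : ∀ x, dist ((τ, x) : ℝ × E) (0, γ t) < r → ∃ y : ℝ → E, y t₀ = x ∧
      y t₁ = G (τ, x) ∧ ∀ s ∈ Icc t₀ t₁, y s ∈ O ∧
        HasDerivWithinAt y (f (y s)) (Icc t₀ t₁) s := by
    intro x hx
    obtain ⟨y, y0, y1, hy⟩ := (hball hx).2
    refine ⟨fun s => y ((s - t₀) / τ), by simp [y0], by simp [← hτ, hτ0.ne', y1], fun s hs => ?_⟩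
    have hmaps : MapsTo (fun s => (s - t₀) / τ) (Icc t₀ t₁) (Icc 0 1) := by
      intro s hs
      exact ⟨div_nonneg (by linarith [hs.1]) hτ0.le, (div_le_one hτ0).2 (by linarith [hs.2])⟩
    obtain ⟨hO', hd⟩ := hy _ (hmaps hs)
    refine ⟨hO', ?_⟩
    have hlin : HasDerivWithinAt (fun s => (s - t₀) / τ) (1 / τ) (Icc t₀ t₁) s :=
      (((hasDerivAt_id s).sub_const t₀).div_const τ).hasDerivWithinAt
    have := HasDerivWithinAt.scomp s hd hlin hmaps
    rw [smul_smul, one_div, inv_mul_cancel₀ hτ0.ne', one_smul] at this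
    exact this
  have hself := hev.self_of_nhds
  refine ⟨fun x => G (τ, x), ?_, ?_, hev.mono hsol⟩
  · exact (hball hself).1.comp_of_eq (analyticAt_const.prod analyticAt_id) rfl
  · obtain ⟨y, y0, y1, hy⟩ := hsol _ hself
    have := ODE_solution_unique_of_contDiffAt (f := f) (a := t₀) (b := t₁) (y₁ := γ) (y₂ := y)
      (fun s hs => (hγ s (hsub hs)).mono hsub) (fun s hs => (hy s hs).2)
      (fun s hs => (hf _ (hγO s (hsub hs))).contDiffAt) y0.symm (right_mem_Icc.2 h01)
    exact (this.trans y1).symm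

/-- The flow of an analytic vector field is analytic near a trajectory over a compact time
interval. -/
theorem hasAnalyticFlow [CompleteSpace E] {f : E → E} {O : Set E} (hO : IsOpen O)
    (hf : AnalyticOnNhd ℝ f O) {a b : ℝ} (hab : a ≤ b) {γ : ℝ → E} (hγO : ∀ t ∈ Icc a b, γ t ∈ O)
    (hγ : ∀ t ∈ Icc a b, HasDerivWithinAt γ (f (γ t)) (Icc a b) t) :
    HasAnalyticFlow f O γ a b := by
  choose! δ hδ hflow using fun t (ht : t ∈ Icc a b) =>
    exists_nhds_hasAnalyticFlow hO hf hγO hγ ht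
  obtain ⟨t, t0, hmono, ⟨n, hn⟩, hcov⟩ := exists_monotone_Icc_subset_open_cover_Icc hab
    (c := fun i : Icc a b => {s | |(s : ℝ) - i| < δ i})
    (fun i => isOpen_lt (by fun_prop) continuous_const)
    (fun s _ => mem_iUnion.2 ⟨s, by simpa using hδ s s.2⟩)
  have key : ∀ k, HasAnalyticFlow f O γ a (t k) := by
    intro k
    induction k with
    | zero => rw [t0]; exact HasAnalyticFlow.refl hO (hγO _ (left_mem_Icc.2 hab))
    | succ k ih =>
      obtain ⟨i, hi⟩ := hcov k
      have hle : t k ≤ t (k + 1) := hmono (Nat.le_succ k)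
      exact ih.trans (t k).2.1 hle (hflow i i.2 _ (t k).2 _ (t (k + 1)).2 hle
        (hi (left_mem_Icc.2 hle)) (hi (right_mem_Icc.2 hle)))
  have := key n
  rwa [hn n le_rfl] at this

/-! ### Primitives and integrals depending on parameters -/

theorem hasDerivWithinAt_primitive [CompleteSpace E] {g : ℝ → E} {a b : ℝ}
    (hg : ContinuousOn g (Icc a b)) {t : ℝ} (ht : t ∈ Icc a b) :
    HasDerivWithinAt (fun u => ∫ s in a..u, g s) (g t) (Icc a b) t := by
  have : Fact (t ∈ Icc a b) := ⟨ht⟩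
  refine intervalIntegral.integral_hasDerivWithinAt_right ?_
    (hg.stronglyMeasurableAtFilter_nhdsWithin measurableSet_Icc t) (hg t ht)
  refine ContinuousOn.intervalIntegrable (hg.mono ?_)
  rw [uIcc_of_le ht.1]
  exact Icc_subset_Icc_right ht.2

theorem eqOn_of_hasDerivWithinAt_eq {g₁ g₂ : ℝ → E} {g' : ℝ → E} {a b : ℝ}
    (h₁ : ∀ t ∈ Icc a b, HasDerivWithinAt g₁ (g' t) (Icc a b) t)
    (h₂ : ∀ t ∈ Icc a b, HasDerivWithinAt g₂ (g' t) (Icc a b) t) (h : g₁ a = g₂ a) :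
    EqOn g₁ g₂ (Icc a b) := by
  intro t ht
  refine eq_of_has_deriv_right_eq (f' := g') (a := a) (b := b) (fun s hs => ?_) (fun s hs => ?_)
    (fun s hs => (h₁ s hs).continuousWithinAt) (fun s hs => (h₂ s hs).continuousWithinAt) h t ht
  · exact (h₁ s (Ico_subset_Icc_self hs)).mono_of_mem_nhdsWithin (Icc_mem_nhdsGE_of_mem hs)
  · exact (h₂ s (Ico_subset_Icc_self hs)).mono_of_mem_nhdsWithin (Icc_mem_nhdsGE_of_mem hs)

/-- The integral is the first coordinate at time 1 of the flow of the field `(g(s, z), 1, 0)`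
started at `(0, 0, z)`, so analyticity of flows gives analyticity in the parameter. -/
theorem AnalyticAt.integral_unitInterval [CompleteSpace E] {g : ℝ × E → ℝ} {z₀ : E}
    (hg : ∀ s ∈ Icc (0 : ℝ) 1, AnalyticAt ℝ g (s, z₀)) :
    AnalyticAt ℝ (fun z => ∫ s in (0 : ℝ)..1, g (s, z)) z₀ := by
  let f : ℝ × ℝ × E → ℝ × ℝ × E := fun x => (g x.2, 1, 0)
  let O : Set (ℝ × ℝ × E) := {x | AnalyticAt ℝ g x.2}
  have hO : IsOpen O := (isOpen_analyticAt ℝ g).preimage continuous_snd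
  have hf : AnalyticOnNhd ℝ f O := fun x hx =>
    (AnalyticAt.comp_of_eq hx analyticAt_snd rfl).prod analyticAt_const
  have hline : ∀ z : E, Continuous fun s : ℝ => (s, z) := fun z => by fun_prop
  have hcont : ∀ z : E, (∀ s ∈ Icc (0 : ℝ) 1, AnalyticAt ℝ g (s, z)) →
      ContinuousOn (fun s => g (s, z)) (Icc 0 1) := fun z hz s hs =>
    ((hz s hs).continuousAt.comp (f := fun s : ℝ => (s, z))
      (hline z).continuousAt).continuousWithinAt
  let γ : ℝ → ℝ × ℝ × E := fun t => (∫ s in (0 : ℝ)..t, g (s, z₀), t, z₀)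
  obtain ⟨G, hG, -, hev⟩ := hasAnalyticFlow hO hf zero_le_one (γ := γ) (fun t ht => hg t ht)
    (fun t ht => (hasDerivWithinAt_primitive (hcont z₀ hg) ht).prodMk
      ((hasDerivWithinAt_id _ _).prodMk (hasDerivWithinAt_const _ _ _)))
  have hγ0 : γ 0 = (0, 0, z₀) := by simp [γ]
  rw [hγ0] at hG hev
  have hins : AnalyticAt ℝ (fun z : E => ((0 : ℝ), (0 : ℝ), z)) z₀ :=
    analyticAt_const.prod (analyticAt_const.prod analyticAt_id)
  have h1 : AnalyticAt ℝ (fun z : E => (G (0, 0, z)).1) z₀ :=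
    analyticAt_fst.comp_of_eq (hG.comp_of_eq hins rfl) rfl
  refine h1.congr ?_
  filter_upwards [hins.continuousAt.eventually hev] with z ⟨y, y0, y1, hy⟩
  have e2 : ∀ t ∈ Icc (0 : ℝ) 1, (y t).2 = (t, z) := by
    intro t ht
    refine eqOn_of_hasDerivWithinAt_eq (g₁ := fun t => (y t).2) (g₂ := fun t => (t, z))
      (g' := fun _ => ((1 : ℝ), (0 : E))) (fun t ht => ?_) (fun t ht => ?_) (by simp [y0]) ht
    · exact ((ContinuousLinearMap.snd ℝ ℝ (ℝ × E)).hasFDerivAt.comp_hasDerivWithinAt t (hy t ht).2)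
    · exact (hasDerivWithinAt_id _ _).prodMk (hasDerivWithinAt_const _ _ _)
  have hz : ∀ s ∈ Icc (0 : ℝ) 1, AnalyticAt ℝ g (s, z) := by
    intro s hs
    have := (hy s hs).1
    rw [← e2 s hs]; exact this
  have e1 := eqOn_of_hasDerivWithinAt_eq (g₁ := fun t => (y t).1)
    (g₂ := fun t => ∫ s in (0 : ℝ)..t, g (s, z)) (g' := fun t => g (t, z)) (a := 0) (b := 1)
    (fun t ht => by
      have := (ContinuousLinearMap.fst ℝ ℝ (ℝ × E)).hasFDerivAt.comp_hasDerivWithinAt t (hy t ht).2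
      rw [← e2 t ht]; exact this)
    (fun t ht => hasDerivWithinAt_primitive (hcont z hz) ht) (by simp [y0])
    (right_mem_Icc.2 zero_le_one)
  simp only [← y1]
  exact e1

/-- Division by the first variable. -/
theorem AnalyticAt.exists_eq_add_mul [CompleteSpace E] {f : ℝ × E → ℝ} {z₀ : E}
    (hf : AnalyticAt ℝ f (0, z₀)) :
    ∃ f₁ : ℝ × E → ℝ, AnalyticAt ℝ f₁ (0, z₀) ∧
      ∀ᶠ z in 𝓝 ((0, z₀) : ℝ × E), f z = f (0, z.2) + z.1 * f₁ z := by
  -- Hadamard's lemma: the quotient is the integral over `s ∈ [0, 1]` of the first partial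
  -- derivative at `(s z.1, z.2)`.
  let D : ℝ × E → ℝ := fun z => fderiv ℝ f z (1, 0)
  have hD : AnalyticAt ℝ D (0, z₀) :=
    ((ContinuousLinearMap.apply ℝ ℝ ((1, 0) : ℝ × E)).analyticAt _).comp_of_eq hf.fderiv rfl
  refine ⟨fun z => ∫ s in (0 : ℝ)..1, D (s * z.1, z.2), ?_, ?_⟩
  · refine AnalyticAt.integral_unitInterval (g := fun x : ℝ × (ℝ × E) => D (x.1 * x.2.1, x.2.2))
      fun s _ => ?_
    refine hD.comp_of_eq (f := fun x : ℝ × (ℝ × E) => (x.1 * x.2.1, x.2.2)) ?_ (by simp)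
    exact (analyticAt_fst.mul (analyticAt_fst.comp_of_eq analyticAt_snd rfl)).prod
      (analyticAt_snd.comp_of_eq analyticAt_snd rfl)
  · obtain ⟨r, hr, hball⟩ := Metric.eventually_nhds_iff.1
      (hf.eventually_analyticAt.and hD.eventually_analyticAt)
    filter_upwards [Metric.ball_mem_nhds _ hr] with z hz
    have hseg : ∀ s ∈ Icc (0 : ℝ) 1, dist ((s * z.1, z.2) : ℝ × E) (0, z₀) < r := by
      intro s hs
      refine lt_of_le_of_lt ?_ (Metric.mem_ball.1 hz)
      rw [Prod.dist_eq, Prod.dist_eq]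
      refine max_le_max ?_ le_rfl
      simp only [dist_zero_right, norm_mul, Real.norm_eq_abs, abs_of_nonneg hs.1]
      exact mul_le_of_le_one_left (abs_nonneg _) hs.2
    have hder : ∀ s ∈ Icc (0 : ℝ) 1, HasDerivWithinAt (fun s => f (s * z.1, z.2))
        (z.1 * D (s * z.1, z.2)) (Icc 0 1) s := by
      intro s hs
      have h1 := (hball (hseg s hs)).1.differentiableAt.hasFDerivAt
      have h2 : HasDerivAt (fun s : ℝ => ((s * z.1, z.2) : ℝ × E)) (z.1, 0) s := by
        have := (hasDerivAt_id s).mul_const z.1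
        simp only [id, one_mul] at this
        exact this.prodMk (hasDerivAt_const _ _)
      have h3 := h1.comp_hasDerivAt s h2
      have h4 : fderiv ℝ f (s * z.1, z.2) (z.1, 0) = z.1 * D (s * z.1, z.2) := by
        have : ((z.1, 0) : ℝ × E) = z.1 • (1, 0) := by simp
        rw [this, map_smul, smul_eq_mul]
      rw [h4] at h3
      exact h3.hasDerivWithinAt
    have hc : ContinuousOn (fun s : ℝ => D (s * z.1, z.2)) (Icc 0 1) := fun s hs =>
      ((hball (hseg s hs)).2.continuousAt.comp (f := fun s : ℝ => ((s * z.1, z.2) : ℝ × E))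
        (by fun_prop)).continuousWithinAt
    have key := eqOn_of_hasDerivWithinAt_eq (g₁ := fun s => f (s * z.1, z.2))
      (g₂ := fun u => f (0, z.2) + z.1 * ∫ s in (0 : ℝ)..u, D (s * z.1, z.2))
      (g' := fun s => z.1 * D (s * z.1, z.2)) hder
      (fun t ht => ((hasDerivWithinAt_primitive hc ht).const_mul z.1).const_add _) (by simp)
      (right_mem_Icc.2 zero_le_one)
    simpa using key

end Flow

/-! ### Scalar equations on a cylinder -/

/-- A solution of the linear equation `y' = a * y`. -/
theorem eq_mul_exp_of_hasDerivWithinAt {y α : ℝ → ℝ} {a b : ℝ} (hα : ContinuousOn α (Icc a b))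
    (hy : ∀ t ∈ Icc a b, HasDerivWithinAt y (α t * y t) (Icc a b) t) {t : ℝ} (ht : t ∈ Icc a b) :
    y t = y a * Real.exp (∫ s in a..t, α s) := by
  have h := eqOn_of_hasDerivWithinAt_eq
    (g₁ := fun t => y t * Real.exp (-∫ s in a..t, α s)) (g₂ := fun _ => y a) (g' := fun _ => 0)
    (a := a) (b := b) (fun t ht => by
      have h1 := (hasDerivWithinAt_primitive hα ht).neg.exp
      refine ((hy t ht).mul h1).congr_deriv ?_
      simp only [Pi.neg_apply]
      ring) (fun t _ => hasDerivWithinAt_const _ _ _) (by simp) ht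
  simp only at h
  rw [← h, mul_assoc, ← Real.exp_add]
  simp

/-- The open cylinder `0 < ρ < ε` (the angle is lifted to `ℝ`). -/
def openCylinder (ε : ℝ) : Set (ℝ × ℝ) := {z | z.2 ∈ Ioo (0 : ℝ) ε}

theorem isOpen_openCylinder (ε : ℝ) : IsOpen (openCylinder ε) :=
  isOpen_Ioo.preimage continuous_snd

/-- `Φ` solves `dρ/dφ = F(φ, ρ)` on `[a, b]`, with values in `(0, ε)`. -/
def IsSolutionOn (F : ℝ → ℝ → ℝ) (ε a b : ℝ) (Φ : ℝ → ℝ) : Prop :=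
  ∀ φ ∈ Icc a b, Φ φ ∈ Ioo 0 ε ∧ HasDerivWithinAt Φ (F φ (Φ φ)) (Icc a b) φ

theorem IsSolutionOn.continuousOn {F : ℝ → ℝ → ℝ} {ε a b : ℝ} {Φ : ℝ → ℝ}
    (h : IsSolutionOn F ε a b Φ) : ContinuousOn Φ (Icc a b) :=
  fun t ht => (h t ht).2.continuousWithinAt

theorem IsSolutionOn.mono {F : ℝ → ℝ → ℝ} {ε a b a' b' : ℝ} {Φ : ℝ → ℝ}
    (h : IsSolutionOn F ε a b Φ) (ha : a ≤ a') (hb : b' ≤ b) : IsSolutionOn F ε a' b' Φ :=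
  fun t ht => have hs := Icc_subset_Icc ha hb
    ⟨(h t (hs ht)).1, (h t (hs ht)).2.mono hs⟩

theorem IsSolutionOn.mono_radius {F : ℝ → ℝ → ℝ} {e ε a b : ℝ} {Φ : ℝ → ℝ}
    (h : IsSolutionOn F e a b Φ) (hle : e ≤ ε) : IsSolutionOn F ε a b Φ :=
  fun t ht => ⟨⟨(h t ht).1.1, (h t ht).1.2.trans_le hle⟩, (h t ht).2⟩

theorem eqOn_of_lipschitzWith {G : ℝ → ℝ → ℝ} {K : NNReal} {a b : ℝ}
    (hG : ∀ t ∈ Icc a b, LipschitzWith K (G t)) {y₁ y₂ : ℝ → ℝ}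
    (h₁ : ∀ t ∈ Icc a b, HasDerivWithinAt y₁ (G t (y₁ t)) (Icc a b) t)
    (h₂ : ∀ t ∈ Icc a b, HasDerivWithinAt y₂ (G t (y₂ t)) (Icc a b) t) {t₀ : ℝ}
    (ht₀ : t₀ ∈ Icc a b) (h : y₁ t₀ = y₂ t₀) : EqOn y₁ y₂ (Icc a b) := by
  have c₁ : ContinuousOn y₁ (Icc a b) := fun t ht => (h₁ t ht).continuousWithinAt
  have c₂ : ContinuousOn y₂ (Icc a b) := fun t ht => (h₂ t ht).continuousWithinAt
  rw [← Icc_union_Icc_eq_Icc ht₀.1 ht₀.2]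
  have s₁ : Icc a t₀ ⊆ Icc a b := Icc_subset_Icc_right ht₀.2
  have s₂ : Icc t₀ b ⊆ Icc a b := Icc_subset_Icc_left ht₀.1
  refine EqOn.union ?_ ?_
  · have hm : ∀ t ∈ Ioc a t₀, Icc a b ∈ 𝓝[≤] t := fun t ht =>
      Icc_mem_nhdsLE_of_mem ⟨ht.1, ht.2.trans ht₀.2⟩
    exact ODE_solution_unique_of_mem_Icc_left (v := G) (s := fun _ => univ) (K := K)
      (fun t ht => (hG t (s₁ (Ioc_subset_Icc_self ht))).lipschitzOnWith) (c₁.mono s₁)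
      (fun t ht => (h₁ t (s₁ (Ioc_subset_Icc_self ht))).mono_of_mem_nhdsWithin (hm t ht))
      (fun _ _ => mem_univ _) (c₂.mono s₁)
      (fun t ht => (h₂ t (s₁ (Ioc_subset_Icc_self ht))).mono_of_mem_nhdsWithin (hm t ht))
      (fun _ _ => mem_univ _) h
  · have hm : ∀ t ∈ Ico t₀ b, Icc a b ∈ 𝓝[≥] t := fun t ht =>
      Icc_mem_nhdsGE_of_mem ⟨ht₀.1.trans ht.1, ht.2⟩
    exact ODE_solution_unique_of_mem_Icc_right (v := G) (s := fun _ => univ) (K := K)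
      (fun t ht => (hG t (s₂ (Ico_subset_Icc_self ht))).lipschitzOnWith) (c₁.mono s₂)
      (fun t ht => (h₁ t (s₂ (Ico_subset_Icc_self ht))).mono_of_mem_nhdsWithin (hm t ht))
      (fun _ _ => mem_univ _) (c₂.mono s₂)
      (fun t ht => (h₂ t (s₂ (Ico_subset_Icc_self ht))).mono_of_mem_nhdsWithin (hm t ht))
      (fun _ _ => mem_univ _) h

/-- Solutions do not cross. -/
theorem le_of_lipschitzWith {G : ℝ → ℝ → ℝ} {K : NNReal} {a b : ℝ}
    (hG : ∀ t ∈ Icc a b, LipschitzWith K (G t)) {y₁ y₂ : ℝ → ℝ}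
    (h₁ : ∀ t ∈ Icc a b, HasDerivWithinAt y₁ (G t (y₁ t)) (Icc a b) t)
    (h₂ : ∀ t ∈ Icc a b, HasDerivWithinAt y₂ (G t (y₂ t)) (Icc a b) t) {t₀ : ℝ}
    (ht₀ : t₀ ∈ Icc a b) (h : y₁ t₀ ≤ y₂ t₀) : ∀ t ∈ Icc a b, y₁ t ≤ y₂ t := by
  intro t ht
  by_contra! hlt
  have c₁ : ContinuousOn y₁ (Icc a b) := fun t ht => (h₁ t ht).continuousWithinAt
  have c₂ : ContinuousOn y₂ (Icc a b) := fun t ht => (h₂ t ht).continuousWithinAt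
  obtain ⟨s, hs, hs'⟩ := isPreconnected_Icc.intermediate_value₂ ht₀ ht c₁ c₂ h hlt.le
  exact hlt.ne' (eqOn_of_lipschitzWith hG h₁ h₂ hs hs' ht)

/-- Through each point between two solutions there is a solution between them. -/
theorem IsSolutionOn.exists_between {F : ℝ → ℝ → ℝ} {ε : ℝ}
    (hF : ContDiffOn ℝ 1 (fun z : ℝ × ℝ => F z.1 z.2) (openCylinder ε)) {a b : ℝ}
    {Φ₁ Φ₂ : ℝ → ℝ} (h₁ : IsSolutionOn F ε a b Φ₁) (h₂ : IsSolutionOn F ε a b Φ₂) {t₀ : ℝ}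
    (ht₀ : t₀ ∈ Icc a b) :
    (Φ₁ t₀ ≤ Φ₂ t₀ → ∀ t ∈ Icc a b, Φ₁ t ≤ Φ₂ t) ∧
    ∀ c ∈ Icc (Φ₁ t₀) (Φ₂ t₀), ∃ Φ, Φ t₀ = c ∧ IsSolutionOn F ε a b Φ := by
  have hne : (Icc a b).Nonempty := ⟨t₀, ht₀⟩
  obtain ⟨s₁, hs₁, hmin⟩ := isCompact_Icc.exists_isMinOn hne (h₁.continuousOn.inf h₂.continuousOn)
  obtain ⟨s₂, hs₂, hmax⟩ := isCompact_Icc.exists_isMaxOn hne (h₁.continuousOn.sup h₂.continuousOn)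
  set α := (Φ₁ ⊓ Φ₂) s₁ with hα
  set β := (Φ₁ ⊔ Φ₂) s₂ with hβ
  have hα0 : 0 < α := lt_min (h₁ _ hs₁).1.1 (h₂ _ hs₁).1.1
  have hβε : β < ε := max_lt (h₁ _ hs₂).1.2 (h₂ _ hs₂).1.2
  have r₁ : ∀ t ∈ Icc a b, Φ₁ t ∈ Icc α β := fun t ht =>
    ⟨(hmin ht).trans (min_le_left _ _), (le_max_left _ _).trans (hmax ht)⟩
  have r₂ : ∀ t ∈ Icc a b, Φ₂ t ∈ Icc α β := fun t ht =>
    ⟨(hmin ht).trans (min_le_right _ _), (le_max_right _ _).trans (hmax ht)⟩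
  have hαβ : α ≤ β := (r₁ _ ht₀).1.trans (r₁ _ ht₀).2
  have hsub : Icc a b ×ˢ Icc α β ⊆ openCylinder ε := fun z hz =>
    ⟨hα0.trans_le hz.2.1, hz.2.2.trans_lt hβε⟩
  have hcomp : IsCompact (Icc a b ×ˢ Icc α β) := isCompact_Icc.prod isCompact_Icc
  obtain ⟨K, hK⟩ : ∃ K, LipschitzOnWith K (fun z : ℝ × ℝ => F z.1 z.2) (Icc a b ×ˢ Icc α β) := by
    refine LocallyLipschitzOn.exists_lipschitzOnWith_of_compact hcomp fun z hz => ?_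
    obtain ⟨K, U, hU, hK⟩ := (hF.contDiffAt
      ((isOpen_openCylinder ε).mem_nhds (hsub hz))).exists_lipschitzOnWith
    exact ⟨K, U, mem_nhdsWithin_of_mem_nhds hU, hK⟩
  -- Clamping the radius to a compact strip containing both solutions makes the field globally
  -- Lipschitz in ρ. A solution trapped between the two never meets the clamp, so it solves the
  -- original equation.
  let p : ℝ → ℝ := fun y => projIcc α β hαβ y
  have hp : ∀ y, p y ∈ Icc α β := fun y => (projIcc α β hαβ y).2
  have hp' : ∀ y ∈ Icc α β, p y = y := fun y hy => by simp [p, projIcc_of_mem hαβ hy]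
  let G : ℝ → ℝ → ℝ := fun t y => F t (p y)
  have hG : ∀ t ∈ Icc a b, LipschitzWith K (G t) := by
    intro t ht
    refine LipschitzWith.of_dist_le_mul fun y y' => ?_
    have h1 := hK.dist_le_mul (t, p y) ⟨ht, hp y⟩ (t, p y') ⟨ht, hp y'⟩
    refine h1.trans (mul_le_mul_of_nonneg_left ?_ K.2)
    simp only [Prod.dist_eq, dist_self]
    refine max_le dist_nonneg ?_
    have := (LipschitzWith.projIcc hαβ).dist_le_mul y y'
    rw [NNReal.coe_one, one_mul, Subtype.dist_eq] at this
    exact this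
  have g₁ : ∀ t ∈ Icc a b, HasDerivWithinAt Φ₁ (G t (Φ₁ t)) (Icc a b) t := fun t ht => by
    simp only [G, hp' _ (r₁ t ht)]; exact (h₁ t ht).2
  have g₂ : ∀ t ∈ Icc a b, HasDerivWithinAt Φ₂ (G t (Φ₂ t)) (Icc a b) t := fun t ht => by
    simp only [G, hp' _ (r₂ t ht)]; exact (h₂ t ht).2
  refine ⟨fun h => le_of_lipschitzWith hG g₁ g₂ ht₀ h, fun c hc => ?_⟩
  obtain ⟨C, hC⟩ := hcomp.exists_bound_of_continuousOn (hF.continuousOn.mono hsub)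
  have hC0 : 0 ≤ C := (norm_nonneg _).trans (hC (t₀, α) ⟨ht₀, left_mem_Icc.2 hαβ⟩)
  obtain ⟨L, hL⟩ : ∃ L : NNReal, (L : ℝ) = C := ⟨⟨C, hC0⟩, rfl⟩
  have hmax0 : 0 ≤ max (b - t₀) (t₀ - a) := le_max_of_le_left (sub_nonneg.2 ht₀.2)
  obtain ⟨M, hM⟩ : ∃ M : NNReal, (M : ℝ) = max (b - t₀) (t₀ - a) := ⟨⟨_, hmax0⟩, rfl⟩
  -- The ball has radius speed bound times the longest time, so Picard–Lindelöf covers the whole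
  -- interval at once.
  have hPL : IsPicardLindelof G (⟨t₀, ht₀⟩ : Icc a b) c (L * M) 0 L K :=
    { lipschitzOnWith := fun t ht => (hG t ht).lipschitzOnWith
      continuousOn := fun y _ => (hF.continuousOn.mono hsub).comp
        (f := fun t : ℝ => (t, p y)) (by fun_prop) fun t ht => ⟨ht, hp y⟩
      norm_le := fun t ht y _ => by rw [hL]; exact hC (t, p y) ⟨ht, hp y⟩
      mul_max_le := by rw [NNReal.coe_zero, sub_zero, NNReal.coe_mul, hM] }
  obtain ⟨Φ, hΦ0, hΦ⟩ := hPL.exists_eq_forall_mem_Icc_hasDerivWithinAt₀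
  have hΦ0' : Φ t₀ = c := hΦ0
  have l₁ := le_of_lipschitzWith hG g₁ hΦ ht₀ (by rw [hΦ0']; exact hc.1)
  have l₂ := le_of_lipschitzWith hG hΦ g₂ ht₀ (by rw [hΦ0']; exact hc.2)
  refine ⟨Φ, hΦ0', fun t ht => ?_⟩
  have hr : Φ t ∈ Icc α β := ⟨(r₁ t ht).1.trans (l₁ t ht), (l₂ t ht).trans (r₂ t ht).2⟩
  refine ⟨⟨hα0.trans_le hr.1, hr.2.trans_lt hβε⟩, ?_⟩
  have := hΦ t ht
  simp only [G, hp' _ hr] at this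
  exact this

/-! ### The conserved quantity of an inverse integrating factor -/

/-- The equation of an inverse integrating factor, on the open cylinder. -/
structure IsFactorOn (F V : ℝ → ℝ → ℝ) (ε : ℝ) : Prop where
  field : ContDiffOn ℝ 1 (fun z : ℝ × ℝ => F z.1 z.2) (openCylinder ε)
  factor : ContDiffOn ℝ 1 (fun z : ℝ × ℝ => V z.1 z.2) (openCylinder ε)
  pde : ∀ z ∈ openCylinder ε,
    fderiv ℝ (fun z : ℝ × ℝ => V z.1 z.2) z (1, F z.1 z.2) =
      fderiv ℝ (fun z : ℝ × ℝ => F z.1 z.2) z (0, 1) * V z.1 z.2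

theorem IsFactorOn.hasFDerivAt_factor {F V : ℝ → ℝ → ℝ} {ε : ℝ} (h : IsFactorOn F V ε)
    {z : ℝ × ℝ} (hz : z ∈ openCylinder ε) :
    HasFDerivAt (fun z : ℝ × ℝ => V z.1 z.2) (fderiv ℝ (fun z : ℝ × ℝ => V z.1 z.2) z) z :=
  ((h.factor.contDiffAt ((isOpen_openCylinder ε).mem_nhds hz)).differentiableAt
    one_ne_zero).hasFDerivAt

theorem IsFactorOn.hasFDerivAt_field {F V : ℝ → ℝ → ℝ} {ε : ℝ} (h : IsFactorOn F V ε)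
    {z : ℝ × ℝ} (hz : z ∈ openCylinder ε) :
    HasFDerivAt (fun z : ℝ × ℝ => F z.1 z.2) (fderiv ℝ (fun z : ℝ × ℝ => F z.1 z.2) z) z :=
  ((h.field.contDiffAt ((isOpen_openCylinder ε).mem_nhds hz)).differentiableAt
    one_ne_zero).hasFDerivAt

theorem IsFactorOn.continuousOn_fderiv_factor {F V : ℝ → ℝ → ℝ} {ε : ℝ} (h : IsFactorOn F V ε)
    (u : ℝ × ℝ) :
    ContinuousOn (fun z => fderiv ℝ (fun z : ℝ × ℝ => V z.1 z.2) z u) (openCylinder ε) :=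
  (h.factor.continuousOn_fderiv_of_isOpen (isOpen_openCylinder ε) le_rfl).clm_apply
    continuousOn_const

theorem IsFactorOn.continuousOn_fderiv_field {F V : ℝ → ℝ → ℝ} {ε : ℝ} (h : IsFactorOn F V ε)
    (u : ℝ × ℝ) :
    ContinuousOn (fun z => fderiv ℝ (fun z : ℝ × ℝ => F z.1 z.2) z u) (openCylinder ε) :=
  (h.field.continuousOn_fderiv_of_isOpen (isOpen_openCylinder ε) le_rfl).clm_apply
    continuousOn_const

/-- Along a solution, an inverse integrating factor solves a linear equation. -/
theorem IsFactorOn.factor_eq_mul_exp {F V : ℝ → ℝ → ℝ} {ε a b : ℝ} (h : IsFactorOn F V ε)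
    {Φ : ℝ → ℝ} (hΦ : IsSolutionOn F ε a b Φ) {t : ℝ} (ht : t ∈ Icc a b) :
    ∃ k : ℝ, V t (Φ t) = V a (Φ a) * Real.exp k := by
  refine ⟨_, eq_mul_exp_of_hasDerivWithinAt (y := fun t => V t (Φ t))
    (α := fun t => fderiv ℝ (fun z : ℝ × ℝ => F z.1 z.2) (t, Φ t) (0, 1)) ?_ (fun t ht => ?_) ht⟩
  · exact (h.continuousOn_fderiv_field _).comp (continuousOn_id.prodMk hΦ.continuousOn)
      fun t ht => (hΦ t ht).1
  · have h1 := h.hasFDerivAt_factor (z := (t, Φ t)) (hΦ t ht).1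
    have h2 := h1.comp_hasDerivWithinAt t ((hasDerivWithinAt_id t (Icc a b)).prodMk (hΦ t ht).2)
    rw [h.pde (t, Φ t) (hΦ t ht).1] at h2
    exact h2

/-- The conserved quantity: the integral of `1 / V` between two solutions. -/
theorem IsFactorOn.integral_eq {F V : ℝ → ℝ → ℝ} {ε a b : ℝ} (hab : a < b)
    (h : IsFactorOn F V ε) (hV : ∀ ρ ∈ Ioo 0 ε, V a ρ ≠ 0) {Φ₁ Φ₂ : ℝ → ℝ}
    (h₁ : IsSolutionOn F ε a b Φ₁) (h₂ : IsSolutionOn F ε a b Φ₂) (hle : Φ₁ a ≤ Φ₂ a) :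
    ∫ s in (Φ₁ a)..(Φ₂ a), (V a s)⁻¹ = ∫ s in (Φ₁ b)..(Φ₂ b), (V b s)⁻¹ := by
  have ha : a ∈ Icc a b := left_mem_Icc.2 hab.le
  have hb : b ∈ Icc a b := right_mem_Icc.2 hab.le
  have hord := (h₁.exists_between h.field h₂ ha).1 hle
  -- the factor does not vanish between the two solutions
  have hne : ∀ t ∈ Icc a b, ∀ c ∈ Icc (Φ₁ t) (Φ₂ t), V t c ≠ 0 := by
    intro t ht c hc
    obtain ⟨Φ, hΦt, hΦ⟩ := (h₁.exists_between h.field h₂ ht).2 c hc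
    obtain ⟨k, hk⟩ := h.factor_eq_mul_exp hΦ ht
    rw [← hΦt, hk]
    exact mul_ne_zero (hV _ (hΦ a ha).1) (Real.exp_ne_zero _)
  -- Linear interpolation between the two solutions replaces the moving interval of integration by
  -- [0, 1]. Here `y'` is the derivative of `y` in `t`, and `g'` below is that of the transformed
  -- integrand `g`.
  let y : ℝ → ℝ → ℝ := fun t s => Φ₁ t + s * (Φ₂ t - Φ₁ t)
  let y' : ℝ → ℝ → ℝ := fun t s => F t (Φ₁ t) + s * (F t (Φ₂ t) - F t (Φ₁ t))
  let DV : ℝ × ℝ → ℝ × ℝ → ℝ := fun z => fderiv ℝ (fun z : ℝ × ℝ => V z.1 z.2) z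
  let DF : ℝ × ℝ → ℝ × ℝ → ℝ := fun z => fderiv ℝ (fun z : ℝ × ℝ => F z.1 z.2) z
  have hy : ∀ t ∈ Icc a b, ∀ s ∈ Icc (0 : ℝ) 1, y t s ∈ Icc (Φ₁ t) (Φ₂ t) := by
    intro t ht s hs
    have := hord t ht
    constructor
    · simp only [y]; nlinarith [hs.1]
    · simp only [y]; nlinarith [hs.2]
  have hcyl : ∀ t ∈ Icc a b, ∀ s ∈ Icc (0 : ℝ) 1, (t, y t s) ∈ openCylinder ε := by
    intro t ht s hs
    exact ⟨(h₁ t ht).1.1.trans_le (hy t ht s hs).1, (hy t ht s hs).2.trans_lt (h₂ t ht).1.2⟩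
  let R : Set (ℝ × ℝ) := Icc a b ×ˢ Icc (0 : ℝ) 1
  have cΦ₁ : ContinuousOn (fun z : ℝ × ℝ => Φ₁ z.1) R :=
    h₁.continuousOn.comp continuousOn_fst fun z hz => hz.1
  have cΦ₂ : ContinuousOn (fun z : ℝ × ℝ => Φ₂ z.1) R :=
    h₂.continuousOn.comp continuousOn_fst fun z hz => hz.1
  have cy : ContinuousOn (fun z : ℝ × ℝ => (z.1, y z.1 z.2)) R :=
    continuousOn_fst.prodMk (cΦ₁.add (continuousOn_snd.mul (cΦ₂.sub cΦ₁)))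
  have hmy : MapsTo (fun z : ℝ × ℝ => (z.1, y z.1 z.2)) R (openCylinder ε) :=
    fun z hz => hcyl _ hz.1 _ hz.2
  have cF : ∀ {Φ : ℝ → ℝ}, IsSolutionOn F ε a b Φ →
      ContinuousOn (fun z : ℝ × ℝ => F z.1 (Φ z.1)) R := by
    intro Φ hΦ
    exact h.field.continuousOn.comp (f := fun z : ℝ × ℝ => (z.1, Φ z.1))
      (continuousOn_fst.prodMk (hΦ.continuousOn.comp continuousOn_fst fun z hz => hz.1))
      fun z hz => (hΦ _ hz.1).1
  have cy' : ContinuousOn (fun z : ℝ × ℝ => y' z.1 z.2) R :=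
    (cF h₁).add (continuousOn_snd.mul ((cF h₂).sub (cF h₁)))
  have cV : ContinuousOn (fun z : ℝ × ℝ => V z.1 (y z.1 z.2)) R :=
    h.factor.continuousOn.comp cy hmy
  have hVne : ∀ z ∈ R, V z.1 (y z.1 z.2) ≠ 0 := fun z hz => hne _ hz.1 _ (hy _ hz.1 _ hz.2)
  let g : ℝ → ℝ → ℝ := fun t s => (Φ₂ t - Φ₁ t) * (V t (y t s))⁻¹
  let g' : ℝ → ℝ → ℝ := fun t s => (F t (Φ₂ t) - F t (Φ₁ t)) * (V t (y t s))⁻¹ +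
    (Φ₂ t - Φ₁ t) * (-(DV (t, y t s) (1, 0) + y' t s * DV (t, y t s) (0, 1)) / V t (y t s) ^ 2)
  have cg : ContinuousOn (fun z : ℝ × ℝ => g z.1 z.2) R := (cΦ₂.sub cΦ₁).mul (cV.inv₀ hVne)
  have cg' : ContinuousOn (fun z : ℝ × ℝ => g' z.1 z.2) R := by
    refine (((cF h₂).sub (cF h₁)).mul (cV.inv₀ hVne)).add ((cΦ₂.sub cΦ₁).mul
      (((((h.continuousOn_fderiv_factor _).comp cy hmy).add
        (cy'.mul ((h.continuousOn_fderiv_factor _).comp cy hmy))).neg).div (cV.pow 2) ?_))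
    exact fun z hz => pow_ne_zero 2 (hVne z hz)
  have slice : ∀ {k : ℝ → ℝ → ℝ}, ContinuousOn (fun z : ℝ × ℝ => k z.1 z.2) R →
      ∀ t ∈ Icc a b, ContinuousOn (k t) (Icc 0 1) := fun hk t ht =>
    hk.comp (f := fun s : ℝ => (t, s)) (by fun_prop) fun s hs => ⟨ht, hs⟩
  have hsplit : ∀ (z : ℝ × ℝ) (c : ℝ), DV z (1, c) = DV z (1, 0) + c * DV z (0, 1) := by
    intro z c
    have : ((1, c) : ℝ × ℝ) = (1, 0) + c • (0, 1) := by simp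
    simp only [DV]
    rw [this, map_add, map_smul, smul_eq_mul]
  have hgd : ∀ t ∈ Ioo a b, ∀ s ∈ Icc (0 : ℝ) 1, HasDerivAt (fun t => g t s) (g' t s) t := by
    intro t ht s hs
    have htI := Ioo_subset_Icc_self ht
    have hmem : Icc a b ∈ 𝓝 t := Icc_mem_nhds ht.1 ht.2
    have d₁ := (h₁ t htI).2.hasDerivAt hmem
    have d₂ := (h₂ t htI).2.hasDerivAt hmem
    have dy : HasDerivAt (fun t => y t s) (y' t s) t := d₁.add ((d₂.sub d₁).const_mul s)
    have dV : HasDerivAt (fun t => V t (y t s)) (DV (t, y t s) (1, y' t s)) t :=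
      (h.hasFDerivAt_factor (hcyl t htI s hs)).comp_hasDerivAt (f := fun t => (t, y t s)) t
        ((hasDerivAt_id t).prodMk dy)
    rw [hsplit] at dV
    exact (d₂.sub d₁).mul (dV.inv (hVne (t, s) ⟨htI, hs⟩))
  -- By the equation for `V`, `g'` is the `s`-derivative of `(y' - F(t, y)) / V(t, y)`. This
  -- vanishes at `s = 0` and `s = 1`, where `y` is a solution and `y' = F`.
  have hzero : ∀ t ∈ Icc a b, ∫ s in (0 : ℝ)..1, g' t s = 0 := by
    intro t ht
    have hq : ∀ s ∈ uIcc (0 : ℝ) 1,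
        HasDerivAt (fun s => (y' t s - F t (y t s)) * (V t (y t s))⁻¹) (g' t s) s := by
      intro s hs
      rw [uIcc_of_le zero_le_one] at hs
      have dy : HasDerivAt (fun s => y t s) (Φ₂ t - Φ₁ t) s := by
        have := ((hasDerivAt_id s).mul_const (Φ₂ t - Φ₁ t)).const_add (Φ₁ t)
        rw [one_mul] at this; exact this
      have dy' : HasDerivAt (fun s => y' t s) (F t (Φ₂ t) - F t (Φ₁ t)) s := by
        have := ((hasDerivAt_id s).mul_const (F t (Φ₂ t) - F t (Φ₁ t))).const_add (F t (Φ₁ t))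
        rw [one_mul] at this; exact this
      have hc := hcyl t ht s hs
      have e : ((0, Φ₂ t - Φ₁ t) : ℝ × ℝ) = (Φ₂ t - Φ₁ t) • (0, 1) := by simp
      have dV : HasDerivAt (fun s => V t (y t s)) ((Φ₂ t - Φ₁ t) * DV (t, y t s) (0, 1)) s := by
        have := (h.hasFDerivAt_factor hc).comp_hasDerivAt (f := fun s => (t, y t s)) s
          ((hasDerivAt_const s t).prodMk dy)
        rw [e, map_smul, smul_eq_mul] at this
        exact this
      have dF : HasDerivAt (fun s => F t (y t s)) ((Φ₂ t - Φ₁ t) * DF (t, y t s) (0, 1)) s := by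
        have := (h.hasFDerivAt_field hc).comp_hasDerivAt (f := fun s => (t, y t s)) s
          ((hasDerivAt_const s t).prodMk dy)
        rw [e, map_smul, smul_eq_mul] at this
        exact this
      have hv := hVne (t, s) ⟨ht, hs⟩
      simp only at hv
      have hp : DV (t, y t s) (1, 0) + F t (y t s) * DV (t, y t s) (0, 1) =
          DF (t, y t s) (0, 1) * V t (y t s) := by
        rw [← hsplit]; exact h.pde _ hc
      refine ((dy'.sub dF).mul (dV.inv hv)).congr_deriv ?_
      simp only [g']
      have e1 : DV (t, y t s) (1, 0) = DF (t, y t s) (0, 1) * V t (y t s) -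
        F t (y t s) * DV (t, y t s) (0, 1) := by linarith
      rw [e1]
      simp only [Pi.sub_apply, Pi.inv_apply]
      field_simp
      ring
    have cgt : ContinuousOn (g' t) (uIcc 0 1) := by
      rw [uIcc_of_le zero_le_one]; exact slice cg' t ht
    rw [intervalIntegral.integral_eq_sub_of_hasDerivAt hq cgt.intervalIntegrable]
    simp [y, y']
  let j : ℝ → ℝ := fun t => ∫ s in (0 : ℝ)..1, g t s
  have hjd : ∀ t ∈ Ioo a b, HasDerivAt j 0 t := by
    intro t ht
    have htI := Ioo_subset_Icc_self ht
    obtain ⟨C, hC⟩ := (isCompact_Icc.prod isCompact_Icc : IsCompact R).exists_bound_of_continuousOn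
      cg'
    have hI : uIoc (0 : ℝ) 1 ⊆ Icc 0 1 := by
      rw [uIoc_of_le zero_le_one]; exact Ioc_subset_Icc_self
    have := (intervalIntegral.hasDerivAt_integral_of_dominated_loc_of_deriv_le
      (μ := MeasureTheory.volume) (F := g) (F' := g') (x₀ := t) (s := Ioo a b) (a := 0) (b := 1)
      (bound := fun _ => C) (Ioo_mem_nhds ht.1 ht.2) ?_ ?_ ?_ ?_ ?_ ?_).2
    · rw [hzero t htI] at this; exact this
    · filter_upwards [Ioo_mem_nhds ht.1 ht.2] with u hu
      exact ((slice cg u (Ioo_subset_Icc_self hu)).mono hI).aestronglyMeasurable measurableSet_uIoc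
    · refine ContinuousOn.intervalIntegrable ?_
      rw [uIcc_of_le zero_le_one]; exact slice cg t htI
    · exact ((slice cg' t htI).mono hI).aestronglyMeasurable measurableSet_uIoc
    · exact Eventually.of_forall fun s hs u hu => hC (u, s) ⟨Ioo_subset_Icc_self hu, hI hs⟩
    · exact intervalIntegrable_const
    · exact Eventually.of_forall fun s hs u hu => hgd u hu s (hI hs)
  -- Differentiation under the integral covers the open interval only. Continuity up to the
  -- endpoints comes from clamping both variables, which gives a globally continuous integrand.
  have hjc : ContinuousOn j (Icc a b) := by
    let k : ℝ → ℝ → ℝ := fun t s => g (projIcc a b hab.le t) (projIcc 0 1 zero_le_one s)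
    have hk : Continuous k.uncurry := by
      refine cg.comp_continuous (f := fun z : ℝ × ℝ =>
        (((projIcc a b hab.le z.1 : Icc a b) : ℝ), ((projIcc 0 1 zero_le_one z.2 : Icc (0:ℝ) 1) :
            ℝ)))
        (by fun_prop) fun z => ⟨Subtype.prop _, Subtype.prop _⟩
    have hkc := intervalIntegral.continuous_parametric_intervalIntegral_of_continuous'
      (μ := MeasureTheory.volume) hk 0 1
    refine hkc.continuousOn.congr fun t ht => ?_
    refine intervalIntegral.integral_congr fun s hs => ?_
    rw [uIcc_of_le zero_le_one] at hs
    simp [k, projIcc_of_mem hab.le ht, projIcc_of_mem zero_le_one hs]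
  obtain ⟨t, ht, hslope⟩ := exists_hasDerivAt_eq_slope j (fun _ => 0) hab hjc hjd
  have hj : j a = j b := by
    have h0 : b - a ≠ 0 := sub_ne_zero.2 hab.ne'
    have := hslope.symm
    rw [div_eq_zero_iff] at this
    rcases this with h' | h'
    · linarith
    · exact absurd h' h0
  have hsubst : ∀ t, j t = ∫ s in (Φ₁ t)..(Φ₂ t), (V t s)⁻¹ := by
    intro t
    have := intervalIntegral.mul_integral_comp_add_mul (a := 0) (b := 1)
      (f := fun s => (V t s)⁻¹) (c := Φ₂ t - Φ₁ t) (Φ₁ t)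
    simp only [mul_zero, add_zero, mul_one, add_sub_cancel] at this
    rw [← this, ← intervalIntegral.integral_const_mul]
    refine intervalIntegral.integral_congr fun s _ => ?_
    simp only [g, y, mul_comm s]
  rw [← hsubst, ← hsubst, hj]

/-! ### The period of an inverse integrating factor -/

/-- Rolle's theorem for the primitive. For `f = 1 / V` it says that ∫ dρ/V is an injective
coordinate: equal translations end at equal points, and translation by 0 is the identity. -/
theorem eq_of_integral_eq_zero {f : ℝ → ℝ} {α β : ℝ} (hf : ContinuousOn f (Ioo α β))
    (hne : ∀ s ∈ Ioo α β, f s ≠ 0) {a b : ℝ} (ha : a ∈ Ioo α β) (hb : b ∈ Ioo α β)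
    (h : ∫ s in a..b, f s = 0) : a = b := by
  wlog hab : a ≤ b generalizing a b
  · exact (this hb ha (by rw [intervalIntegral.integral_symm, h, neg_zero]) (not_le.1 hab).le).symm
  by_contra hne'
  have hlt : a < b := lt_of_le_of_ne hab hne'
  have hsub : Icc a b ⊆ Ioo α β := fun s hs => ⟨ha.1.trans_le hs.1, hs.2.trans_lt hb.2⟩
  have hd : ∀ t ∈ Icc a b, HasDerivWithinAt (fun u => ∫ s in a..u, f s) (f t) (Icc a b) t :=
    fun t ht => hasDerivWithinAt_primitive (hf.mono hsub) ht
  obtain ⟨c, hc, hc0⟩ := exists_hasDerivAt_eq_zero hlt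
    (fun t ht => (hd t ht).continuousWithinAt) (by simp [h])
    (fun t ht => (hd t (Ioo_subset_Icc_self ht)).hasDerivAt (Icc_mem_nhds ht.1 ht.2))
  exact hne c (hsub (Ioo_subset_Icc_self hc)) hc0

theorem intervalIntegrable_of_continuousOn_Ioo {f : ℝ → ℝ} {α β : ℝ}
    (hf : ContinuousOn f (Ioo α β)) {a b : ℝ} (ha : a ∈ Ioo α β) (hb : b ∈ Ioo α β) :
    IntervalIntegrable f MeasureTheory.volume a b :=
  (hf.mono (ordConnected_Ioo.uIcc_subset ha hb)).intervalIntegrable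

theorem IsFactorOn.continuousOn_inv {F V : ℝ → ℝ → ℝ} {ε : ℝ} (h : IsFactorOn F V ε) {a : ℝ}
    (hV : ∀ ρ ∈ Ioo 0 ε, V a ρ ≠ 0) : ContinuousOn (fun s => (V a s)⁻¹) (Ioo 0 ε) :=
  (h.factor.continuousOn.comp (f := fun s : ℝ => (a, s)) (by fun_prop) fun _ hs => hs).inv₀ hV

/-- The integral of `1 / V` over one turn does not depend on the turn. -/
theorem IsFactorOn.exists_period {F V : ℝ → ℝ → ℝ} {ε b : ℝ} (hb : 0 < b) (h : IsFactorOn F V ε)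
    (hV : ∀ ρ ∈ Ioo 0 ε, V 0 ρ ≠ 0) (hper : ∀ ρ ∈ Ioo 0 ε, V b ρ = V 0 ρ) :
    ∃ T : ℝ, ∀ Φ, IsSolutionOn F ε 0 b Φ → ∫ s in (Φ 0)..(Φ b), (V 0 s)⁻¹ = T := by
  have key : ∀ Φ₁ Φ₂, IsSolutionOn F ε 0 b Φ₁ → IsSolutionOn F ε 0 b Φ₂ → Φ₁ 0 ≤ Φ₂ 0 →
      ∫ s in (Φ₁ 0)..(Φ₁ b), (V 0 s)⁻¹ = ∫ s in (Φ₂ 0)..(Φ₂ b), (V 0 s)⁻¹ := by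
    intro Φ₁ Φ₂ h₁ h₂ hle
    have m0 : (0 : ℝ) ∈ Icc 0 b := left_mem_Icc.2 hb.le
    have mb : b ∈ Icc 0 b := right_mem_Icc.2 hb.le
    have hc := h.continuousOn_inv hV
    have hi := fun {x y : ℝ} (hx : x ∈ Ioo 0 ε) (hy : y ∈ Ioo 0 ε) =>
      intervalIntegrable_of_continuousOn_Ioo hc hx hy
    have e := h.integral_eq hb hV h₁ h₂ hle
    have e' : ∫ s in (Φ₁ b)..(Φ₂ b), (V b s)⁻¹ = ∫ s in (Φ₁ b)..(Φ₂ b), (V 0 s)⁻¹ := by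
      refine intervalIntegral.integral_congr fun s hs => ?_
      have : s ∈ Ioo 0 ε := ordConnected_Ioo.uIcc_subset (h₁ b mb).1 (h₂ b mb).1 hs
      simp only [hper s this]
    rw [e'] at e
    -- Both sums are the integral from `Φ₁ 0` to `Φ₂ b`. The pieces between the two solutions, at
    -- angles `0` and `b`, agree by conservation and periodicity, so the pieces along the turns
    -- agree as well.
    have a1 := intervalIntegral.integral_add_adjacent_intervals
      (hi (h₁ 0 m0).1 (h₁ b mb).1) (hi (h₁ b mb).1 (h₂ b mb).1)
    have a2 := intervalIntegral.integral_add_adjacent_intervals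
      (hi (h₁ 0 m0).1 (h₂ 0 m0).1) (hi (h₂ 0 m0).1 (h₂ b mb).1)
    linarith
  by_cases hex : ∃ Φ, IsSolutionOn F ε 0 b Φ
  · obtain ⟨Φ₀, h₀⟩ := hex
    refine ⟨∫ s in (Φ₀ 0)..(Φ₀ b), (V 0 s)⁻¹, fun Φ hΦ => ?_⟩
    rcases le_total (Φ 0) (Φ₀ 0) with hle | hle
    · exact key _ _ hΦ h₀ hle
    · exact (key _ _ h₀ hΦ hle).symm
  · exact ⟨0, fun Φ hΦ => absurd ⟨Φ, hΦ⟩ hex⟩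

/-! ### The flow of `ρ ^ k * W(ρ) ∂_ρ` near `ρ = 0` -/

section

variable {Z : Type*} [NormedAddCommGroup Z] [NormedSpace ℝ Z]

/-- `G` is the time-one map of `τ ρ^k W ∂_ρ`, with `τ` and the parameter carried along as constants.
Since `k ≥ 1`, the point `(0, τ₀, l₀)` is an equilibrium, so the flow reaches time 1 near it however
large `τ₀` is. Along a trajectory with ρ > 0 the integral of `1 / (s^k W)` grows at the rate `τ`.
The clause for `k = 1` serves to compute the derivative of `G` at ρ = 0. -/
theorem AnalyticAt.exists_translation [CompleteSpace Z] {W : ℝ × Z → ℝ} {l₀ : Z} (hW :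
    AnalyticAt ℝ W (0, l₀))
    (hW0 : W (0, l₀) ≠ 0) {k : ℕ} (hk : 1 ≤ k) (τ₀ : ℝ) {δ : ℝ} (hδ : 0 < δ) :
    ∃ G : ℝ × ℝ × Z → ℝ, AnalyticAt ℝ G (0, τ₀, l₀) ∧
      ∀ᶠ z : ℝ × ℝ × Z in 𝓝 (0, τ₀, l₀),
        (z.1 = 0 → G z = 0) ∧ (z.2.1 = 0 → G z = z.1) ∧
        (0 < z.1 → G z ∈ Ioo 0 δ ∧ ∫ s in (z.1)..(G z), (s ^ k * W (s, z.2.2))⁻¹ = z.2.1) ∧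
        (k = 1 → 0 < z.1 → ∃ x ∈ Ioo 0 δ, x ≤ z.1 * Real.exp ((|τ₀| + 1) * (|W (0, l₀)| + 1)) ∧
          G z = z.1 * Real.exp (z.2.1 * W (x, z.2.2))) := by
  let f : ℝ × ℝ × Z → ℝ × ℝ × Z := fun x => (x.2.1 * x.1 ^ k * W (x.1, x.2.2), 0)
  let π : ℝ × ℝ × Z → ℝ × Z := fun x => (x.1, x.2.2)
  have hπ : Continuous π := by fun_prop
  have hπa : ∀ x, AnalyticAt ℝ π x := fun x =>
    analyticAt_fst.prod (analyticAt_snd.comp_of_eq analyticAt_snd rfl)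
  -- a convex neighbourhood on which `W` is analytic, bounded and nonzero
  obtain ⟨r, hr, hball⟩ := Metric.eventually_nhds_iff.1 (hW.eventually_analyticAt.and
    ((hW.continuousAt.eventually_ne hW0).and (hW.continuousAt.abs.eventually_lt
      (continuousAt_const (y := |W (0, l₀)| + 1)) (lt_add_one _))))
  let r' := min r δ
  have hr' : 0 < r' := lt_min hr hδ
  -- Besides analyticity, staying in `O` bounds `|τ|` and `|W|`; these bounds give the exponential
  -- estimate for `k = 1`.
  let O : Set (ℝ × ℝ × Z) := {x | π x ∈ Metric.ball (0, l₀) r' ∧ |x.2.1| < |τ₀| + 1}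
  have hO : IsOpen O := (Metric.isOpen_ball.preimage hπ).inter
    (isOpen_lt (f := fun x : ℝ × ℝ × Z => |x.2.1|) (by fun_prop) continuous_const)
  have hOball : ∀ x ∈ O, dist (π x) (0, l₀) < r := fun x hx => hx.1.trans_le (min_le_left _ _)
  have hf : AnalyticOnNhd ℝ f O := by
    intro x hx
    have h1 : AnalyticAt ℝ (fun x : ℝ × ℝ × Z => x.2.1) x :=
      analyticAt_fst.comp_of_eq analyticAt_snd rfl
    have h2 : AnalyticAt ℝ (fun x => W (π x)) x :=
      (hball (hOball x hx)).1.comp_of_eq (hπa x) rfl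
    exact ((h1.mul (analyticAt_fst.pow k)).mul h2).prod analyticAt_const
  have hbase : ((0, τ₀, l₀) : ℝ × ℝ × Z) ∈ O := by
    refine ⟨by simpa [π] using hr', ?_⟩
    simp
  obtain ⟨g, hg, -, hev⟩ := hasAnalyticFlow hO hf zero_le_one (γ := fun _ => (0, τ₀, l₀))
    (fun _ _ => hbase) (fun t _ => by
      have : f (0, τ₀, l₀) = 0 := by simp [f, show k ≠ 0 by omega]
      rw [this]; exact hasDerivWithinAt_const _ _ _)
  refine ⟨fun z => (g z).1, analyticAt_fst.comp_of_eq hg rfl, ?_⟩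
  filter_upwards [hev] with z ⟨Y, Y0, Y1, hY⟩
  have e2 : ∀ t ∈ Icc (0 : ℝ) 1, (Y t).2 = z.2 := by
    intro t ht
    refine eqOn_of_hasDerivWithinAt_eq (g₁ := fun t => (Y t).2) (g₂ := fun _ => z.2)
      (g' := fun _ => 0) (fun t ht => ?_) (fun t ht => hasDerivWithinAt_const _ _ _)
      (by simp [Y0]) ht
    exact ((ContinuousLinearMap.snd ℝ ℝ (ℝ × Z)).hasFDerivAt.comp_hasDerivWithinAt t (hY t ht).2)
  let y : ℝ → ℝ := fun t => (Y t).1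
  obtain ⟨ρ, τ, l⟩ := z
  simp only at e2 Y0 Y1 ⊢
  have y0 : y 0 = ρ := by simp [y, Y0]
  have y1 : y 1 = (g (ρ, τ, l)).1 := by simp [y, Y1]
  have hyd : ∀ t ∈ Icc (0 : ℝ) 1,
      HasDerivWithinAt y (τ * y t ^ k * W (y t, l)) (Icc 0 1) t := by
    intro t ht
    have := (ContinuousLinearMap.fst ℝ ℝ (ℝ × Z)).hasFDerivAt.comp_hasDerivWithinAt t (hY t ht).2
    simp only [f, ContinuousLinearMap.coe_fst', e2 t ht] at this
    exact this
  have hyball : ∀ t ∈ Icc (0 : ℝ) 1, dist (y t, l) (0, l₀) < r' := by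
    intro t ht
    have := (hY t ht).1.1
    simp only [π, e2 t ht, Metric.mem_ball] at this
    exact this
  have hτ : |τ| < |τ₀| + 1 := by
    have := (hY 0 (by simp)).1.2
    simpa [Y0] using this
  have hyδ : ∀ t ∈ Icc (0 : ℝ) 1, |y t| < δ := by
    intro t ht
    have h1 := (hyball t ht).trans_le (min_le_right _ _)
    rw [Prod.dist_eq] at h1
    simpa using (le_max_left _ _).trans_lt h1
  have hyW : ∀ t ∈ Icc (0 : ℝ) 1, AnalyticAt ℝ W (y t, l) ∧ W (y t, l) ≠ 0 ∧
      |W (y t, l)| < |W (0, l₀)| + 1 := fun t ht =>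
    hball ((hyball t ht).trans_le (min_le_left _ _))
  have cy : ContinuousOn y (Icc 0 1) := fun t ht => (hyd t ht).continuousWithinAt
  have cW : ContinuousOn (fun t => W (y t, l)) (Icc 0 1) := fun t ht =>
    (hyW t ht).1.continuousAt.comp_continuousWithinAt (f := fun t => (y t, l))
      ((cy t ht).prodMk continuousWithinAt_const)
  -- Read as a linear equation for `y`: the solution is its initial value times an exponential, so
  -- zero stays zero and positive stays positive.
  have hlin : ∀ t ∈ Icc (0 : ℝ) 1, HasDerivWithinAt y
      ((τ * y t ^ (k - 1) * W (y t, l)) * y t) (Icc 0 1) t := by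
    intro t ht
    refine (hyd t ht).congr_deriv ?_
    obtain ⟨n, rfl⟩ : ∃ n, k = n + 1 := ⟨k - 1, by omega⟩
    rw [Nat.add_sub_cancel, pow_succ]; ring
  have hexp := fun {t : ℝ} (ht : t ∈ Icc (0 : ℝ) 1) => eq_mul_exp_of_hasDerivWithinAt
    ((continuousOn_const.mul (cy.pow (k - 1))).mul cW) hlin ht
  have h1mem : (1 : ℝ) ∈ Icc (0 : ℝ) 1 := by simp
  refine ⟨fun h => ?_, fun h => ?_, fun h => ?_, fun hk1 h => ?_⟩
  · rw [← y1, hexp h1mem, y0, h, zero_mul]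
  · have := eqOn_of_hasDerivWithinAt_eq (g₁ := y) (g₂ := fun _ => ρ) (g' := fun _ => 0)
      (fun t ht => by simpa [h] using hyd t ht) (fun t _ => hasDerivWithinAt_const _ _ _) y0 h1mem
    rw [← y1, this]
  all_goals
    have hpos : ∀ t ∈ Icc (0 : ℝ) 1, 0 < y t := by
      intro t ht
      rw [hexp ht, y0]; positivity
    have hypos : ∀ t ∈ Icc (0 : ℝ) 1, y t ∈ Ioo 0 δ := fun t ht =>
      ⟨hpos t ht, (abs_lt.1 (hyδ t ht)).2⟩
  · rw [← y1]
    refine ⟨hypos 1 h1mem, ?_⟩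
    -- a primitive along the solution
    have hIoo : ∀ s ∈ Ioo 0 r', AnalyticAt ℝ W (s, l) ∧ W (s, l) ≠ 0 := by
      intro s hs
      have hl : dist l l₀ < r' := by
        have h1 := hyball 0 (by simp)
        rw [Prod.dist_eq] at h1
        exact (le_max_right _ _).trans_lt h1
      have : dist ((s, l) : ℝ × Z) (0, l₀) < r := by
        rw [Prod.dist_eq]
        refine (max_lt ?_ hl).trans_le (min_le_left _ _)
        simpa [abs_of_pos hs.1] using hs.2
      exact ⟨(hball this).1, (hball this).2.1⟩
    have hyr : ∀ t ∈ Icc (0 : ℝ) 1, y t ∈ Ioo 0 r' := by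
      intro t ht
      refine ⟨hpos t ht, ?_⟩
      have h1 := hyball t ht
      rw [Prod.dist_eq] at h1
      have h2 := (le_max_left _ _).trans_lt h1
      simp only [dist_zero_right, Real.norm_eq_abs] at h2
      exact (abs_lt.1 h2).2
    have hq : ∀ s ∈ Ioo 0 r', ContinuousAt (fun s => (s ^ k * W (s, l))⁻¹) s := by
      intro s hs
      have : ContinuousAt (fun s => W (s, l)) s :=
        (hIoo s hs).1.continuousAt.comp (f := fun s => (s, l)) (by fun_prop)
      exact ((continuousAt_id.pow k).mul this).inv₀
        (mul_ne_zero (pow_ne_zero _ hs.1.ne') (hIoo s hs).2)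
    have hqc : ContinuousOn (fun s => (s ^ k * W (s, l))⁻¹) (Ioo 0 r') := fun s hs =>
      (hq s hs).continuousWithinAt
    have hρ : ρ ∈ Ioo 0 r' := y0 ▸ hyr 0 (by simp)
    have hu : ∀ t ∈ Icc (0 : ℝ) 1, HasDerivWithinAt
        (fun t => ∫ s in ρ..(y t), (s ^ k * W (s, l))⁻¹) τ (Icc 0 1) t := by
      intro t ht
      have hi := intervalIntegrable_of_continuousOn_Ioo hqc hρ (hyr t ht)
      have h1 : HasDerivAt (fun u => ∫ s in ρ..u, (s ^ k * W (s, l))⁻¹)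
          ((y t ^ k * W (y t, l))⁻¹) (y t) := by
        refine intervalIntegral.integral_hasDerivAt_right hi ?_ (hq _ (hyr t ht))
        exact hqc.stronglyMeasurableAtFilter isOpen_Ioo _ (hyr t ht)
      have h2 := h1.comp_hasDerivWithinAt t (hyd t ht)
      refine h2.congr_deriv ?_
      have := mul_ne_zero (pow_ne_zero k (hpos t ht).ne') (hyW t ht).2.1
      rw [mul_assoc, mul_comm τ, ← mul_assoc, inv_mul_cancel₀ this, one_mul]
    have := eqOn_of_hasDerivWithinAt_eq hu (g₂ := fun t => τ * t)
      (fun t _ => by simpa using ((hasDerivAt_id t).const_mul τ).hasDerivWithinAt)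
      (by simp [y0]) h1mem
    simpa using this
  · subst hk1
    -- For `k = 1` the logarithm of `y` has derivative `τ W(y)`. The mean value theorem on [0, 1]
    -- gives the formula with `x = y s`; applied again on `[0, s]` it bounds `x` by a multiple of ρ.
    have hlog : ∀ t ∈ Icc (0 : ℝ) 1,
        HasDerivWithinAt (fun t => Real.log (y t)) (τ * W (y t, l)) (Icc 0 1) t := by
      intro t ht
      refine ((hyd t ht).log (hpos t ht).ne').congr_deriv ?_
      have := (hpos t ht).ne'
      field_simp
    have hmv : ∀ t ∈ Ioc (0 : ℝ) 1, ∃ s ∈ Ioo 0 t,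
        y t = ρ * Real.exp (τ * W (y s, l) * t) := by
      intro t ht
      have hsub : Icc 0 t ⊆ Icc (0 : ℝ) 1 := Icc_subset_Icc_right ht.2
      obtain ⟨s, hs, hsl⟩ := exists_hasDerivAt_eq_slope (fun t => Real.log (y t))
        (fun t => τ * W (y t, l)) ht.1
        (fun s hs => (hlog s (hsub hs)).continuousWithinAt.mono hsub)
        (fun s hs => (hlog s (hsub (Ioo_subset_Icc_self hs))).hasDerivAt
          (Icc_mem_nhds hs.1 (hs.2.trans_le ht.2)))
      refine ⟨s, hs, ?_⟩
      rw [sub_zero, eq_div_iff ht.1.ne', y0] at hsl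
      rw [hsl, Real.exp_sub, Real.exp_log (hpos t (Ioc_subset_Icc_self ht)), Real.exp_log h]
      field_simp
    obtain ⟨s, hs, hs1⟩ := hmv 1 (by simp)
    have hsI : s ∈ Icc (0 : ℝ) 1 := Ioo_subset_Icc_self hs
    refine ⟨y s, hypos s hsI, ?_, by rw [← y1, hs1, mul_one]⟩
    obtain ⟨s', hs', he⟩ := hmv s ⟨hs.1, hs.2.le⟩
    have hs'I : s' ∈ Icc (0 : ℝ) 1 := ⟨hs'.1.le, hs'.2.le.trans hs.2.le⟩
    rw [he]
    refine mul_le_mul_of_nonneg_left (Real.exp_le_exp.2 ?_) h.le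
    calc τ * W (y s', l) * s ≤ |τ * W (y s', l) * s| := le_abs_self _
      _ = |τ| * |W (y s', l)| * s := by rw [abs_mul, abs_mul, abs_of_pos hs.1]
      _ ≤ (|τ₀| + 1) * (|W (0, l₀)| + 1) * 1 := by
        have h1 := (hyW s' hs'I).2.2.le
        have h2 := hs.1.le
        have h3 := hs.2.le
        gcongr
      _ = _ := mul_one _

/-! ### Expansions in the first variable -/

/-- The Taylor coefficients in the first variable are analytic. -/
theorem AnalyticAt.exists_coeff [CompleteSpace Z] {H : ℝ × Z → ℝ} {z₀ : Z} (hH :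
    AnalyticAt ℝ H (0, z₀)) :
    ∃ c : ℕ → Z → ℝ, (∀ k, AnalyticAt ℝ (c k) z₀) ∧ ∀ N, ∃ R : ℝ × Z → ℝ,
      AnalyticAt ℝ R (0, z₀) ∧ ∀ᶠ z in 𝓝 ((0, z₀) : ℝ × Z),
        H z = ∑ i ∈ Finset.range N, c i z.2 * z.1 ^ i + z.1 ^ N * R z := by
  -- `q` splits off the value at 0 and divides by the first variable; iterating it produces the
  -- coefficients as values at 0, and the remainders.
  choose! q hq hqe using fun (f : ℝ × Z → ℝ) (hf : AnalyticAt ℝ f (0, z₀)) => hf.exists_eq_add_mul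
  have hit : ∀ n, AnalyticAt ℝ (q^[n] H) (0, z₀) := by
    intro n
    induction n with
    | zero => exact hH
    | succ n ih => rw [Function.iterate_succ_apply']; exact hq _ ih
  refine ⟨fun k z => (q^[k] H) (0, z), fun k => ?_, fun N => ⟨q^[N] H, hit N, ?_⟩⟩
  · exact (hit k).comp_of_eq (analyticAt_const.prod analyticAt_id) rfl
  · induction N with
    | zero => simp
    | succ N ih =>
      filter_upwards [ih, hqe _ (hit N)] with z h1 h2
      rw [h1, Finset.sum_range_succ, Function.iterate_succ_apply', h2]
      ring

end

theorem eq_zero_of_sum_isBigO {N : ℕ} {a : ℕ → ℝ}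
    (h : (fun ρ : ℝ => ∑ i ∈ Finset.range N, a i * ρ ^ i) =O[𝓝[>] 0] fun ρ => ρ ^ N) :
    ∀ i < N, a i = 0 := by
  induction N generalizing a with
  | zero => simp
  | succ N ih =>
    have h0 : a 0 = 0 := by
      have h1 : Tendsto (fun ρ : ℝ => ∑ i ∈ Finset.range (N + 1), a i * ρ ^ i) (𝓝[>] 0) (𝓝 0) := by
        refine h.trans_tendsto ?_
        have : Tendsto (fun ρ : ℝ => ρ ^ (N + 1)) (𝓝 0) (𝓝 (0 ^ (N + 1))) :=
          (continuous_pow (N + 1)).tendsto 0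
        simpa using this.mono_left nhdsWithin_le_nhds
      have h2 : Tendsto (fun ρ : ℝ => ∑ i ∈ Finset.range (N + 1), a i * ρ ^ i) (𝓝[>] 0)
          (𝓝 (∑ i ∈ Finset.range (N + 1), a i * (0 : ℝ) ^ i)) :=
        (Continuous.tendsto (by fun_prop) 0).mono_left nhdsWithin_le_nhds
      have := tendsto_nhds_unique h1 h2
      rw [Finset.sum_range_succ'] at this
      simpa using this.symm
    have hstep := ih (a := fun i => a (i + 1)) (by
      have hinv : (fun ρ : ℝ => ρ⁻¹) =O[𝓝[>] 0] fun ρ : ℝ => ρ⁻¹ := Asymptotics.isBigO_refl _ _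
      refine (hinv.mul h).congr' ?_ ?_
      · filter_upwards [self_mem_nhdsWithin] with ρ hρ
        have hρ0 : ρ ≠ 0 := (mem_Ioi.1 hρ).ne'
        rw [Finset.sum_range_succ', h0, zero_mul, add_zero, Finset.mul_sum]
        refine Finset.sum_congr rfl fun i _ => ?_
        rw [pow_succ]; field_simp
      · filter_upwards [self_mem_nhdsWithin] with ρ hρ
        have hρ0 : ρ ≠ 0 := (mem_Ioi.1 hρ).ne'
        rw [pow_succ]; field_simp)
    intro i hi
    rcases Nat.eq_zero_or_pos i with rfl | hpos
    · exact h0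
    · obtain ⟨j, rfl⟩ : ∃ j, i = j + 1 := ⟨i - 1, by omega⟩
      exact hstep j (by omega)

theorem eventually_nhds_slice {A B : Type*} [TopologicalSpace A] [TopologicalSpace B] {a : A}
    {b : B} {Q : A × B → Prop} (h : ∀ᶠ z in 𝓝 (a, b), Q z) :
    ∀ᶠ y in 𝓝 b, ∀ᶠ x in 𝓝 a, Q (x, y) := by
  rw [nhds_prod_eq, eventually_swap_iff] at h
  exact h.curry

/-! ### Asymptotic expansions at `0⁺` -/

theorem sum_Icc_eq_sum_range (c : ℕ → ℝ) (N : ℕ) (ρ : ℝ) :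
    ∑ i ∈ Finset.Icc 1 N, c i * ρ ^ i =
      ∑ i ∈ Finset.range (N + 1), (if i = 0 then 0 else c i) * ρ ^ i := by
  rw [Finset.sum_range_succ', Finset.range_eq_Ico,
    Finset.sum_Ico_add' (fun i => (if i = 0 then 0 else c i) * ρ ^ i) 0 N 1]
  simp only [if_true, zero_mul, add_zero, zero_add]
  refine Finset.sum_congr (by ext; simp) fun i hi => ?_
  rw [if_neg (by have := (Finset.mem_Ico.1 hi).1; omega)]

theorem coeff_unique {f : ℝ → ℝ} {N : ℕ} {a b : ℕ → ℝ}
    (ha : (fun ρ => f ρ - ∑ i ∈ Finset.range N, a i * ρ ^ i) =O[𝓝[>] (0 : ℝ)] fun ρ => ρ ^ N)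
    (hb : (fun ρ => f ρ - ∑ i ∈ Finset.range N, b i * ρ ^ i) =O[𝓝[>] (0 : ℝ)] fun ρ => ρ ^ N) :
    ∀ i < N, a i = b i := by
  intro i hi
  refine sub_eq_zero.1 (eq_zero_of_sum_isBigO (a := fun i => a i - b i) ?_ i hi)
  refine (hb.sub ha).congr_left fun ρ => ?_
  simp only [sub_mul, Finset.sum_sub_distrib]
  ring

theorem tendsto_div_of_isBigO {f : ℝ → ℝ} {k : ℕ} {L : ℝ}
    (h : (fun ρ => f ρ - L * ρ ^ k) =O[𝓝[>] (0 : ℝ)] fun ρ => ρ ^ (k + 1)) :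
    Tendsto (fun ρ => f ρ / ρ ^ k) (𝓝[>] 0) (𝓝 L) := by
  have h1 : (fun ρ : ℝ => (ρ ^ k)⁻¹) =O[𝓝[>] (0 : ℝ)] fun ρ => (ρ ^ k)⁻¹ :=
    Asymptotics.isBigO_refl _ _
  have h2 : (fun ρ => f ρ / ρ ^ k - L) =O[𝓝[>] (0 : ℝ)] fun ρ => ρ := by
    refine (h.mul h1).congr' ?_ ?_
    all_goals
      filter_upwards [self_mem_nhdsWithin] with ρ hρ
      have hρ0 : ρ ≠ 0 := (mem_Ioi.1 hρ).ne'
    · field_simp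
    · rw [pow_succ]; field_simp
  have h3 : Tendsto (fun ρ : ℝ => ρ) (𝓝[>] 0) (𝓝 0) := tendsto_id.mono_left nhdsWithin_le_nhds
  have h4 := (h2.trans_tendsto h3).add_const L
  simpa using h4

/-! ### Return maps that are translations in the coordinate `∫ dρ / V` -/

theorem exists_mean_value {f : ℝ → ℝ} {α β : ℝ} (hf : ContinuousOn f (Ioo α β)) {a b : ℝ}
    (ha : a ∈ Ioo α β) (hb : b ∈ Ioo α β) : ∃ c ∈ uIcc a b, ∫ s in a..b, f s = f c * (b - a) := by
  wlog hab : a ≤ b generalizing a b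
  · obtain ⟨c, hc, he⟩ := this hb ha (not_le.1 hab).le
    refine ⟨c, uIcc_comm a b ▸ hc, ?_⟩
    rw [intervalIntegral.integral_symm, he]; ring
  rcases hab.eq_or_lt with rfl | hlt
  · exact ⟨a, by simp, by simp⟩
  have hsub : Icc a b ⊆ Ioo α β := fun s hs => ⟨ha.1.trans_le hs.1, hs.2.trans_lt hb.2⟩
  have hd : ∀ t ∈ Icc a b, HasDerivWithinAt (fun u => ∫ s in a..u, f s) (f t) (Icc a b) t :=
    fun t ht => hasDerivWithinAt_primitive (hf.mono hsub) ht
  obtain ⟨c, hc, he⟩ := exists_hasDerivAt_eq_slope _ f hlt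
    (fun t ht => (hd t ht).continuousWithinAt)
    (fun t ht => (hd t (Ioo_subset_Icc_self ht)).hasDerivAt (Icc_mem_nhds ht.1 ht.2))
  refine ⟨c, by rw [uIcc_of_le hab]; exact Ioo_subset_Icc_self hc, ?_⟩
  rw [he, intervalIntegral.integral_same, sub_zero, div_mul_cancel₀ _ (sub_ne_zero.2 hlt.ne')]

theorem continuousOn_zpow_mul_inv {W : ℝ → ℝ} {δ : ℝ} (hc : ContinuousOn W (Ioo 0 δ))
    (hW : ∀ s ∈ Ioo 0 δ, W s ≠ 0) (m : ℤ) :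
    ContinuousOn (fun s => (s ^ m * W s)⁻¹) (Ioo 0 δ) := by
  refine ContinuousOn.inv₀ (ContinuousOn.mul (fun s hs => ?_) hc) fun s hs => ?_
  · exact (continuousAt_zpow₀ s m (Or.inl hs.1.ne')).continuousWithinAt
  · exact mul_ne_zero (zpow_ne_zero m hs.1.ne') (hW s hs)

/-- If `1 / V` is bounded near `0` then the translation is trivial. -/
theorem translation_eq_zero {W p : ℝ → ℝ} {δ T : ℝ} {m : ℤ} (hm : m ≤ 0)
    (hc : ContinuousOn W (Ioo 0 δ)) (hW : ∀ s ∈ Ioo 0 δ, W s ≠ 0) (hc0 : ContinuousAt W 0)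
    (hW0 : W 0 ≠ 0) (hp0 : Tendsto p (𝓝[>] 0) (𝓝 0))
    (hp : ∀ᶠ ρ in 𝓝[>] 0, p ρ ∈ Ioo 0 δ ∧ ∫ s in ρ..(p ρ), (s ^ m * W s)⁻¹ = T) : T = 0 := by
  obtain ⟨n, rfl⟩ : ∃ n : ℕ, m = -(n : ℤ) := ⟨m.natAbs, by omega⟩
  have hid : Tendsto (fun ρ : ℝ => ρ) (𝓝[>] 0) (𝓝 0) := tendsto_id.mono_left nhdsWithin_le_nhds
  have hδ : 0 < δ := by
    obtain ⟨ρ, hρ, -⟩ := hp.exists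
    exact hρ.1.trans hρ.2
  have hcf := continuousOn_zpow_mul_inv hc hW (-(n : ℤ))
  -- With `m = -n` the integrand at `c` is `c^n / W(c)`, which stays bounded, while the interval
  -- from ρ to `p ρ` shrinks to a point.
  have hmv : ∀ᶠ ρ in 𝓝[>] (0 : ℝ), ∃ c ∈ uIcc ρ (p ρ),
      T = (c ^ (-(n : ℤ)) * W c)⁻¹ * (p ρ - ρ) := by
    filter_upwards [hp, Ioo_mem_nhdsGT hδ] with ρ h1 h2
    rw [← h1.2]
    exact exists_mean_value hcf h2 h1.1
  obtain ⟨c, hcc⟩ := hmv.choice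
  have hclim : Tendsto c (𝓝[>] 0) (𝓝 0) := by
    have hmin : Tendsto (fun ρ => min ρ (p ρ)) (𝓝[>] 0) (𝓝 0) := by simpa using hid.min hp0
    have hmax : Tendsto (fun ρ => max ρ (p ρ)) (𝓝[>] 0) (𝓝 0) := by simpa using hid.max hp0
    refine tendsto_of_tendsto_of_tendsto_of_le_of_le' hmin hmax ?_ ?_
    · filter_upwards [hcc] with ρ h using h.1.1
    · filter_upwards [hcc] with ρ h using h.1.2
  have hlim : Tendsto (fun ρ => (c ρ ^ n * (W (c ρ))⁻¹) * (p ρ - ρ)) (𝓝[>] 0)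
      (𝓝 ((0 ^ n * (W 0)⁻¹) * (0 - 0))) :=
    ((hclim.pow n).mul ((hc0.tendsto.comp hclim).inv₀ hW0)).mul (hp0.sub hid)
  rw [sub_zero, mul_zero] at hlim
  refine tendsto_nhds_unique (tendsto_const_nhds (x := T) (f := 𝓝[>] (0 : ℝ))) (hlim.congr' ?_)
  filter_upwards [hcc] with ρ h
  rw [h.2, zpow_neg, zpow_natCast, mul_inv, inv_inv]

/-- The leading coefficient of a translation. -/
theorem tendsto_translation {W p : ℝ → ℝ} {δ T : ℝ} {k : ℕ} (hk : 2 ≤ k)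
    (hc : ContinuousOn W (Ioo 0 δ)) (hW : ∀ s ∈ Ioo 0 δ, W s ≠ 0) (hc0 : ContinuousAt W 0)
    (hpO : p =O[𝓝[>] 0] fun ρ => ρ)
    (hp : ∀ᶠ ρ in 𝓝[>] 0, p ρ ∈ Ioo 0 δ ∧ ∫ s in ρ..(p ρ), (s ^ (k : ℤ) * W s)⁻¹ = T) :
    (fun ρ => p ρ - ρ) =O[𝓝[>] 0] (fun ρ => ρ ^ k) ∧
      Tendsto (fun ρ => (p ρ - ρ) / ρ ^ k) (𝓝[>] 0) (𝓝 (T * W 0)) := by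
  have hid : Tendsto (fun ρ : ℝ => ρ) (𝓝[>] 0) (𝓝 0) := tendsto_id.mono_left nhdsWithin_le_nhds
  have hδ : 0 < δ := by
    obtain ⟨ρ, hρ, -⟩ := hp.exists
    exact hρ.1.trans hρ.2
  have hcf := continuousOn_zpow_mul_inv hc hW (k : ℤ)
  have hmv : ∀ᶠ ρ in 𝓝[>] (0 : ℝ), ∃ c, c ∈ uIcc ρ (p ρ) ∧ p ρ - ρ = T * (c ^ k * W c) := by
    filter_upwards [hp, Ioo_mem_nhdsGT hδ] with ρ h1 h2
    obtain ⟨c, hcm, he⟩ := exists_mean_value hcf h2 h1.1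
    have hcI := ordConnected_Ioo.uIcc_subset h2 h1.1 hcm
    refine ⟨c, hcm, ?_⟩
    have hne : c ^ (k : ℤ) * W c ≠ 0 := mul_ne_zero (zpow_ne_zero _ hcI.1.ne') (hW c hcI)
    rw [h1.2] at he
    rw [zpow_natCast] at he hne
    rw [he, mul_comm, ← mul_assoc, mul_inv_cancel₀ hne, one_mul]
  obtain ⟨c, hcc⟩ := hmv.choice
  have hcO : c =O[𝓝[>] 0] fun ρ : ℝ => ρ := by
    obtain ⟨C, hC⟩ := hpO.bound
    refine Asymptotics.IsBigO.of_bound (max 1 C) ?_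
    filter_upwards [hcc, hC, self_mem_nhdsWithin, hp] with ρ h1 h2 h3 h4
    have hρ : 0 < ρ := h3
    have hle := h1.1.2
    have hge := h1.1.1
    have hcpos : 0 < c ρ := (lt_min hρ h4.1.1).trans_le hge
    rw [Real.norm_eq_abs, Real.norm_eq_abs, abs_of_pos hcpos, abs_of_pos hρ]
    rw [Real.norm_eq_abs, Real.norm_eq_abs, abs_of_pos h4.1.1, abs_of_pos hρ] at h2
    refine hle.trans (max_le ?_ ?_)
    · nlinarith [le_max_left 1 C]
    · nlinarith [le_max_right 1 C]
  have hclim : Tendsto c (𝓝[>] 0) (𝓝 0) := hcO.trans_tendsto hid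
  have hWlim : Tendsto (fun ρ => W (c ρ)) (𝓝[>] 0) (𝓝 (W 0)) := hc0.tendsto.comp hclim
  have hdO : (fun ρ => p ρ - ρ) =O[𝓝[>] 0] fun ρ : ℝ => ρ ^ k := by
    have h1 : (fun ρ => T * (c ρ ^ k * W (c ρ))) =O[𝓝[>] 0] fun ρ : ℝ => 1 * (ρ ^ k * 1) :=
      (Asymptotics.isBigO_const_const T one_ne_zero _).mul ((hcO.pow k).mul (hWlim.isBigO_one ℝ))
    refine h1.congr' ?_ (Eventually.of_forall fun ρ => by simp)
    filter_upwards [hcc] with ρ h using h.2.symm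
  refine ⟨hdO, ?_⟩
  have hdo : (fun ρ => p ρ - ρ) =o[𝓝[>] 0] fun ρ : ℝ => ρ := by
    refine hdO.trans_isLittleO ?_
    have := (Asymptotics.isLittleO_pow_pow (𝕜 := ℝ) (show 1 < k by omega)).mono
      (nhdsWithin_le_nhds (s := Ioi 0))
    simpa using this
  -- As `k ≥ 2`, the displacement is o(ρ). The intermediate point is thus asymptotic to ρ, and `c^k
  -- W(c)` may be replaced by `ρ^k W(0)` in the limit.
  have hco : (fun ρ => c ρ - ρ) =o[𝓝[>] 0] fun ρ : ℝ => ρ := by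
    refine Asymptotics.IsBigO.trans_isLittleO ?_ hdo
    refine Asymptotics.IsBigO.of_bound 1 ?_
    filter_upwards [hcc] with ρ h
    rw [one_mul]
    exact abs_sub_left_of_mem_uIcc h.1
  have hratio : Tendsto (fun ρ => c ρ / ρ) (𝓝[>] 0) (𝓝 1) := by
    have h1 := hco.tendsto_div_nhds_zero.add_const 1
    rw [zero_add] at h1
    refine h1.congr' ?_
    filter_upwards [self_mem_nhdsWithin] with ρ hρ
    have : ρ ≠ 0 := (mem_Ioi.1 hρ).ne'
    field_simp; ring
  have hlim := (hratio.pow k).mul hWlim |>.const_mul T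
  rw [one_pow, one_mul] at hlim
  refine hlim.congr' ?_
  filter_upwards [hcc] with ρ h
  rw [h.2, div_pow]; ring

/-! ### Translations depending on a parameter -/

section

variable {Z : Type*} [NormedAddCommGroup Z] [NormedSpace ℝ Z]

/-- `Π(·; l)` is, near `l₀` and for small `ρ > 0`, the translation by `T(l)` in the coordinate
`∫ dρ / (ρ ^ m * W(ρ, l))`. -/
structure IsTranslationNear (m : ℤ) (W : ℝ × Z → ℝ) (T : Z → ℝ) (p : Z → ℝ → ℝ) (δ : ℝ)
    (l₀ : Z) : Prop where
  pos : 0 < δ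
  factor : AnalyticAt ℝ W (0, l₀)
  factor_ne : W (0, l₀) ≠ 0
  cont : ∀ᶠ l in 𝓝 l₀, ContinuousOn (fun s => W (s, l)) (Ioo 0 δ) ∧
    ∀ s ∈ Ioo 0 δ, W (s, l) ≠ 0
  period : AnalyticAt ℝ T l₀
  map : ∀ᶠ l in 𝓝 l₀, Tendsto (p l) (𝓝[>] 0) (𝓝 0) ∧ ∀ᶠ ρ in 𝓝[>] (0 : ℝ),
    p l ρ ∈ Ioo 0 δ ∧ ∫ s in ρ..(p l ρ), (s ^ m * W (s, l))⁻¹ = T l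

variable {m : ℤ} {W : ℝ × Z → ℝ} {T : Z → ℝ} {p : Z → ℝ → ℝ} {δ : ℝ} {l₀ : Z}

theorem IsTranslationNear.factor_near (h : IsTranslationNear m W T p δ l₀) :
    ∀ᶠ l in 𝓝 l₀, ContinuousAt (fun s => W (s, l)) 0 ∧ W (0, l) ≠ 0 := by
  have hins : ContinuousAt (fun l : Z => ((0 : ℝ), l)) l₀ := by fun_prop
  filter_upwards [hins.eventually h.factor.eventually_analyticAt,
    hins.eventually (h.factor.continuousAt.eventually_ne h.factor_ne)] with l h1 h2
  exact ⟨h1.continuousAt.comp (f := fun s : ℝ => (s, l)) (by fun_prop), h2⟩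

/-- The map is the restriction of an analytic function of `(ρ, T(l), l)`. -/
theorem IsTranslationNear.exists_analytic [CompleteSpace Z] (h : IsTranslationNear m W T p δ l₀) :
    ∃ G : ℝ × ℝ × Z → ℝ, AnalyticAt ℝ G (0, T l₀, l₀) ∧
      (∀ᶠ z : ℝ × ℝ × Z in 𝓝 (0, T l₀, l₀), (z.1 = 0 → G z = 0) ∧ (z.2.1 = 0 → G z = z.1)) ∧
      (∀ᶠ l in 𝓝 l₀, ∀ᶠ ρ in 𝓝[>] (0 : ℝ), p l ρ = G (ρ, T l, l)) ∧
      (m ≤ 0 → ∀ᶠ l in 𝓝 l₀, T l = 0) ∧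
      (m = 1 → ∀ᶠ l in 𝓝 l₀, Tendsto (fun ρ => p l ρ / ρ) (𝓝[>] 0)
        (𝓝 (Real.exp (T l * W (0, l))))) := by
  rcases le_or_gt m 0 with hm | hm
  · have hT : ∀ᶠ l in 𝓝 l₀, T l = 0 := by
      filter_upwards [h.cont, h.factor_near, h.map] with l h1 h2 h3
      exact translation_eq_zero hm h1.1 h1.2 h2.1 h2.2 h3.1 h3.2
    -- For `m ≤ 0` the period vanishes near `l₀`, and the map is the identity.
    refine ⟨fun z => z.1, analyticAt_fst, Eventually.of_forall fun z => ⟨fun h => h, fun _ => rfl⟩,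
      ?_, fun _ => hT, fun h => by omega⟩
    filter_upwards [hT, h.map, h.cont] with l h1 h2 h3
    filter_upwards [h2.2, Ioo_mem_nhdsGT h.pos] with ρ h4 h5
    refine (eq_of_integral_eq_zero (continuousOn_zpow_mul_inv h3.1 h3.2 m) (fun s hs => ?_) h5 h4.1
      (h4.2.trans h1)).symm
    exact inv_ne_zero (mul_ne_zero (zpow_ne_zero _ hs.1.ne') (h3.2 s hs))
  · obtain ⟨k, rfl⟩ : ∃ k : ℕ, m = k := ⟨m.toNat, by omega⟩
    have hk : 1 ≤ k := by omega
    obtain ⟨G, hG, hGe⟩ := h.factor.exists_translation h.factor_ne hk (T l₀) h.pos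
    have hcurve : ContinuousAt (fun l => (T l, l)) l₀ :=
        h.period.continuousAt.prodMk continuousAt_id
    have hsl := hcurve.eventually (eventually_nhds_slice hGe)
    -- The return map and `G` at time `T l` translate ρ by the same amount, so injectivity of ∫ dρ/V
    -- makes them equal.
    have hmap : ∀ᶠ l in 𝓝 l₀, ∀ᶠ ρ in 𝓝[>] (0 : ℝ), p l ρ = G (ρ, T l, l) := by
      filter_upwards [hsl, h.map, h.cont] with l h1 h2 h3
      filter_upwards [h1.filter_mono nhdsWithin_le_nhds, h2.2, self_mem_nhdsWithin,
        Ioo_mem_nhdsGT h.pos] with ρ h4 h5 h6 h7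
      have h8 := h4.2.2.1 h6
      have hcf := continuousOn_zpow_mul_inv h3.1 h3.2 (k : ℤ)
      have hi := fun {x y : ℝ} (hx : x ∈ Ioo 0 δ) (hy : y ∈ Ioo 0 δ) =>
        intervalIntegrable_of_continuousOn_Ioo hcf hx hy
      refine (eq_of_integral_eq_zero hcf (fun s hs => ?_) h8.1 h5.1 ?_).symm
      · exact inv_ne_zero (mul_ne_zero (zpow_ne_zero _ hs.1.ne') (h3.2 s hs))
      · have := intervalIntegral.integral_add_adjacent_intervals (hi h7 h8.1) (hi h8.1 h5.1)
        have h9 := h8.2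
        have h10 := h5.2
        simp only [zpow_natCast] at *
        linarith
    refine ⟨G, hG, hGe.mono fun z hz => ⟨hz.1, hz.2.1⟩, hmap, fun h => by omega, fun hm1 => ?_⟩
    have hk1 : k = 1 := by omega
    filter_upwards [hsl, hmap, h.factor_near] with l h1 h2 h3
    have hx : ∀ᶠ ρ in 𝓝[>] (0 : ℝ), ∃ x : ℝ, x ∈ Ioo 0 δ ∧
        x ≤ ρ * Real.exp ((|T l₀| + 1) * (|W (0, l₀)| + 1)) ∧
        G (ρ, T l, l) = ρ * Real.exp (T l * W (x, l)) := by
      filter_upwards [h1.filter_mono nhdsWithin_le_nhds, self_mem_nhdsWithin] with ρ h4 h5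
      obtain ⟨x, hx1, hx2, hx3⟩ := h4.2.2.2 hk1 h5
      exact ⟨x, hx1, hx2, hx3⟩
    obtain ⟨x, hx⟩ := hx.choice
    have hid : Tendsto (fun ρ : ℝ => ρ) (𝓝[>] 0) (𝓝 0) := tendsto_id.mono_left nhdsWithin_le_nhds
    have hxlim : Tendsto x (𝓝[>] 0) (𝓝 0) := by
      have hup := hid.mul_const (Real.exp ((|T l₀| + 1) * (|W (0, l₀)| + 1)))
      rw [zero_mul] at hup
      refine tendsto_of_tendsto_of_tendsto_of_le_of_le' tendsto_const_nhds hup ?_ ?_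
      · filter_upwards [hx] with ρ h using h.1.1.le
      · filter_upwards [hx] with ρ h using h.2.1
    have hlim : Tendsto (fun ρ => Real.exp (T l * W (x ρ, l))) (𝓝[>] 0)
        (𝓝 (Real.exp (T l * W (0, l)))) :=
      (Real.continuous_exp.tendsto _).comp ((h3.1.tendsto.comp hxlim).const_mul (T l))
    refine hlim.congr' ?_
    filter_upwards [hx, h2, self_mem_nhdsWithin] with ρ h4 h5 h6
    have hρ : ρ ≠ 0 := (mem_Ioi.1 h6).ne'
    rw [h5, h4.2.2]; field_simp

end

section

variable {Z : Type*} [NormedAddCommGroup Z] [NormedSpace ℝ Z] [CompleteSpace Z]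
  {m : ℤ} {W : ℝ × Z → ℝ} {T : Z → ℝ} {p : Z → ℝ → ℝ} {δ : ℝ} {l₀ : Z}

/-! ### The coefficients of the return map -/

/-- The coefficients of the return map are analytic in `l`, and all of them are multiples of the
period. -/
theorem IsTranslationNear.exists_expansion (h : IsTranslationNear m W T p δ l₀) :
    ∃ c : ℕ → Z → ℝ, (∀ k, AnalyticAt ℝ (c k) l₀) ∧ (∀ᶠ l in 𝓝 l₀, c 0 l = 0) ∧
      (∀ N, ∀ᶠ l in 𝓝 l₀, (fun ρ => p l ρ - ∑ i ∈ Finset.range N, c i l * ρ ^ i)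
        =O[𝓝[>] (0 : ℝ)] fun ρ => ρ ^ N) ∧
      (∀ k, ∃ q : Z → ℝ, AnalyticAt ℝ q l₀ ∧
        ∀ᶠ l in 𝓝 l₀, c k l - (if k = 1 then 1 else 0) = T l * q l) ∧
      (m ≤ 0 → ∀ᶠ l in 𝓝 l₀, T l = 0) ∧
      (m = 1 → ∃ q : Z → ℝ, AnalyticAt ℝ q l₀ ∧ ∀ᶠ l in 𝓝 l₀, T l = (c 1 l - 1) * q l) ∧
      (∀ k : ℕ, 2 ≤ k → m = k → ∃ q : Z → ℝ, AnalyticAt ℝ q l₀ ∧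
        ∀ᶠ l in 𝓝 l₀, T l = c k l * q l) ∧
      IsAnalyticAtZero (p l₀) := by
  obtain ⟨G, hG, hG0, hGp, hTm, hm1⟩ := h.exists_analytic
  obtain ⟨C, hC, hexp⟩ := hG.exists_coeff
  have hcurve : AnalyticAt ℝ (fun l => (T l, l)) l₀ := h.period.prod analyticAt_id
  have hcc : ContinuousAt (fun l => (T l, l)) l₀ := hcurve.continuousAt
  have hrange : ∀ N, ∀ᶠ l in 𝓝 l₀, (fun ρ => p l ρ - ∑ i ∈ Finset.range N, C i (T l, l) * ρ ^ i)
      =O[𝓝[>] (0 : ℝ)] fun ρ => ρ ^ N := by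
    intro N
    obtain ⟨R, hR, hRe⟩ := hexp N
    have hins : ContinuousAt (fun l => ((0 : ℝ), T l, l)) l₀ := continuousAt_const.prodMk hcc
    filter_upwards [hGp, hcc.eventually (eventually_nhds_slice hRe),
      hins.eventually hR.eventually_analyticAt] with l h1 h2 h3
    have hb : (fun ρ => R (ρ, T l, l)) =O[𝓝[>] (0 : ℝ)] fun _ => (1 : ℝ) := by
      have : ContinuousAt (fun ρ : ℝ => R (ρ, T l, l)) 0 :=
        h3.continuousAt.comp (f := fun ρ : ℝ => (ρ, T l, l)) (by fun_prop)
      exact (this.tendsto.mono_left nhdsWithin_le_nhds).isBigO_one ℝ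
    refine (((Asymptotics.isBigO_refl (fun ρ : ℝ => ρ ^ N) _).mul hb).congr' ?_
      (Eventually.of_forall fun ρ => mul_one _))
    filter_upwards [h1, h2.filter_mono nhdsWithin_le_nhds] with ρ h4 h5
    rw [h4, h5]; simp
  have hanal : IsAnalyticAtZero (p l₀) :=
    ⟨fun ρ => G (ρ, T l₀, l₀), hG.comp_of_eq (analyticAt_id.prod analyticAt_const) rfl,
      hGp.self_of_nhds⟩
  have hc1 : ∀ᶠ l in 𝓝 l₀, C 0 (T l, l) = 0 := by
    obtain ⟨R, -, hRe⟩ := hexp 1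
    have hins : ContinuousAt (fun l => ((0 : ℝ), T l, l)) l₀ := continuousAt_const.prodMk hcc
    filter_upwards [hins.eventually hRe, hins.eventually hG0] with l h1 h2
    have h3 := h2.1 rfl
    rw [h1] at h3
    simpa using h3
  have hpo : ∀ᶠ l in 𝓝 l₀, (fun ρ => p l ρ - C 1 (T l, l) * ρ ^ 1) =O[𝓝[>] (0 : ℝ)]
      fun ρ => ρ ^ (1 + 1) := by
    filter_upwards [hrange 2, hc1] with l h1 h2
    refine h1.congr_left fun ρ => ?_
    simp [Finset.sum_range_succ, h2]
  refine ⟨fun k l => C k (T l, l), fun k => (hC k).comp_of_eq hcurve rfl, hc1, hrange, fun k => ?_,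
    hTm, fun hm => ?_, fun k hk hm => ?_, hanal⟩
  · -- divisibility by the period
    by_cases hT : T l₀ = 0
    · obtain ⟨q, hq, hqe⟩ := (hT ▸ hC k).exists_eq_add_mul
      refine ⟨fun l => q (T l, l), hq.comp_of_eq hcurve (by rw [hT]), ?_⟩
      -- At `τ = 0` the function `G` is the identity in ρ, so its coefficients there are those of ρ.
      -- What remains of `C k` is then divisible by `τ`, and substituting `τ = T l` gives the claim.
      have hzero : ∀ᶠ l in 𝓝 l₀, C k (0, l) = if k = 1 then 1 else 0 := by
        obtain ⟨R, hR, hRe⟩ := hexp (k + 2)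
        rw [hT] at hRe hR
        have hG0' := hG0
        rw [hT] at hG0'
        have hins : ContinuousAt (fun l : Z => ((0 : ℝ), l)) l₀ := by fun_prop
        have hins2 : ContinuousAt (fun l : Z => ((0 : ℝ), (0 : ℝ), l)) l₀ := by fun_prop
        filter_upwards [hins.eventually (eventually_nhds_slice hRe),
          hins.eventually (eventually_nhds_slice hG0'),
          hins2.eventually hR.eventually_analyticAt] with l h1 h2 h3
        have hb : (fun ρ => R (ρ, 0, l)) =O[𝓝[>] (0 : ℝ)] fun _ => (1 : ℝ) := by
          have : ContinuousAt (fun ρ : ℝ => R (ρ, 0, l)) 0 :=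
            h3.continuousAt.comp (f := fun ρ : ℝ => (ρ, (0 : ℝ), l)) (by fun_prop)
          exact (this.tendsto.mono_left nhdsWithin_le_nhds).isBigO_one ℝ
        refine coeff_unique (f := fun ρ => ρ) (N := k + 2) (a := fun i => C i (0, l))
          (b := fun i => if i = 1 then 1 else 0) ?_ ?_ k (by omega)
        · refine (((Asymptotics.isBigO_refl (fun ρ : ℝ => ρ ^ (k + 2)) _).mul hb).congr' ?_
            (Eventually.of_forall fun ρ => mul_one _))
          filter_upwards [h1.filter_mono nhdsWithin_le_nhds,
            h2.filter_mono nhdsWithin_le_nhds] with ρ h4 h5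
          have h6 := h5.2 rfl
          rw [h4] at h6
          linarith
        · refine (Asymptotics.isBigO_zero _ _).congr_left fun ρ => ?_
          simp
      rw [← hT] at hqe
      filter_upwards [hcc.eventually hqe, hzero] with l h1 h2
      rw [h1, hT, h2]; ring
    -- If `T l₀ ≠ 0`, the period is a unit and divides everything.
    · refine ⟨fun l => (C k (T l, l) - (if k = 1 then 1 else 0)) / T l,
        (((hC k).comp_of_eq hcurve rfl).sub analyticAt_const).div h.period hT, ?_⟩
      filter_upwards [h.period.continuousAt.eventually_ne hT] with l hl
      field_simp
  · -- multiplicity one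
    have hc : ∀ᶠ l in 𝓝 l₀, C 1 (T l, l) = Real.exp (T l * W (0, l)) := by
      filter_upwards [hpo, hm1 hm] with l h1 h2
      have := tendsto_div_of_isBigO h1
      simp only [pow_one] at this
      exact tendsto_nhds_unique this h2
    have hW : AnalyticAt ℝ (fun l => W (0, l)) l₀ :=
      h.factor.comp_of_eq (analyticAt_const.prod analyticAt_id) rfl
    have hC1 : AnalyticAt ℝ (fun l => C 1 (T l, l)) l₀ := (hC 1).comp_of_eq hcurve rfl
    by_cases hT : T l₀ = 0
    · have he : AnalyticAt ℝ (fun z : ℝ × Z => Real.exp z.1) (0, l₀) := analyticAt_fst.rexp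
      obtain ⟨q, hq, hqe⟩ := he.exists_eq_add_mul
      -- In `exp x = 1 + x q` the quotient is 1 at the base point. Hence `c 1 - 1` is the period
      -- times a factor `Q` that is `W(0, l₀) ≠ 0` at `l₀`.
      have hq1 : q (0, l₀) = 1 := by
        have hd : HasDerivAt Real.exp 1 0 := by simpa using Real.hasDerivAt_exp 0
        have hqd : DifferentiableAt ℝ (fun x : ℝ => q (x, l₀)) 0 :=
          hq.differentiableAt.comp (0 : ℝ) (f := fun x : ℝ => (x, l₀)) (by fun_prop)
        have hd' : HasDerivAt (fun x : ℝ => 1 + x * q (x, l₀)) (q (0, l₀)) 0 := by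
          have := ((hasDerivAt_id (0 : ℝ)).mul hqd.hasDerivAt).const_add 1
          simpa using this
        refine hd'.unique (hd.congr_of_eventuallyEq ?_)
        filter_upwards [(eventually_nhds_slice hqe).self_of_nhds] with x hx
        simpa using hx.symm
      let Q : Z → ℝ := fun l => W (0, l) * q (T l * W (0, l), l)
      have hTW : T l₀ * W (0, l₀) = 0 := by rw [hT, zero_mul]
      have hin : AnalyticAt ℝ (fun l => (T l * W (0, l), l)) l₀ :=
        (h.period.mul hW).prod analyticAt_id
      have hQ : AnalyticAt ℝ Q l₀ := hW.mul (hq.comp_of_eq hin (by simp [hTW]))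
      have hQ0 : Q l₀ ≠ 0 := by
        simp only [Q, hTW, hq1, mul_one]; exact h.factor_ne
      refine ⟨fun l => (Q l)⁻¹, hQ.inv hQ0, ?_⟩
      have htend : Tendsto (fun l => (T l * W (0, l), l)) (𝓝 l₀) (𝓝 (0, l₀)) := by
        have := hin.continuousAt.tendsto
        simpa only [hTW] using this
      filter_upwards [hc, htend.eventually hqe, hQ.continuousAt.eventually_ne hQ0] with l h1 h2 h3
      rw [h1, h2, Real.exp_zero, add_sub_cancel_left, eq_mul_inv_iff_mul_eq₀ h3, mul_assoc]
    -- If the period does not vanish at `l₀`, neither does `exp (T W) - 1`, and both functions are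
    -- units.
    · have hne : C 1 (T l₀, l₀) - 1 ≠ 0 := by
        rw [hc.self_of_nhds, sub_ne_zero]
        intro h1
        rw [Real.exp_eq_one_iff] at h1
        exact mul_ne_zero hT h.factor_ne h1
      refine ⟨fun l => T l / (C 1 (T l, l) - 1), h.period.div (hC1.sub analyticAt_const) hne, ?_⟩
      filter_upwards [(hC1.sub analyticAt_const).continuousAt.eventually_ne hne] with l hl
      have hl' : C 1 (T l, l) - 1 ≠ 0 := hl
      field_simp
  · -- higher multiplicity
    have hW : AnalyticAt ℝ (fun l => W (0, l)) l₀ :=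
      h.factor.comp_of_eq (analyticAt_const.prod analyticAt_id) rfl
    have hc : ∀ᶠ l in 𝓝 l₀, C k (T l, l) = T l * W (0, l) := by
      filter_upwards [hpo, hrange k, hrange (k + 1), h.map, h.cont, h.factor_near]
        with l h1 h2 h3 h4 h5 h6
      have hpO : p l =O[𝓝[>] 0] fun ρ : ℝ => ρ := by
        have h7 : (fun ρ : ℝ => ρ ^ (1 + 1)) =O[𝓝[>] (0 : ℝ)] fun ρ => ρ := by
          have := (Asymptotics.isLittleO_pow_pow (𝕜 := ℝ) (show 1 < 2 by omega)).isBigO.mono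
            (nhdsWithin_le_nhds (s := Ioi 0))
          simpa using this
        have h8 : (fun ρ : ℝ => C 1 (T l, l) * ρ ^ 1) =O[𝓝[>] (0 : ℝ)] fun ρ => ρ := by
          simpa using (Asymptotics.isBigO_refl (fun ρ : ℝ => ρ) (𝓝[>] 0)).const_mul_left _
        exact ((h1.trans h7).add h8).congr_left fun ρ => by ring
      obtain ⟨h7, h8⟩ := tendsto_translation hk h5.1 h5.2 h6.1 hpO (hm ▸ h4.2)
      -- The displacement is O(ρ^k), so the expansion agrees with that of the identity below order
      -- `k`. The coefficient of order `k` is therefore the limit `T l * W (0, l)` found in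
      -- `tendsto_translation`.
      have h9 : ∀ i < k, C i (T l, l) = if i = 1 then 1 else 0 := by
        refine coeff_unique (a := fun i => C i (T l, l)) (b := fun i => if i = 1 then 1 else 0) h2
          (h7.congr_left fun ρ => ?_)
        simp [show 1 < k by omega]
      have h10 : (fun ρ => (p l ρ - ρ) - C k (T l, l) * ρ ^ k) =O[𝓝[>] (0 : ℝ)]
          fun ρ => ρ ^ (k + 1) := by
        refine h3.congr_left fun ρ => ?_
        rw [Finset.sum_range_succ]
        have : ∑ i ∈ Finset.range k, C i (T l, l) * ρ ^ i = ρ := by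
          rw [Finset.sum_congr rfl fun i hi => by rw [h9 i (Finset.mem_range.1 hi)]]
          simp [show 1 < k by omega]
        rw [this]; ring
      exact tendsto_nhds_unique (tendsto_div_of_isBigO h10) h8
    refine ⟨fun l => (W (0, l))⁻¹, hW.inv h.factor_ne, ?_⟩
    filter_upwards [hc, hW.continuousAt.eventually_ne h.factor_ne] with l h1 h2
    rw [h1]; field_simp

end

/-! ### Ideals of germs -/

section Germs

variable {d : ℕ} {a : Param d}

/-- The germ of an analytic function. -/
def analyticGerm (f : Param d → ℝ) (hf : AnalyticAt ℝ f a) : analyticGerms a :=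
  ⟨(f : Germ (𝓝 a) ℝ), f, hf, rfl⟩

theorem germIdeal_singleton {f : Param d → ℝ} (hf : AnalyticAt ℝ f a) :
    germIdeal a {f} = Ideal.span {analyticGerm f hf} := by
  unfold germIdeal
  congr 1
  ext g
  simp only [mem_singleton_iff, exists_eq_left, mem_ofPred_eq]
  exact ⟨fun h => Subtype.ext h, fun h => by rw [h]; rfl⟩

/-- A family of germs consisting of multiples of one of its members generates a principal
ideal. -/
theorem germIdeal_eq_singleton {S : Set (Param d → ℝ)} {f : Param d → ℝ} (hfS : f ∈ S)
    (hf : AnalyticAt ℝ f a)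
    (hS : ∀ s ∈ S, ∃ q : Param d → ℝ, AnalyticAt ℝ q a ∧ ∀ᶠ l in 𝓝 a, s l = f l * q l) :
    germIdeal a S = germIdeal a {f} := by
  refine le_antisymm ?_ (Ideal.span_mono fun g ⟨s, hs, hg⟩ => ⟨s, by
    rw [mem_singleton_iff.1 hs]; exact hfS, hg⟩)
  rw [germIdeal_singleton hf]
  refine Ideal.span_le.2 ?_
  rintro g ⟨s, hs, hg⟩
  obtain ⟨q, hq, he⟩ := hS s hs
  refine Ideal.mem_span_singleton.2 ⟨analyticGerm q hq, Subtype.ext ?_⟩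
  rw [hg]
  exact Germ.coe_eq.2 he

theorem germIdeal_singleton_isPrincipal {f : Param d → ℝ} (hf : AnalyticAt ℝ f a) :
    (germIdeal a {f}).IsPrincipal := by
  rw [germIdeal_singleton hf]
  exact ⟨⟨_, rfl⟩⟩

variable {m : ℤ} {W : ℝ × Param d → ℝ} {T : Param d → ℝ} {p : Param d → ℝ → ℝ} {δ : ℝ}

/-- The coefficients of an expansion that is valid near `a` are the analytic ones, and their
Bautin ideal is principal. -/
theorem IsTranslationNear.bautinIdeal (h : IsTranslationNear m W T p δ a)
    {η : ℕ → Param d → ℝ} (hη : ∀ᶠ l in 𝓝 a, HasFormalExpansion (p l) fun i => η i l) :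
    (∀ k, 1 ≤ k → AnalyticAt ℝ (η k) a) ∧ (bautinIdeal η a).IsPrincipal ∧
      (m = 1 → bautinIdeal η a = germIdeal a {fun l => η 1 l - 1}) ∧
      (∀ k : ℕ, 2 ≤ k → m = k → bautinIdeal η a = germIdeal a {η k}) := by
  obtain ⟨c, hc, hc0, hexp, hdiv, hT0, hT1, hTk, -⟩ := h.exists_expansion
  -- `η` is only assumed to give an asymptotic expansion for each parameter separately. Uniqueness
  -- of expansions identifies it near `a` with the analytic coefficients, and so makes it analytic.
  have heq : ∀ k, 1 ≤ k → ∀ᶠ l in 𝓝 a, c k l = η k l := by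
    intro k hk
    filter_upwards [hη, hexp (k + 1), hc0] with l h1 h2 h3
    have h4 := h1 k
    simp only [sum_Icc_eq_sum_range] at h4
    have := coeff_unique (a := fun i => c i l) (b := fun i => if i = 0 then 0 else η i l) h2 h4 k
      (by omega)
    simpa [show k ≠ 0 by omega] using this
  have hη' : ∀ k, 1 ≤ k → AnalyticAt ℝ (η k) a := fun k hk => (hc k).congr (heq k hk)
  -- all generators are multiples of the period
  have hmul : ∀ s ∈ ({fun l => η 1 l - 1} ∪ {f | ∃ j, 2 ≤ j ∧ f = η j} : Set (Param d → ℝ)),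
      ∃ q : Param d → ℝ, AnalyticAt ℝ q a ∧ ∀ᶠ l in 𝓝 a, s l = T l * q l := by
    rintro s (hs | ⟨j, hj, rfl⟩)
    · rw [mem_singleton_iff] at hs
      subst hs
      obtain ⟨q, hq, hqe⟩ := hdiv 1
      refine ⟨q, hq, ?_⟩
      filter_upwards [hqe, heq 1 le_rfl] with l h1 h2
      rw [← h2, ← h1]; simp
    · obtain ⟨q, hq, hqe⟩ := hdiv j
      refine ⟨q, hq, ?_⟩
      filter_upwards [hqe, heq j (by omega)] with l h1 h2
      rw [← h2, ← h1]; simp [show j ≠ 1 by omega]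
  have hgen : ∀ f ∈ ({fun l => η 1 l - 1} ∪ {f | ∃ j, 2 ≤ j ∧ f = η j} : Set (Param d → ℝ)),
      AnalyticAt ℝ f a → (∃ q : Param d → ℝ, AnalyticAt ℝ q a ∧ ∀ᶠ l in 𝓝 a, T l = f l * q l) →
      -- A generator `f` that divides `T` divides all the others, since they are multiples of `T`.
      _root_.bautinIdeal η a = germIdeal a {f} := by
    rintro f hfS hf ⟨q, hq, hqe⟩
    refine germIdeal_eq_singleton hfS hf fun s hs => ?_
    obtain ⟨q', hq', hqe'⟩ := hmul s hs
    refine ⟨fun l => q l * q' l, hq.mul hq', ?_⟩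
    filter_upwards [hqe, hqe'] with l h1 h2
    rw [h2, h1, mul_assoc]
  have hone : AnalyticAt ℝ (fun l => η 1 l - 1) a := (hη' 1 le_rfl).sub analyticAt_const
  have H1 : m = 1 → _root_.bautinIdeal η a = germIdeal a {fun l => η 1 l - 1} := by
    intro hm
    refine hgen _ (Or.inl rfl) hone ?_
    obtain ⟨q, hq, hqe⟩ := hT1 hm
    refine ⟨q, hq, ?_⟩
    filter_upwards [hqe, heq 1 le_rfl] with l h1 h2
    rw [h1, h2]
  have Hk : ∀ k : ℕ, 2 ≤ k → m = k → _root_.bautinIdeal η a = germIdeal a {η k} := by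
    intro k hk hm
    refine hgen _ (Or.inr ⟨k, hk, rfl⟩) (hη' k (by omega)) ?_
    obtain ⟨q, hq, hqe⟩ := hTk k hk hm
    refine ⟨q, hq, ?_⟩
    filter_upwards [hqe, heq k (by omega)] with l h1 h2
    rw [h1, h2]
  refine ⟨hη', ?_, H1, Hk⟩
  rcases le_or_gt m 0 with hm | hm
  -- Here `T` is the zero germ, trivially a multiple of `η 1 - 1`.
  · rw [hgen _ (Or.inl rfl) hone ⟨fun _ => 0, analyticAt_const, by simpa using hT0 hm⟩]
    exact germIdeal_singleton_isPrincipal hone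
  · rcases (show 1 ≤ m by omega).eq_or_lt with h1 | h1
    · rw [H1 h1.symm]
      exact germIdeal_singleton_isPrincipal hone
    · obtain ⟨k, rfl⟩ : ∃ k : ℕ, m = k := ⟨m.toNat, by omega⟩
      rw [Hk k (by omega) rfl]
      exact germIdeal_singleton_isPrincipal (hη' k (by omega))

theorem IsTranslationNear.exists_hasFormalExpansion (h : IsTranslationNear m W T p δ a) :
    ∃ c : ℕ → ℝ, HasFormalExpansion (p a) c := by
  obtain ⟨c, hc, hc0, hexp, -⟩ := h.exists_expansion
  refine ⟨fun i => c i a, fun N => ?_⟩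
  refine (hexp (N + 1)).self_of_nhds.congr_left fun ρ => ?_
  rw [sum_Icc_eq_sum_range]
  congr 1
  refine Finset.sum_congr rfl fun i _ => ?_
  by_cases hi : i = 0
  · simp [hi, hc0.self_of_nhds]
  · simp [hi]

theorem IsTranslationNear.isAnalyticAtZero (h : IsTranslationNear m W T p δ a) :
    IsAnalyticAtZero (p a) := by
  obtain ⟨c, -, -, -, -, -, -, -, hA⟩ := h.exists_expansion
  exact hA

end Germs

/-! ### Change of the independent variable -/

/-- This exchanges time and angle as independent variables, in both directions. The inverse is
continuous as the inverse of a continuous bijection of compact intervals, and differentiability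
follows from that, including at the endpoints. -/
theorem exists_inverse_of_hasDerivWithinAt_pos {h h' : ℝ → ℝ} {a b : ℝ} (hab : a < b)
    (hd : ∀ t ∈ Icc a b, HasDerivWithinAt h (h' t) (Icc a b) t) (hpos : ∀ t ∈ Icc a b, 0 < h' t) :
    h a < h b ∧ ∃ k : ℝ → ℝ, k (h a) = a ∧ k (h b) = b ∧ ∀ s ∈ Icc (h a) (h b),
      k s ∈ Icc a b ∧ h (k s) = s ∧
        HasDerivWithinAt k (h' (k s))⁻¹ (Icc (h a) (h b)) s := by
  have hc : ContinuousOn h (Icc a b) := fun t ht => (hd t ht).continuousWithinAt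
  have ha : a ∈ Icc a b := left_mem_Icc.2 hab.le
  have hb : b ∈ Icc a b := right_mem_Icc.2 hab.le
  have hmono : StrictMonoOn h (Icc a b) := by
    refine strictMonoOn_of_deriv_pos (convex_Icc a b) hc fun t ht => ?_
    rw [interior_Icc] at ht
    rw [((hd t (Ioo_subset_Icc_self ht)).hasDerivAt (Icc_mem_nhds ht.1 ht.2)).deriv]
    exact hpos t (Ioo_subset_Icc_self ht)
  have hlt : h a < h b := hmono ha hb hab
  have hmaps : ∀ t ∈ Icc a b, h t ∈ Icc (h a) (h b) := fun t ht =>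
    ⟨hmono.monotoneOn ha ht ht.1, hmono.monotoneOn ht hb ht.2⟩
  let e₀ : Icc a b → Icc (h a) (h b) := fun t => ⟨h t, hmaps t t.2⟩
  have hbij : Function.Bijective e₀ := by
    refine ⟨fun x y hxy => ?_, fun s => ?_⟩
    · exact Subtype.ext (hmono.injOn x.2 y.2 (congrArg Subtype.val hxy))
    · obtain ⟨t, ht, hts⟩ := intermediate_value_Icc hab.le hc s.2
      exact ⟨⟨t, ht⟩, Subtype.ext hts⟩
  have he₀ : Continuous e₀ := (continuousOn_iff_continuous_domRestrict.1 hc).subtype_mk _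
  let e : Icc a b ≃ₜ Icc (h a) (h b) :=
    Continuous.homeoOfEquivCompactToT2 (f := Equiv.ofBijective e₀ hbij) he₀
  let k : ℝ → ℝ := fun s => e.symm (projIcc (h a) (h b) hlt.le s)
  have hk : Continuous k :=
    continuous_subtype_val.comp (e.symm.continuous.comp continuous_projIcc)
  have hkm : ∀ s, k s ∈ Icc a b := fun s => (e.symm _).2
  have hhk : ∀ s ∈ Icc (h a) (h b), h (k s) = s := by
    intro s hs
    have h1 : e (e.symm (projIcc (h a) (h b) hlt.le s)) = projIcc (h a) (h b) hlt.le s :=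
      e.apply_symm_apply _
    have h2 := congrArg Subtype.val h1
    rw [projIcc_of_mem hlt.le hs] at h2
    simp only [k, projIcc_of_mem hlt.le hs]
    exact h2
  have hkh : ∀ t ∈ Icc a b, k (h t) = t := fun t ht =>
    hmono.injOn (hkm _) ht (hhk _ (hmaps t ht))
  refine ⟨hlt, k, hkh a ha, hkh b hb, fun s hs => ⟨hkm s, hhk s hs, ?_⟩⟩
  have hne : h' (k s) ≠ 0 := (hpos _ (hkm s)).ne'
  have hfd : HasFDerivWithinAt h
      ((ContinuousLinearEquiv.unitsEquivAut ℝ (Units.mk0 _ hne) : ℝ ≃L[ℝ] ℝ) : ℝ →L[ℝ] ℝ)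
      (Icc a b) (k s) := by
    have he : ((ContinuousLinearEquiv.unitsEquivAut ℝ (Units.mk0 _ hne) : ℝ ≃L[ℝ] ℝ) : ℝ →L[ℝ] ℝ) =
        ContinuousLinearMap.toSpanSingleton ℝ (h' (k s)) := ContinuousLinearMap.ext_ring (by simp)
    rw [he]
    exact (hd _ (hkm s)).hasFDerivWithinAt
  have htend : Tendsto k (𝓝[Icc (h a) (h b)] s) (𝓝[Icc a b] (k s)) :=
    tendsto_nhdsWithin_iff.2 ⟨hk.continuousAt.mono_left nhdsWithin_le_nhds,
      Eventually.of_forall hkm⟩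
  have := (HasFDerivWithinAt.of_local_left_inverse htend hfd hs
    (eventually_nhdsWithin_of_forall hhk)).hasDerivWithinAt
  refine this.congr_deriv ?_
  simp

/-! ### Weighted polar coordinates -/

/-- Weighted polar coordinates `(φ, ρ) ↦ (ρ ^ p * cos φ, ρ ^ q * sin φ)`. -/
noncomputable def weightedPolar (w : ℕ × ℕ) (z : ℝ × ℝ) : ℝ × ℝ :=
  (z.2 ^ w.1 * Real.cos z.1, z.2 ^ w.2 * Real.sin z.1)

theorem weight_combination_pos {w : ℕ × ℕ} (hp : 0 < w.1) (hq : 0 < w.2) (φ : ℝ) :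
    0 < (w.1 : ℝ) * Real.cos φ ^ 2 + (w.2 : ℝ) * Real.sin φ ^ 2 := by
  have h1 : (1 : ℝ) ≤ w.1 := by exact_mod_cast hp
  have h2 : (1 : ℝ) ≤ w.2 := by exact_mod_cast hq
  nlinarith [Real.sin_sq_add_cos_sq φ, sq_nonneg (Real.sin φ), sq_nonneg (Real.cos φ)]

theorem polarJac_pos {w : ℕ × ℕ} (hp : 0 < w.1) (hq : 0 < w.2) {φ ρ : ℝ} (hρ : 0 < ρ) :
    0 < PlanarFamily.polarJac w φ ρ :=
  mul_pos (pow_pos hρ _) (weight_combination_pos hp hq φ)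

theorem hasFDerivAt_weightedPolar (w : ℕ × ℕ) (z : ℝ × ℝ) :
    HasFDerivAt (weightedPolar w)
      (((w.1 * z.2 ^ (w.1 - 1) * Real.cos z.1) • ContinuousLinearMap.snd ℝ ℝ ℝ -
          (z.2 ^ w.1 * Real.sin z.1) • ContinuousLinearMap.fst ℝ ℝ ℝ).prod
        ((w.2 * z.2 ^ (w.2 - 1) * Real.sin z.1) • ContinuousLinearMap.snd ℝ ℝ ℝ +
          (z.2 ^ w.2 * Real.cos z.1) • ContinuousLinearMap.fst ℝ ℝ ℝ)) z := by
  have h1 : HasFDerivAt (fun z : ℝ × ℝ => z.1) (ContinuousLinearMap.fst ℝ ℝ ℝ) z := hasFDerivAt_fst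
  have h2 : HasFDerivAt (fun z : ℝ × ℝ => z.2) (ContinuousLinearMap.snd ℝ ℝ ℝ) z := hasFDerivAt_snd
  refine HasFDerivAt.prodMk ?_ ?_
  · convert! (h2.pow w.1).mul h1.cos using 1
    ext <;> simp <;> ring
  · convert! (h2.pow w.2).mul h1.sin using 1
    ext <;> simp <;> ring

/-- The coordinates of a differentiable curve are differentiable. -/
theorem hasDerivWithinAt_of_weightedPolar {w : ℕ × ℕ} (hp : 0 < w.1) (hq : 0 < w.2)
    {z : ℝ → ℝ × ℝ} {φ ρ : ℝ → ℝ} {s : Set ℝ} {t : ℝ} (ht : t ∈ s)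
    (hφ : ContinuousWithinAt φ s t) (hρ : ContinuousWithinAt ρ s t) (hpos : 0 < ρ t)
    (hz : ∀ u ∈ s, weightedPolar w (φ u, ρ u) = z u) {v : ℝ × ℝ} (hd : HasDerivWithinAt z v s t) :
    HasDerivWithinAt φ ((w.1 * ρ t ^ (w.1 - 1) * Real.cos (φ t) * v.2 -
        w.2 * ρ t ^ (w.2 - 1) * Real.sin (φ t) * v.1) / PlanarFamily.polarJac w (φ t) (ρ t)) s t ∧
    HasDerivWithinAt ρ ((ρ t ^ w.2 * Real.cos (φ t) * v.1 + ρ t ^ w.1 * Real.sin (φ t) * v.2) /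
        PlanarFamily.polarJac w (φ t) (ρ t)) s t := by
  set J := PlanarFamily.polarJac w (φ t) (ρ t) with hJdef
  have hJ : J ≠ 0 := (polarJac_pos hp hq hpos).ne'
  -- The inverse of the differential of the weighted polar map, whose determinant is `J` up to sign.
  -- With a left inverse of the differential and continuity of the coordinates, differentiability of
  -- the image curve passes to the coordinates.
  let A : ℝ × ℝ →L[ℝ] ℝ × ℝ :=
    ((w.1 * ρ t ^ (w.1 - 1) * Real.cos (φ t) / J) • ContinuousLinearMap.snd ℝ ℝ ℝ -
      (w.2 * ρ t ^ (w.2 - 1) * Real.sin (φ t) / J) • ContinuousLinearMap.fst ℝ ℝ ℝ).prod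
    ((ρ t ^ w.2 * Real.cos (φ t) / J) • ContinuousLinearMap.fst ℝ ℝ ℝ +
      (ρ t ^ w.1 * Real.sin (φ t) / J) • ContinuousLinearMap.snd ℝ ℝ ℝ)
  have hJ' : w.1 * ρ t ^ (w.1 - 1) * Real.cos (φ t) * (ρ t ^ w.2 * Real.cos (φ t)) +
      w.2 * ρ t ^ (w.2 - 1) * Real.sin (φ t) * (ρ t ^ w.1 * Real.sin (φ t)) = J := by
    rw [hJdef, PlanarFamily.polarJac]
    have e1 : ρ t ^ (w.1 - 1) * ρ t ^ w.2 = ρ t ^ (w.1 + w.2 - 1) := by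
      rw [← pow_add]; congr 1; omega
    have e2 : ρ t ^ (w.2 - 1) * ρ t ^ w.1 = ρ t ^ (w.1 + w.2 - 1) := by
      rw [← pow_add]; congr 1; omega
    have e3 : w.1 * ρ t ^ (w.1 - 1) * Real.cos (φ t) * (ρ t ^ w.2 * Real.cos (φ t)) +
        w.2 * ρ t ^ (w.2 - 1) * Real.sin (φ t) * (ρ t ^ w.1 * Real.sin (φ t)) =
        w.1 * Real.cos (φ t) ^ 2 * (ρ t ^ (w.1 - 1) * ρ t ^ w.2) +
        w.2 * Real.sin (φ t) ^ 2 * (ρ t ^ (w.2 - 1) * ρ t ^ w.1) := by ring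
    rw [e3, e1, e2]; ring
  have hleft : Function.LeftInverse A
      (((w.1 * ρ t ^ (w.1 - 1) * Real.cos (φ t)) • ContinuousLinearMap.snd ℝ ℝ ℝ -
          (ρ t ^ w.1 * Real.sin (φ t)) • ContinuousLinearMap.fst ℝ ℝ ℝ).prod
        ((w.2 * ρ t ^ (w.2 - 1) * Real.sin (φ t)) • ContinuousLinearMap.snd ℝ ℝ ℝ +
          (ρ t ^ w.2 * Real.cos (φ t)) • ContinuousLinearMap.fst ℝ ℝ ℝ)) := by
    intro u
    refine Prod.ext ?_ ?_
    · have : (w.1 * ρ t ^ (w.1 - 1) * Real.cos (φ t) * (ρ t ^ w.2 * Real.cos (φ t)) +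
        w.2 * ρ t ^ (w.2 - 1) * Real.sin (φ t) * (ρ t ^ w.1 * Real.sin (φ t))) / J * u.1 = u.1 := by
        rw [hJ', div_self hJ, one_mul]
      simp only [A, ContinuousLinearMap.prod_apply, add_apply,
        sub_apply, smul_apply,
        ContinuousLinearMap.coe_fst', ContinuousLinearMap.coe_snd', smul_eq_mul]
      refine Eq.trans ?_ this
      ring
    · have : (w.1 * ρ t ^ (w.1 - 1) * Real.cos (φ t) * (ρ t ^ w.2 * Real.cos (φ t)) +
        w.2 * ρ t ^ (w.2 - 1) * Real.sin (φ t) * (ρ t ^ w.1 * Real.sin (φ t))) / J * u.2 = u.2 := by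
        rw [hJ', div_self hJ, one_mul]
      simp only [A, ContinuousLinearMap.prod_apply, add_apply,
        sub_apply, smul_apply,
        ContinuousLinearMap.coe_fst', ContinuousLinearMap.coe_snd', smul_eq_mul]
      refine Eq.trans ?_ this
      ring
  have hg : ContinuousWithinAt (fun u => (φ u, ρ u)) s t := hφ.prodMk hρ
  have key := HasFDerivWithinAt.of_comp_of_leftInverse (g := fun u => (φ u, ρ u)) (t := univ)
    (tendsto_nhdsWithin_iff.2 ⟨hg, by simp⟩)
    (hasFDerivAt_weightedPolar w (φ t, ρ t)).hasFDerivWithinAt hd.hasFDerivWithinAt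
    (eventually_nhdsWithin_of_forall hz) hleft ht
  have key' := key.hasDerivWithinAt
  constructor
  · have := (ContinuousLinearMap.fst ℝ ℝ ℝ).hasFDerivAt.comp_hasDerivWithinAt t key'
    refine HasDerivWithinAt.congr_deriv this ?_
    simp [A]; ring
  · have := (ContinuousLinearMap.snd ℝ ℝ ℝ).hasFDerivAt.comp_hasDerivWithinAt t key'
    refine HasDerivWithinAt.congr_deriv this ?_
    simp [A]; ring

/-! #### The weighted radius -/

/-- Intermediate values in ρ: at `min 1 √R`, where `R = x² + y²`, the left side is at least 1; at `1
+ R` it is at most 1. -/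
theorem exists_weighted_radius {w : ℕ × ℕ} (hp : 0 < w.1) (hq : 0 < w.2) {x y : ℝ}
    (h : (x, y) ≠ (0, 0)) : ∃ ρ > 0, x ^ 2 / ρ ^ (2 * w.1) + y ^ 2 / ρ ^ (2 * w.2) = 1 := by
  have hr : 0 < x ^ 2 + y ^ 2 := by
    rcases eq_or_ne x 0 with rfl | hx
    · have : y ≠ 0 := fun hy => h (by simp [hy])
      positivity
    · positivity
  set R := x ^ 2 + y ^ 2 with hR
  set a := min 1 (Real.sqrt R) with ha
  have ha0 : 0 < a := lt_min one_pos (Real.sqrt_pos.2 hr)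
  have ha1 : a ≤ 1 := min_le_left _ _
  have ha2 : a ^ 2 ≤ R := by
    have := pow_le_pow_left₀ ha0.le (min_le_right 1 (Real.sqrt R)) 2
    rwa [Real.sq_sqrt hr.le] at this
  have hcont : ContinuousOn (fun ρ : ℝ => x ^ 2 / ρ ^ (2 * w.1) + y ^ 2 / ρ ^ (2 * w.2))
      (Icc a (1 + R)) := by
    refine ContinuousOn.add ?_ ?_ <;>
    refine ContinuousOn.div continuousOn_const (by fun_prop) fun ρ hρ => ?_ <;>
    exact pow_ne_zero _ (ha0.trans_le hρ.1).ne'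
  have hsmall : 1 ≤ x ^ 2 / a ^ (2 * w.1) + y ^ 2 / a ^ (2 * w.2) := by
    have e : ∀ n, 0 < n → a ^ (2 * n) ≤ a ^ 2 := fun n hn =>
      pow_le_pow_of_le_one ha0.le ha1 (by omega)
    have h1 : x ^ 2 / a ^ 2 ≤ x ^ 2 / a ^ (2 * w.1) :=
      div_le_div_of_nonneg_left (sq_nonneg _) (by positivity) (e _ hp)
    have h2 : y ^ 2 / a ^ 2 ≤ y ^ 2 / a ^ (2 * w.2) :=
      div_le_div_of_nonneg_left (sq_nonneg _) (by positivity) (e _ hq)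
    have h3 : 1 ≤ x ^ 2 / a ^ 2 + y ^ 2 / a ^ 2 := by
      rw [← add_div, le_div_iff₀ (by positivity), one_mul]; exact ha2
    linarith
  have hlarge : x ^ 2 / (1 + R) ^ (2 * w.1) + y ^ 2 / (1 + R) ^ (2 * w.2) ≤ 1 := by
    have e : ∀ n, 0 < n → 1 + R ≤ (1 + R) ^ (2 * n) := fun n hn =>
      le_self_pow₀ (by linarith) (by omega)
    have h1 : x ^ 2 / (1 + R) ^ (2 * w.1) ≤ x ^ 2 / (1 + R) :=
      div_le_div_of_nonneg_left (sq_nonneg _) (by positivity) (e _ hp)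
    have h2 : y ^ 2 / (1 + R) ^ (2 * w.2) ≤ y ^ 2 / (1 + R) :=
      div_le_div_of_nonneg_left (sq_nonneg _) (by positivity) (e _ hq)
    have h3 : x ^ 2 / (1 + R) + y ^ 2 / (1 + R) ≤ 1 := by
      rw [← add_div, div_le_one (by positivity)]; linarith
    linarith
  obtain ⟨ρ, hρ, he⟩ := intermediate_value_Icc' (by linarith : a ≤ 1 + R) hcont ⟨hlarge, hsmall⟩
  exact ⟨ρ, ha0.trans_le hρ.1, he⟩

/-- Strict monotonicity in ρ yields both the uniqueness and the continuity of the weighted radius.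
-/
theorem weighted_radius_lt {w : ℕ × ℕ} (hp : 0 < w.1) (hq : 0 < w.2) {x y : ℝ}
    (h : (x, y) ≠ (0, 0)) {ρ ρ' : ℝ} (hρ : 0 < ρ) (hlt : ρ < ρ') :
    x ^ 2 / ρ' ^ (2 * w.1) + y ^ 2 / ρ' ^ (2 * w.2) <
      x ^ 2 / ρ ^ (2 * w.1) + y ^ 2 / ρ ^ (2 * w.2) := by
  have e : ∀ n, 0 < n → ρ ^ (2 * n) < ρ' ^ (2 * n) := fun n hn =>
    pow_lt_pow_left₀ hlt hρ.le (by omega)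
  have hle : ∀ (c : ℝ) (n : ℕ), 0 < n → c ^ 2 / ρ' ^ (2 * n) ≤ c ^ 2 / ρ ^ (2 * n) := fun c n hn =>
    div_le_div_of_nonneg_left (sq_nonneg _) (by positivity) (e n hn).le
  have hl : ∀ (c : ℝ) (n : ℕ), c ≠ 0 → 0 < n → c ^ 2 / ρ' ^ (2 * n) < c ^ 2 / ρ ^ (2 * n) :=
    fun c n hc hn => div_lt_div_of_pos_left (by positivity) (by positivity) (e n hn)
  rcases eq_or_ne x 0 with hx | hx
  · have hy : y ≠ 0 := fun hy => h (by simp [hx, hy])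
    exact add_lt_add_of_le_of_lt (hle x _ hp) (hl y _ hy hq)
  · exact add_lt_add_of_lt_of_le (hl x _ hx hp) (hle y _ hq)

open Classical in
/-- The weighted radius of a point of the plane. -/
noncomputable def weightedRadius (w : ℕ × ℕ) (z : ℝ × ℝ) : ℝ :=
  if h : ∃ ρ > 0, z.1 ^ 2 / ρ ^ (2 * w.1) + z.2 ^ 2 / ρ ^ (2 * w.2) = 1 then h.choose else 0

theorem weightedRadius_spec {w : ℕ × ℕ} (hp : 0 < w.1) (hq : 0 < w.2) {z : ℝ × ℝ}
    (hz : z ≠ (0, 0)) : 0 < weightedRadius w z ∧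
      z.1 ^ 2 / weightedRadius w z ^ (2 * w.1) + z.2 ^ 2 / weightedRadius w z ^ (2 * w.2) = 1 := by
  have h := exists_weighted_radius hp hq (x := z.1) (y := z.2) hz
  rw [weightedRadius, dif_pos h]
  exact h.choose_spec

/-- For fixed `a`, the comparison of `a` with the weighted radius is decided by whether the defining
expression at `ρ = a` is above or below 1, an open condition on the point. -/
theorem continuousAt_weightedRadius {w : ℕ × ℕ} (hp : 0 < w.1) (hq : 0 < w.2) {z : ℝ × ℝ}
    (hz : z ≠ (0, 0)) : ContinuousAt (weightedRadius w) z := by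
  obtain ⟨h0, h1⟩ := weightedRadius_spec hp hq hz
  have hne : ∀ᶠ u in 𝓝 z, u ≠ (0, 0) := isOpen_ne.mem_nhds hz
  have hcont : ∀ ρ : ℝ, Continuous
      fun u : ℝ × ℝ => u.1 ^ 2 / ρ ^ (2 * w.1) + u.2 ^ 2 / ρ ^ (2 * w.2) := fun ρ => by fun_prop
  refine tendsto_order.2 ⟨fun a ha => ?_, fun a ha => ?_⟩
  · rcases le_or_gt a 0 with ha0 | ha0
    · filter_upwards [hne] with u hu
      exact ha0.trans_lt (weightedRadius_spec hp hq hu).1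
    · have h2 := weighted_radius_lt hp hq (x := z.1) (y := z.2) hz ha0 ha
      rw [h1] at h2
      filter_upwards [hne, (isOpen_lt continuous_const (hcont a)).mem_nhds h2] with u hu hu2
      by_contra! hle
      obtain ⟨h3, h4⟩ := weightedRadius_spec hp hq hu
      rcases hle.eq_or_lt with he | hlt
      · rw [he] at h4; exact (ne_of_gt hu2) h4
      · have := weighted_radius_lt hp hq (x := u.1) (y := u.2) hu h3 hlt
        rw [h4] at this
        exact lt_asymm this hu2
  · have h2 := weighted_radius_lt hp hq (x := z.1) (y := z.2) hz h0 ha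
    rw [h1] at h2
    filter_upwards [hne, (isOpen_lt (hcont a) continuous_const).mem_nhds h2] with u hu hu2
    by_contra! hle
    obtain ⟨h3, h4⟩ := weightedRadius_spec hp hq hu
    rcases hle.eq_or_lt with he | hlt
    · rw [← he] at h4; exact (ne_of_lt hu2) h4
    · have := weighted_radius_lt hp hq (x := u.1) (y := u.2) hu (h0.trans ha) hlt
      rw [h4] at this
      exact lt_asymm this hu2

/-- Weighted polar coordinates of a curve given in polar coordinates. -/
theorem exists_weightedPolar_lift {w : ℕ × ℕ} (hp : 0 < w.1) (hq : 0 < w.2) {r θ : ℝ → ℝ}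
    {s : Set ℝ} (hr : ContinuousOn r s) (hθ : ContinuousOn θ s) (hpos : ∀ t ∈ s, 0 < r t) :
    ∃ φ ρ : ℝ → ℝ, ContinuousOn φ s ∧ ContinuousOn ρ s ∧ ∀ t ∈ s, 0 < ρ t ∧
      |φ t - θ t| < Real.pi / 2 ∧
      weightedPolar w (φ t, ρ t) = (r t * Real.cos (θ t), r t * Real.sin (θ t)) := by
  let z : ℝ → ℝ × ℝ := fun t => (r t * Real.cos (θ t), r t * Real.sin (θ t))
  have hzc : ContinuousOn z s :=
    (hr.mul (Real.continuous_cos.comp_continuousOn hθ)).prodMk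
      (hr.mul (Real.continuous_sin.comp_continuousOn hθ))
  have hz : ∀ t ∈ s, z t ≠ (0, 0) := by
    intro t ht h
    have h1 := congrArg Prod.fst h
    have h2 := congrArg Prod.snd h
    simp only [z] at h1 h2
    have hrt := (hpos t ht).ne'
    have h3 : Real.cos (θ t) = 0 := (mul_eq_zero.1 h1).resolve_left hrt
    have h4 : Real.sin (θ t) = 0 := (mul_eq_zero.1 h2).resolve_left hrt
    have := Real.sin_sq_add_cos_sq (θ t)
    rw [h3, h4] at this
    norm_num at this
  let ρ : ℝ → ℝ := fun t => weightedRadius w (z t)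
  have hρc : ContinuousOn ρ s := fun t ht =>
    (continuousAt_weightedRadius hp hq (hz t ht)).comp_continuousWithinAt (hzc t ht)
  have hρ : ∀ t ∈ s, 0 < ρ t := fun t ht => (weightedRadius_spec hp hq (hz t ht)).1
  let c : ℝ → ℝ := fun t => r t * Real.cos (θ t) / ρ t ^ w.1
  let d : ℝ → ℝ := fun t => r t * Real.sin (θ t) / ρ t ^ w.2
  have hcd : ∀ t ∈ s, c t ^ 2 + d t ^ 2 = 1 := by
    intro t ht
    have := (weightedRadius_spec hp hq (hz t ht)).2
    simp only [c, d, div_pow, ← pow_mul, mul_comm w.1 2, mul_comm w.2 2]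
    exact this
  have hcc : ContinuousOn c s := (hr.mul (Real.continuous_cos.comp_continuousOn hθ)).div
    (hρc.pow _) fun t ht => pow_ne_zero _ (hρ t ht).ne'
  have hdc : ContinuousOn d s := (hr.mul (Real.continuous_sin.comp_continuousOn hθ)).div
    (hρc.pow _) fun t ht => pow_ne_zero _ (hρ t ht).ne'
  -- `(c, d)` is the unit vector at the weighted angle, so `S` and `C` below are the sine and cosine
  -- of the difference between the weighted and the Euclidean angle. As `C > 0`, the arcsine is a
  -- continuous determination of it in (-π/2, π/2), and both angles count the same turns.
  let S : ℝ → ℝ := fun t => d t * Real.cos (θ t) - c t * Real.sin (θ t)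
  have hSc : ContinuousOn S s := (hdc.mul (Real.continuous_cos.comp_continuousOn hθ)).sub
    (hcc.mul (Real.continuous_sin.comp_continuousOn hθ))
  refine ⟨fun t => θ t + Real.arcsin (S t), ρ,
    hθ.add (Real.continuous_arcsin.comp_continuousOn hSc), hρc, fun t ht => ⟨hρ t ht, ?_⟩⟩
  have hsc := Real.sin_sq_add_cos_sq (θ t)
  set C := c t * Real.cos (θ t) + d t * Real.sin (θ t) with hC
  have hC0 : 0 < C := by
    have hpp := pow_pos (hρ t ht) w.1
    have hpq := pow_pos (hρ t ht) w.2
    have e : C = r t * (Real.cos (θ t) ^ 2 / ρ t ^ w.1 + Real.sin (θ t) ^ 2 / ρ t ^ w.2) := by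
      simp only [hC, c, d]; ring
    rw [e]
    refine mul_pos (hpos t ht) ?_
    rcases eq_or_ne (Real.cos (θ t)) 0 with h | h
    · have h' : Real.sin (θ t) ≠ 0 := fun h' => by rw [h, h'] at hsc; norm_num at hsc
      positivity
    · positivity
  have hSC : S t ^ 2 + C ^ 2 = 1 := by
    have := hcd t ht
    simp only [S, hC]
    nlinarith [hsc]
  have hS1 : -1 < S t ∧ S t < 1 := by
    have : S t ^ 2 < 1 := by nlinarith
    exact abs_lt.1 ((sq_lt_one_iff_abs_lt_one _).1 this)
  have hsin : Real.sin (Real.arcsin (S t)) = S t := Real.sin_arcsin hS1.1.le hS1.2.le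
  have hcos : Real.cos (Real.arcsin (S t)) = C := by
    rw [Real.cos_arcsin, show 1 - S t ^ 2 = C ^ 2 by linarith, Real.sqrt_sq hC0.le]
  refine ⟨?_, ?_⟩
  · rw [add_sub_cancel_left, abs_lt]
    exact ⟨Real.neg_pi_div_two_lt_arcsin.2 hS1.1, Real.arcsin_lt_pi_div_two.2 hS1.2⟩
  · have e1 : Real.cos (θ t + Real.arcsin (S t)) = c t := by
      rw [Real.cos_add, hsin, hcos]
      simp only [S, hC]
      linear_combination (c t) * hsc
    have e2 : Real.sin (θ t + Real.arcsin (S t)) = d t := by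
      rw [Real.sin_add, hsin, hcos]
      simp only [S, hC]
      linear_combination (d t) * hsc
    have hpp := (pow_pos (hρ t ht) w.1).ne'
    have hpq := (pow_pos (hρ t ht) w.2).ne'
    simp only [weightedPolar, e1, e2, c, d]
    rw [mul_div_cancel₀ _ hpp, mul_div_cancel₀ _ hpq]

/-! ### Solutions in weighted polar coordinates -/

theorem eq_zero_of_sin_eq_zero {x : ℝ} (h : |x| < Real.pi / 2) (hs : Real.sin x = 0) : x = 0 := by
  have := abs_lt.1 h
  exact (Real.sin_eq_zero_iff_of_lt_of_lt (by linarith [Real.pi_pos])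
    (by linarith [Real.pi_pos])).1 hs

namespace PlanarFamily

variable {d : ℕ}

/-- The numerator of the angular speed. -/
noncomputable def angNum (X : PlanarFamily d) (w : ℕ × ℕ) (l : Param d) (φ ρ : ℝ) : ℝ :=
  (w.1 : ℝ) * ρ ^ (w.1 - 1) * Real.cos φ * X.polarQ w l φ ρ -
    (w.2 : ℝ) * ρ ^ (w.2 - 1) * Real.sin φ * X.polarP w l φ ρ

/-- The numerator of the radial speed. -/
noncomputable def radNum (X : PlanarFamily d) (w : ℕ × ℕ) (l : Param d) (φ ρ : ℝ) : ℝ :=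
  ρ ^ w.2 * Real.cos φ * X.polarP w l φ ρ + ρ ^ w.1 * Real.sin φ * X.polarQ w l φ ρ

theorem angularSpeed_ne_zero_iff (X : PlanarFamily d) {w : ℕ × ℕ} (hp : 0 < w.1) (hq : 0 < w.2)
    (l : Param d) {φ ρ : ℝ} (hρ : 0 < ρ) : X.angularSpeed w l φ ρ ≠ 0 ↔ X.angNum w l φ ρ ≠ 0 := by
  have hJ : polarJac w φ ρ ≠ 0 := (polarJac_pos hp hq hρ).ne'
  have hz : ρ ^ (-X.leadingDegree l w) ≠ 0 := zpow_ne_zero _ hρ.ne'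
  rw [angularSpeed, mul_ne_zero_iff_right hz, div_ne_zero_iff]
  exact and_iff_left hJ

/-- The Jacobian and the power of ρ cancel in the quotient; for ρ > 0 the equation depends on the
numerators alone. -/
theorem polarF_eq (X : PlanarFamily d) {w : ℕ × ℕ} (hp : 0 < w.1) (hq : 0 < w.2)
    (l : Param d) {φ ρ : ℝ} (hρ : 0 < ρ) :
    X.polarF w l φ ρ = X.radNum w l φ ρ / X.angNum w l φ ρ := by
  have hJ : polarJac w φ ρ ≠ 0 := (polarJac_pos hp hq hρ).ne'
  have hz : ρ ^ (-X.leadingDegree l w) ≠ 0 := zpow_ne_zero _ hρ.ne'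
  rw [polarF, radialSpeed, angularSpeed, mul_div_mul_right _ _ hz, div_div_div_cancel_right₀ hJ]
  rfl

theorem field_weightedPolar (X : PlanarFamily d) (w : ℕ × ℕ) (l : Param d) (φ ρ : ℝ) :
    X.field l (weightedPolar w (φ, ρ)) = (X.polarP w l φ ρ, X.polarQ w l φ ρ) := rfl

variable {X : PlanarFamily d} {w : ℕ × ℕ} {l : Param d}

/-- The weighted polar coordinates of a solution, run at speed `σ`. -/
theorem hasDerivWithinAt_coordinates (hp : 0 < w.1) (hq : 0 < w.2) {σ : ℝ} {z : ℝ → ℝ × ℝ}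
    {φ ρ : ℝ → ℝ} {s : Set ℝ} (hφ : ContinuousOn φ s) (hρ : ContinuousOn ρ s)
    (hpos : ∀ t ∈ s, 0 < ρ t) (hz : ∀ t ∈ s, weightedPolar w (φ t, ρ t) = z t)
    (hd : ∀ t ∈ s, HasDerivWithinAt z (σ • X.field l (z t)) s t) {t : ℝ} (ht : t ∈ s) :
    HasDerivWithinAt φ (σ * X.angNum w l (φ t) (ρ t) / polarJac w (φ t) (ρ t)) s t ∧
    HasDerivWithinAt ρ (σ * X.radNum w l (φ t) (ρ t) / polarJac w (φ t) (ρ t)) s t := by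
  have h := hasDerivWithinAt_of_weightedPolar hp hq ht (hφ t ht) (hρ t ht) (hpos t ht) hz (hd t ht)
  rw [← hz t ht, field_weightedPolar] at h
  refine ⟨h.1.congr_deriv ?_, h.2.congr_deriv ?_⟩
  · simp only [angNum, Prod.smul_mk, smul_eq_mul]; ring
  · simp only [radNum, Prod.smul_mk, smul_eq_mul]; ring

/-- A solution that turns in the positive direction is a solution of `dρ/dφ = F`. -/
theorem exists_isSolutionOn_of_curve (hp : 0 < w.1) (hq : 0 < w.2) {a b ε σ : ℝ} (hab : a < b)
    {z : ℝ → ℝ × ℝ} {φ ρ : ℝ → ℝ} (hφ : ContinuousOn φ (Icc a b)) (hρ : ContinuousOn ρ (Icc a b))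
    (hpos : ∀ t ∈ Icc a b, ρ t ∈ Ioo 0 ε) (hz : ∀ t ∈ Icc a b, weightedPolar w (φ t, ρ t) = z t)
    (hd : ∀ t ∈ Icc a b, HasDerivWithinAt z (σ • X.field l (z t)) (Icc a b) t)
    (hang : ∀ t ∈ Icc a b, 0 < σ * X.angNum w l (φ t) (ρ t)) :
    φ a < φ b ∧ ∃ Φ : ℝ → ℝ, Φ (φ a) = ρ a ∧ Φ (φ b) = ρ b ∧
      IsSolutionOn (X.polarF w l) ε (φ a) (φ b) Φ ∧
      ∀ s ∈ Icc (φ a) (φ b), ∃ t ∈ Icc a b, weightedPolar w (s, Φ s) = z t := by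
  have hder := fun t ht => hasDerivWithinAt_coordinates (X := X) (l := l) hp hq hφ hρ
    (fun t ht => (hpos t ht).1) hz hd (t := t) ht
  have hJ : ∀ t ∈ Icc a b, 0 < polarJac w (φ t) (ρ t) := fun t ht =>
    polarJac_pos hp hq (hpos t ht).1
  obtain ⟨hlt, k, hka, hkb, hk⟩ := exists_inverse_of_hasDerivWithinAt_pos hab
    (fun t ht => (hder t ht).1) fun t ht => div_pos (hang t ht) (hJ t ht)
  refine ⟨hlt, fun s => ρ (k s), congrArg ρ hka, congrArg ρ hkb, fun s hs => ?_, fun s hs => ?_⟩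
  · obtain ⟨h1, h2, h3⟩ := hk s hs
    refine ⟨hpos _ h1, ?_⟩
    have := HasDerivWithinAt.scomp s (hder _ h1).2 h3 fun u hu => (hk u hu).1
    refine this.congr_deriv ?_
    have hA := (hang _ h1).ne'
    have hσ : σ ≠ 0 := left_ne_zero_of_mul hA
    have hA' : X.angNum w l (φ (k s)) (ρ (k s)) ≠ 0 := right_ne_zero_of_mul hA
    have hJ' := (hJ _ h1).ne'
    rw [h2] at hA' hJ' ⊢
    rw [polarF_eq X hp hq l (hpos _ h1).1, smul_eq_mul]
    field_simp
  · obtain ⟨h1, h2, -⟩ := hk s hs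
    refine ⟨k s, h1, ?_⟩
    rw [← hz _ h1, h2]

/-- Where the angular speed does not vanish, solutions turn in one direction. -/
theorem angNum_pos_or_neg (hp : 0 < w.1) (hq : 0 < w.2) {σ : ℝ} (hσ : σ ≠ 0)
    {z : ℝ → ℝ × ℝ} {φ ρ : ℝ → ℝ} {s : Set ℝ} (hs : Convex ℝ s)
    (hφ : ContinuousOn φ s) (hρ : ContinuousOn ρ s)
    (hpos : ∀ t ∈ s, 0 < ρ t) (hz : ∀ t ∈ s, weightedPolar w (φ t, ρ t) = z t)
    (hd : ∀ t ∈ s, HasDerivWithinAt z (σ • X.field l (z t)) s t)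
    (hang : ∀ t ∈ s, X.angNum w l (φ t) (ρ t) ≠ 0) :
    (∀ t ∈ s, σ * X.angNum w l (φ t) (ρ t) < 0) ∨ ∀ t ∈ s, 0 < σ * X.angNum w l (φ t) (ρ t) := by
  have hder := fun t ht => (hasDerivWithinAt_coordinates (X := X) (l := l) hp hq hφ hρ
    hpos hz hd (t := t) ht).1
  have hJ : ∀ t ∈ s, 0 < polarJac w (φ t) (ρ t) := fun t ht => polarJac_pos hp hq (hpos t ht)
  refine (hasDerivWithinAt_forall_lt_or_forall_gt_of_forall_ne hs hder (m := 0)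
    fun t ht => div_ne_zero (mul_ne_zero hσ (hang t ht)) (hJ t ht).ne').imp ?_ ?_
  · exact fun h t ht => by
      have := mul_neg_of_neg_of_pos (h t ht) (hJ t ht)
      rwa [div_mul_cancel₀ _ (hJ t ht).ne'] at this
  · exact fun h t ht => (div_pos_iff_of_pos_right (hJ t ht)).1 (h t ht)

/-- Were ρ at least `e`, then ρ^p and ρ^q would both exceed `r`, and r² = ρ^(2p) cos² φ + ρ^(2q)
sin² φ would exceed itself. This turns Euclidean smallness into smallness of the weighted radius. -/
theorem weightedPolar_radius_lt {ρ φ r θ e : ℝ} (he : 0 < e) (hr : r ∈ Ioo 0 (min (e ^ w.1)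
    (e ^ w.2)))
    (h : weightedPolar w (φ, ρ) = (r * Real.cos θ, r * Real.sin θ)) : ρ < e := by
  by_contra! hle
  have h1 := congrArg Prod.fst h
  have h2 := congrArg Prod.snd h
  simp only [weightedPolar] at h1 h2
  have hr2 : r ^ 2 = (ρ ^ w.1 * Real.cos φ) ^ 2 + (ρ ^ w.2 * Real.sin φ) ^ 2 := by
    rw [h1, h2]; linear_combination -(r ^ 2) * Real.sin_sq_add_cos_sq θ
  have ha : r < ρ ^ w.1 := (hr.2.trans_le (min_le_left _ _)).trans_le (pow_le_pow_left₀ he.le hle _)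
  have hb : r < ρ ^ w.2 := (hr.2.trans_le (min_le_right _ _)).trans_le (pow_le_pow_left₀ he.le hle _)
  have ha2 : r ^ 2 < (ρ ^ w.1) ^ 2 := pow_lt_pow_left₀ ha hr.1.le two_ne_zero
  have hb2 : r ^ 2 < (ρ ^ w.2) ^ 2 := pow_lt_pow_left₀ hb hr.1.le two_ne_zero
  rw [mul_pow, mul_pow] at hr2
  have hsc := Real.sin_sq_add_cos_sq φ
  have hs0 := sq_nonneg (Real.sin φ)
  have hc0 := sq_nonneg (Real.cos φ)
  rcases hs0.eq_or_lt with h | h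
  · rw [← h] at hr2 hsc
    rw [zero_add] at hsc
    rw [hsc] at hr2
    linarith
  · nlinarith [mul_lt_mul_of_pos_right hb2 h, mul_le_mul_of_nonneg_right ha2.le hc0]

/-- Near a monodromic singularity the equation `dρ/dφ = F` has solutions over a full turn. -/
theorem IsMonodromic.exists_turn (hp : 0 < w.1) (hq : 0 < w.2) (h : X.IsMonodromic l) {ε : ℝ}
    (hang : ∀ φ : ℝ, ∀ ρ ∈ Ioo 0 ε, X.angNum w l φ ρ ≠ 0) {e : ℝ} (he : 0 < e) (hle : e ≤ ε) :
    ∃ δ > 0, ∀ ρ₀ ∈ Ioo 0 δ, ∃ Φ : ℝ → ℝ, Φ 0 = ρ₀ ∧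
      IsSolutionOn (X.polarF w l) e 0 (2 * Real.pi) Φ := by
  obtain ⟨δ, hδ, H⟩ := h.2 (min (e ^ w.1) (e ^ w.2)) (lt_min (pow_pos he _) (pow_pos he _))
  -- The orbit starts at `(ρ₀ ^ p, 0)`; the bound 1 gives `ρ₀ ^ p ≤ ρ₀ < δ`.
  refine ⟨min (min δ 1) ε, lt_min (lt_min hδ one_pos) (he.trans_le hle), fun ρ₀ hρ₀ => ?_⟩
  have h1 : ρ₀ < δ := hρ₀.2.trans_le ((min_le_left _ _).trans (min_le_left _ _))
  have h2 : ρ₀ < 1 := hρ₀.2.trans_le ((min_le_left _ _).trans (min_le_right _ _))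
  have h3 : ρ₀ < ε := hρ₀.2.trans_le (min_le_right _ _)
  have hA := hang 0 ρ₀ ⟨hρ₀.1, h3⟩
  -- The time direction is chosen so that the weighted angle increases; the sign at the starting
  -- point persists along the orbit.
  obtain ⟨σ, hσ, hσA⟩ : ∃ σ ∈ ({1, -1} : Set ℝ), 0 < σ * X.angNum w l 0 ρ₀ := by
    rcases hA.lt_or_gt with hA | hA
    · exact ⟨-1, by simp, by linarith⟩
    · exact ⟨1, by simp, by linarith⟩
  have hσ0 : σ ≠ 0 := left_ne_zero_of_mul hσA.ne'
  obtain ⟨T, hT, r, θ, hr, hθ, hr0, hθ0, hθT, hsol⟩ := H (ρ₀ ^ w.1)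
    ⟨pow_pos hρ₀.1 _, (pow_le_of_le_one hρ₀.1.le h2.le hp.ne').trans_lt h1⟩ 0 σ hσ
  obtain ⟨φ, ρ, hφ, hρ, hlift⟩ := exists_weightedPolar_lift hp hq hr hθ fun t ht => (hsol t ht).1.1
  have h0 : (0 : ℝ) ∈ Icc 0 T := left_mem_Icc.2 hT.le
  have hTm : T ∈ Icc 0 T := right_mem_Icc.2 hT.le
  have hφ0 : φ 0 = 0 := by
    obtain ⟨a1, a2, a3⟩ := hlift 0 h0
    have := congrArg Prod.snd a3
    simp only [weightedPolar, hθ0, Real.sin_zero, mul_zero] at this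
    rw [hθ0, sub_zero] at a2
    exact eq_zero_of_sin_eq_zero a2 ((mul_eq_zero.1 this).resolve_left (pow_pos a1 _).ne')
  have hρ0 : ρ 0 = ρ₀ := by
    obtain ⟨a1, a2, a3⟩ := hlift 0 h0
    have := congrArg Prod.fst a3
    simp only [weightedPolar, hθ0, hφ0, Real.cos_zero, mul_one, hr0] at this
    exact (pow_left_inj₀ a1.le hρ₀.1.le hp.ne').1 this
  have hρe : ∀ t ∈ Icc 0 T, ρ t ∈ Ioo 0 e := fun t ht =>
    ⟨(hlift t ht).1, weightedPolar_radius_lt he (hsol t ht).1 (hlift t ht).2.2⟩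
  have hz : ∀ t ∈ Icc 0 T, weightedPolar w (φ t, ρ t) =
      (fun s => (r s * Real.cos (θ s), r s * Real.sin (θ s))) t := fun t ht => (hlift t ht).2.2
  have hpos : ∀ t ∈ Icc 0 T, 0 < σ * X.angNum w l (φ t) (ρ t) := by
    rcases angNum_pos_or_neg hp hq hσ0 (convex_Icc 0 T) hφ hρ (fun t ht => (hρe t ht).1) hz
      (fun t ht => (hsol t ht).2)
      (fun t ht => hang _ _ ⟨(hρe t ht).1, (hρe t ht).2.trans_le hle⟩) with hn | hn
    · have := hn 0 h0
      rw [hφ0, hρ0] at this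
      exact absurd this hσA.le.not_gt
    · exact hn
  obtain ⟨hlt, Φ, hΦ0, -, hΦ, -⟩ := exists_isSolutionOn_of_curve hp hq hT hφ hρ hρe hz
    (fun t ht => (hsol t ht).2) hpos
  -- The Euclidean angle ends at ±2π and the weighted angle is within π/2 of it. The endpoint lies
  -- on the axis y = 0, so the two angles coincide there, and monotonicity selects the positive
  -- sign.
  have hφT : φ T = 2 * Real.pi := by
    obtain ⟨a1, a2, a3⟩ := hlift T hTm
    rw [sub_zero, abs_eq (by positivity)] at hθT
    have hsin : Real.sin (θ T) = 0 := by
      rcases hθT with h | h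
      · rw [h]; simp
      · rw [h, Real.sin_neg]; simp
    have := congrArg Prod.snd a3
    simp only [weightedPolar, hsin, mul_zero] at this
    have hs : Real.sin (φ T) = 0 := (mul_eq_zero.1 this).resolve_left (pow_pos a1 _).ne'
    have : φ T - θ T = 0 := eq_zero_of_sin_eq_zero a2 (by rw [Real.sin_sub, hs, hsin]; simp)
    rcases hθT with h | h
    · linarith
    · rw [hφ0] at hlt
      linarith [Real.pi_pos]
  rw [hφ0] at hΦ0 hΦ
  rw [hφT] at hΦ
  exact ⟨Φ, hΦ0.trans hρ0, hΦ⟩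

end PlanarFamily

/-! ### Taylor expansions along weighted polar coordinates -/

theorem coeff_eq_iteratedDeriv {g R : ℝ → ℝ} {a : ℕ → ℝ} {N : ℕ} (hg : AnalyticAt ℝ g 0)
    (hR : ContinuousAt R 0)
    (h : ∀ᶠ x in 𝓝 (0 : ℝ), g x = ∑ i ∈ Finset.range N, a i * x ^ i + x ^ N * R x) :
    ∀ i < N, a i = iteratedDeriv i g 0 / i.factorial := by
  refine coeff_unique (f := g) ?_ ?_
  · have h1 : (fun x => x ^ N * R x) =O[𝓝 (0 : ℝ)] fun x => x ^ N * (1 : ℝ) :=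
      (Asymptotics.isBigO_refl _ _).mul (hR.isBigO_one ℝ)
    simp only [mul_one] at h1
    refine (h1.congr' ?_ EventuallyEq.rfl).mono nhdsWithin_le_nhds
    filter_upwards [h] with x hx
    rw [hx]; ring
  · have h1 := hg.hasFPowerSeriesAt.isBigO_sub_partialSum_pow N
    have h2 : (fun x : ℝ => ‖x‖ ^ N) =O[𝓝 (0 : ℝ)] fun x => x ^ N :=
      Asymptotics.isBigO_of_le _ fun x => by simp
    refine ((h1.trans h2).congr_left fun x => ?_).mono nhdsWithin_le_nhds
    simp only [zero_add, FormalMultilinearSeries.partialSum,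
      FormalMultilinearSeries.ofScalars_apply_eq, smul_eq_mul]

theorem AnalyticAt.exists_eq_taylor {g : ℝ → ℝ} (hg : AnalyticAt ℝ g 0) (N : ℕ) :
    ∃ S : ℝ → ℝ, AnalyticAt ℝ S 0 ∧ ∀ᶠ x in 𝓝 (0 : ℝ),
      g x = ∑ i ∈ Finset.range N, iteratedDeriv i g 0 / i.factorial * x ^ i + x ^ N * S x := by
  have hH : AnalyticAt ℝ (fun z : ℝ × ℝ => g z.1) (0, 0) := hg.comp_of_eq analyticAt_fst rfl
  obtain ⟨c, -, hc⟩ := hH.exists_coeff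
  obtain ⟨R, hR, he⟩ := hc N
  have hS : AnalyticAt ℝ (fun x => R (x, 0)) 0 :=
    hR.comp_of_eq (analyticAt_id.prod analyticAt_const) rfl
  have he' : ∀ᶠ x in 𝓝 (0 : ℝ),
      g x = ∑ i ∈ Finset.range N, c i 0 * x ^ i + x ^ N * R (x, 0) :=
    ((Continuous.prodMk_left (0 : ℝ)).tendsto (0 : ℝ)).eventually he
  refine ⟨_, hS, he'.mono fun x hx => ?_⟩
  rw [hx]
  congr 1
  refine Finset.sum_congr rfl fun i hi => ?_
  rw [← coeff_eq_iteratedDeriv hg hS.continuousAt he' i (Finset.mem_range.1 hi)]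

/-- The Taylor expansion of a function of two variables, to a finite order. -/
theorem AnalyticAt.exists_eq_taylorCoeff {f : ℝ × ℝ → ℝ} (hf : AnalyticAt ℝ f (0, 0)) (N : ℕ) :
    ∃ (S : ℕ → ℝ → ℝ) (R : ℝ × ℝ → ℝ), (∀ i, AnalyticAt ℝ (S i) 0) ∧ AnalyticAt ℝ R (0, 0) ∧
      ∀ᶠ z in 𝓝 ((0, 0) : ℝ × ℝ), f z = ∑ i ∈ Finset.range N,
        (∑ j ∈ Finset.range N, taylorCoeff (fun x y => f (x, y)) i j * z.2 ^ j +
          z.2 ^ N * S i z.2) * z.1 ^ i + z.1 ^ N * R z := by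
  obtain ⟨c, hca, hc⟩ := hf.exists_coeff
  obtain ⟨R, hR, he⟩ := hc N
  choose S hS hSe using fun i => (hca i).exists_eq_taylor N
  have hcoef : ∀ i < N, ∀ j, iteratedDeriv j (c i) 0 / j.factorial =
      taylorCoeff (fun x y => f (x, y)) i j := by
    intro i hi j
    -- `taylorCoeff` differentiates in `x` first and then in `y`; the inner derivative at `x = 0` is
    -- the analytic coefficient function `c i`, up to the factorial.
    have hev : (fun y => iteratedDeriv i (fun x => f (x, y)) 0) =ᶠ[𝓝 0]
        fun y => (i.factorial : ℝ) * c i y := by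
      have hpt : Tendsto (fun y : ℝ => ((0 : ℝ), y)) (𝓝 0) (𝓝 (0, 0)) :=
        (Continuous.prodMk_right (0 : ℝ)).tendsto (0 : ℝ)
      filter_upwards [eventually_nhds_slice he, hpt.eventually hf.eventually_analyticAt,
        hpt.eventually hR.eventually_analyticAt] with y h1 h2 h3
      have := coeff_eq_iteratedDeriv (g := fun x => f (x, y)) (R := fun x => R (x, y))
        (a := fun i => c i y) (h2.comp_of_eq (analyticAt_id.prod analyticAt_const) rfl)
        (h3.comp_of_eq (analyticAt_id.prod analyticAt_const) rfl :
            AnalyticAt ℝ (fun x => R (x, y)) 0).continuousAt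
        h1 i hi
      rw [this]
      field_simp
    rw [taylorCoeff, hev.iteratedDeriv_eq, iteratedDeriv_const_mul_field]
    field_simp
  refine ⟨S, R, hS, hR, ?_⟩
  have hS' : ∀ᶠ z in 𝓝 ((0, 0) : ℝ × ℝ), ∀ i ∈ Finset.range N, c i z.2 =
      ∑ j ∈ Finset.range N, iteratedDeriv j (c i) 0 / j.factorial * z.2 ^ j + z.2 ^ N * S i z.2 :=
    (eventually_all_finset _).2 fun i _ =>
      (continuous_snd.tendsto ((0, 0) : ℝ × ℝ)).eventually (hSe i)
  filter_upwards [he, hS'] with z h1 h2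
  rw [h1]
  congr 1
  refine Finset.sum_congr rfl fun i hi => ?_
  rw [h2 i hi]
  congr 2
  exact Finset.sum_congr rfl fun j _ => by rw [hcoef i (Finset.mem_range.1 hi)]

/-- If the Taylor coefficients of small weighted degree vanish, a power of the radius divides. -/
theorem AnalyticAt.exists_eq_pow_mul {f : ℝ × ℝ → ℝ} (hf : AnalyticAt ℝ f (0, 0)) {w : ℕ × ℕ}
    (hp : 0 < w.1) (hq : 0 < w.2) {n M : ℕ}
    (h : ∀ i j, w.1 * i + w.2 * j + n < M → taylorCoeff (fun x y => f (x, y)) i j = 0) (c s : ℝ) :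
    ∃ A : ℝ × ℝ × ℝ → ℝ, AnalyticAt ℝ A (0, c, s) ∧ ∀ᶠ z in 𝓝 ((0, c, s) : ℝ × ℝ × ℝ),
      z.1 ^ n * f (z.1 ^ w.1 * z.2.1, z.1 ^ w.2 * z.2.2) = z.1 ^ M * A z := by
  -- Order `M` in each variable suffices: since both weights are at least 1, the remainders contain
  -- `x ^ M` or `y ^ M`, hence at least ρ^M.
  obtain ⟨S, R, hS, hR, he⟩ := hf.exists_eq_taylorCoeff M
  have h1 : AnalyticAt ℝ (fun z : ℝ × ℝ × ℝ => z.1) (0, c, s) := analyticAt_fst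
  have h2 : AnalyticAt ℝ (fun z : ℝ × ℝ × ℝ => z.2.1) (0, c, s) :=
    analyticAt_fst.comp_of_eq analyticAt_snd rfl
  have h3 : AnalyticAt ℝ (fun z : ℝ × ℝ × ℝ => z.2.2) (0, c, s) :=
    analyticAt_snd.comp_of_eq analyticAt_snd rfl
  have hx : AnalyticAt ℝ (fun z : ℝ × ℝ × ℝ => z.1 ^ w.1 * z.2.1) (0, c, s) := (h1.pow _).mul h2
  have hy : AnalyticAt ℝ (fun z : ℝ × ℝ × ℝ => z.1 ^ w.2 * z.2.2) (0, c, s) := (h1.pow _).mul h3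
  have hxy0 : ((0 : ℝ) ^ w.1 * c, (0 : ℝ) ^ w.2 * s) = ((0, 0) : ℝ × ℝ) := by
    simp [hp.ne', hq.ne']
  have hSa : ∀ i, AnalyticAt ℝ (fun z : ℝ × ℝ × ℝ => S i (z.1 ^ w.2 * z.2.2)) (0, c, s) := fun i =>
    (hS i).comp_of_eq hy (by simp [hq.ne'])
  have hRa : AnalyticAt ℝ (fun z : ℝ × ℝ × ℝ => R (z.1 ^ w.1 * z.2.1, z.1 ^ w.2 * z.2.2))
      (0, c, s) := hR.comp_of_eq (hx.prod hy) hxy0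
  set b := taylorCoeff (fun x y => f (x, y)) with hb
  -- The subtractions in the exponents truncate only where the Taylor coefficient vanishes by
  -- assumption.
  refine ⟨fun z => ∑ i ∈ Finset.range M,
    (∑ j ∈ Finset.range M, b i j * z.1 ^ (w.1 * i + w.2 * j + n - M) * z.2.1 ^ i * z.2.2 ^ j +
      z.1 ^ (w.1 * i + w.2 * M + n - M) * z.2.1 ^ i * z.2.2 ^ M * S i (z.1 ^ w.2 * z.2.2)) +
      z.1 ^ (w.1 * M + n - M) * z.2.1 ^ M * R (z.1 ^ w.1 * z.2.1, z.1 ^ w.2 * z.2.2), ?_, ?_⟩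
  · refine AnalyticAt.add (Finset.analyticAt_fun_sum _ fun i _ => AnalyticAt.add
      (Finset.analyticAt_fun_sum _ fun j _ => ?_) ?_) ?_
    · exact ((analyticAt_const.mul (h1.pow _)).mul (h2.pow _)).mul (h3.pow _)
    · exact (((h1.pow _).mul (h2.pow _)).mul (h3.pow _)).mul (hSa i)
    · exact ((h1.pow _).mul (h2.pow _)).mul hRa
  · have ht : Tendsto (fun z : ℝ × ℝ × ℝ => (z.1 ^ w.1 * z.2.1, z.1 ^ w.2 * z.2.2)) (𝓝 (0, c, s))
        (𝓝 (0, 0)) := by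
      rw [← hxy0]; exact (hx.prod hy).continuousAt
    filter_upwards [ht.eventually he] with z hz
    have hle : ∀ k, 0 < k → M ≤ k * M := fun k hk => Nat.le_mul_of_pos_left M hk
    have e1 : ∀ k, M ≤ k → z.1 ^ M * z.1 ^ (k - M) = z.1 ^ k := fun k hk => by
      rw [← pow_add, Nat.add_sub_cancel' hk]
    rw [hz]
    simp only [mul_add, Finset.mul_sum, add_mul, Finset.sum_mul]
    congr 1
    · refine Finset.sum_congr rfl fun i _ => ?_
      congr 1
      · refine Finset.sum_congr rfl fun j _ => ?_
        by_cases hij : w.1 * i + w.2 * j + n < M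
        · rw [h i j hij]; ring
        · calc _ = b i j * z.1 ^ (w.1 * i + w.2 * j + n) * z.2.1 ^ i * z.2.2 ^ j := by ring
            _ = _ := by rw [← e1 _ (not_lt.1 hij)]; ring
      · calc _ = z.1 ^ (w.1 * i + w.2 * M + n) * z.2.1 ^ i * z.2.2 ^ M * S i (z.1 ^ w.2 * z.2.2) := by ring
          _ = _ := by rw [← e1 _ (by have := hle _ hq; omega)]; ring
    · calc _ = z.1 ^ (w.1 * M + n) * z.2.1 ^ M * R (z.1 ^ w.1 * z.2.1, z.1 ^ w.2 * z.2.2) := by ring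
        _ = _ := by rw [← e1 _ (by have := hle _ hp; omega)]; ring

/-! ### Leading powers of the radius, and extension of the equation to ρ = 0 -/

namespace PlanarFamily

variable {d : ℕ} {X : PlanarFamily d} {w : ℕ × ℕ} {l : Param d}

/-- The minimal weighted degree of the support. -/
noncomputable def minWeight (X : PlanarFamily d) (l : Param d) (w : ℕ × ℕ) : ℕ :=
  sInf ((fun s : ℕ × ℕ => w.1 * s.1 + w.2 * s.2) '' X.support l)

theorem minWeight_le {s : ℕ × ℕ} (hs : s ∈ X.support l) :
    X.minWeight l w ≤ w.1 * s.1 + w.2 * s.2 := Nat.sInf_le ⟨s, hs, rfl⟩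

/-- A nonempty face forces a nonempty support, and every support point has positive weighted degree.
Positivity makes `minWeight - 1`, the order of the angular numerator, a true subtraction. -/
theorem minWeight_pos (hw : w ∈ X.weights l) : 0 < X.minWeight l w := by
  obtain ⟨hp, hq, -, hne⟩ := hw
  have hs : (X.support l).Nonempty := by
    by_contra! he
    obtain ⟨z, hz⟩ := hne.nonempty
    have := hz.1
    simp [newtonRegion, he] at this
  obtain ⟨s, hs, he⟩ := Nat.sInf_mem (hs.image fun s : ℕ × ℕ => w.1 * s.1 + w.2 * s.2)
  rw [minWeight, ← he]
  rcases hs with hs | hs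
  · exact Nat.add_pos_right _ (Nat.mul_pos hq hs.1)
  · exact Nat.add_pos_left (Nat.mul_pos hp hs.1) _

theorem AnalyticNear.analyticAt_slice (h : X.AnalyticNear l) :
    AnalyticAt ℝ (fun z : ℝ × ℝ => X.P (z.1, z.2, l)) (0, 0) ∧
    AnalyticAt ℝ (fun z : ℝ × ℝ => X.Q (z.1, z.2, l)) (0, 0) :=
  have hc : AnalyticAt ℝ (fun z : ℝ × ℝ => (z.1, z.2, l)) (0, 0) :=
    analyticAt_fst.prod (analyticAt_snd.prod analyticAt_const)
  ⟨h.1.comp_of_eq hc rfl, h.2.comp_of_eq hc rfl⟩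

/-- The numerators of the speeds, divided by the maximal powers of the radius. -/
theorem exists_numerators (hX : X.AnalyticNear l) (hw : w ∈ X.weights l) (φ₀ : ℝ) :
    ∃ A B : ℝ × ℝ → ℝ, AnalyticAt ℝ A (φ₀, 0) ∧ AnalyticAt ℝ B (φ₀, 0) ∧
      ∀ᶠ z in 𝓝 ((φ₀, 0) : ℝ × ℝ),
        X.radNum w l z.1 z.2 = z.2 ^ X.minWeight l w * A z ∧
        X.angNum w l z.1 z.2 = z.2 ^ (X.minWeight l w - 1) * B z := by
  obtain ⟨hP, hQ⟩ := hX.analyticAt_slice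
  obtain ⟨hp, hq, -⟩ := id hw
  set M := X.minWeight l w with hM
  -- The monomial `x^i y^j` of `P` belongs to the support point `(i, j + 1)`, and that of `Q` to `(i
  -- + 1, j)`; this accounts for the extra `w.2` and `w.1` in the degree.
  have hPM : ∀ i j, w.1 * i + w.2 * j + w.2 < M →
      taylorCoeff (fun x y => X.P (x, y, l)) i j = 0 := by
    intro i j hij
    by_contra hne
    have := minWeight_le (w := w) (X := X) (l := l) (s := (i, j + 1))
        (Or.inl ⟨by simp, by simpa using hne⟩)
    simp only [mul_add, mul_one] at this
    omega
  have hQM : ∀ i j, w.1 * i + w.2 * j + w.1 < M →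
      taylorCoeff (fun x y => X.Q (x, y, l)) i j = 0 := by
    intro i j hij
    by_contra hne
    have := minWeight_le (w := w) (X := X) (l := l) (s := (i + 1, j))
        (Or.inr ⟨by simp, by simpa using hne⟩)
    simp only [mul_add, mul_one] at this
    omega
  obtain ⟨A₁, hA₁, e₁⟩ := hP.exists_eq_pow_mul hp hq hPM (Real.cos φ₀) (Real.sin φ₀)
  obtain ⟨A₂, hA₂, e₂⟩ := hQ.exists_eq_pow_mul hp hq hQM (Real.cos φ₀) (Real.sin φ₀)
  -- The angular numerator carries one power of ρ less than the radial one. This is why `F` vanishes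
  -- to first order at ρ = 0.
  obtain ⟨B₁, hB₁, e₃⟩ := hP.exists_eq_pow_mul hp hq (n := w.2 - 1) (M := M - 1)
    (fun i j hij => hPM i j (by omega)) (Real.cos φ₀) (Real.sin φ₀)
  obtain ⟨B₂, hB₂, e₄⟩ := hQ.exists_eq_pow_mul hp hq (n := w.1 - 1) (M := M - 1)
    (fun i j hij => hQM i j (by omega)) (Real.cos φ₀) (Real.sin φ₀)
  have hcos : AnalyticAt ℝ (fun z : ℝ × ℝ => Real.cos z.1) (φ₀, 0) :=
    Real.analyticAt_cos.comp_of_eq analyticAt_fst rfl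
  have hsin : AnalyticAt ℝ (fun z : ℝ × ℝ => Real.sin z.1) (φ₀, 0) :=
    Real.analyticAt_sin.comp_of_eq analyticAt_fst rfl
  have hg : AnalyticAt ℝ (fun z : ℝ × ℝ => (z.2, Real.cos z.1, Real.sin z.1)) (φ₀, 0) :=
    analyticAt_snd.prod (hcos.prod hsin)
  have hc : ∀ {A : ℝ × ℝ × ℝ → ℝ}, AnalyticAt ℝ A (0, Real.cos φ₀, Real.sin φ₀) →
      AnalyticAt ℝ (fun z : ℝ × ℝ => A (z.2, Real.cos z.1, Real.sin z.1)) (φ₀, 0) := fun hA =>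
    hA.comp_of_eq hg rfl
  refine ⟨fun z => Real.cos z.1 * A₁ (z.2, Real.cos z.1, Real.sin z.1) +
      Real.sin z.1 * A₂ (z.2, Real.cos z.1, Real.sin z.1),
    fun z => w.1 * Real.cos z.1 * B₂ (z.2, Real.cos z.1, Real.sin z.1) -
      w.2 * Real.sin z.1 * B₁ (z.2, Real.cos z.1, Real.sin z.1),
    (hcos.mul (hc hA₁)).add (hsin.mul (hc hA₂)),
    ((analyticAt_const.mul hcos).mul (hc hB₂)).sub ((analyticAt_const.mul hsin).mul (hc hB₁)), ?_⟩
  have ht := hg.continuousAt.tendsto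
  filter_upwards [ht.eventually e₁, ht.eventually e₂, ht.eventually e₃, ht.eventually e₄]
    with z h₁ h₂ h₃ h₄
  simp only [radNum, angNum, polarP, polarQ]
  constructor
  · linear_combination Real.cos z.1 * h₁ + Real.sin z.1 * h₂
  · linear_combination (w.1 : ℝ) * Real.cos z.1 * h₄ - w.2 * Real.sin z.1 * h₃

/-- At an angle that is not a characteristic direction, the equation `dρ/dφ = F` extends
analytically to `ρ = 0`, and nearby angles are not characteristic directions. -/
theorem exists_polarF_eq_mul (hX : X.AnalyticNear l) (hw : w ∈ X.weights l) {φ₀ : ℝ}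
    (h : φ₀ ∉ X.charDirections w l) :
    (∃ G : ℝ × ℝ → ℝ, AnalyticAt ℝ G (φ₀, 0) ∧ ∀ᶠ z in 𝓝 ((φ₀, 0) : ℝ × ℝ),
      0 < z.2 → X.polarF w l z.1 z.2 = z.2 * G z) ∧
    ∀ᶠ φ in 𝓝 φ₀, φ ∉ X.charDirections w l := by
  obtain ⟨A, B, hA, hB, he⟩ := exists_numerators hX hw φ₀
  obtain ⟨hp, hq, -⟩ := id hw
  have hM := minWeight_pos hw
  set M := X.minWeight l w with hMdef
  let D : ℝ → ℝ := fun φ => (w.1 : ℝ) * Real.cos φ ^ 2 + (w.2 : ℝ) * Real.sin φ ^ 2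
  have hD : ∀ φ, D φ ≠ 0 := fun φ => (weight_combination_pos hp hq φ).ne'
  -- The normalising power of ρ exactly cancels the order of the angular numerator, so Θ(φ, 0) is `B
  -- (φ, 0) / D φ`, and characteristic directions are the zeros of `B (φ, 0)`.
  have hΘ : ∀ φ ρ : ℝ, 0 < ρ → X.angNum w l φ ρ = ρ ^ (M - 1) * B (φ, ρ) →
      X.angularSpeed w l φ ρ = B (φ, ρ) / D φ := by
    intro φ ρ hρ h
    have h1 : X.angularSpeed w l φ ρ = X.angNum w l φ ρ / polarJac w φ ρ *
      ρ ^ (-X.leadingDegree l w) := rfl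
    have h2 : ρ ^ (-X.leadingDegree l w) * ρ ^ (M - 1) = ρ ^ (w.1 + w.2 - 1) := by
      rw [← zpow_natCast, ← zpow_natCast, ← zpow_add₀ hρ.ne']
      congr 1
      have : X.leadingDegree l w = (M : ℤ) - w.1 - w.2 := rfl
      rw [this]
      omega
    have h3 : ρ ^ (w.1 + w.2 - 1) ≠ 0 := (pow_pos hρ _).ne'
    have hDφ := hD φ
    rw [h1, h, polarJac]
    change _ / (_ * D φ) * _ = _
    rw [div_mul_eq_mul_div, div_eq_div_iff (mul_ne_zero h3 hDφ) hDφ, ← h2]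
    ring
  have hslice := he
  rw [nhds_prod_eq] at hslice
  have hcurry := hslice.curry
  have hBan : ∀ᶠ φ in 𝓝 φ₀, AnalyticAt ℝ B (φ, 0) :=
    ((Continuous.prodMk_left (0 : ℝ)).tendsto φ₀).eventually hB.eventually_analyticAt
  have hlim : ∀ φ, AnalyticAt ℝ B (φ, 0) →
      (∀ᶠ ρ in 𝓝 (0 : ℝ), X.angNum w l φ ρ = ρ ^ (M - 1) * B (φ, ρ)) →
      Tendsto (fun ρ => X.angularSpeed w l φ ρ) (𝓝[>] 0) (𝓝 (B (φ, 0) / D φ)) := by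
    intro φ hBφ hev
    have h1 : Tendsto (fun ρ : ℝ => B (φ, ρ) / D φ) (𝓝[>] 0) (𝓝 (B (φ, 0) / D φ)) := by
      have h2 : ContinuousAt (fun ρ : ℝ => B (φ, ρ)) 0 :=
        hBφ.continuousAt.comp_of_eq (Continuous.prodMk_right φ).continuousAt rfl
      exact (h2.tendsto.mono_left nhdsWithin_le_nhds).div_const _
    refine h1.congr' ?_
    filter_upwards [hev.filter_mono nhdsWithin_le_nhds, self_mem_nhdsWithin] with ρ h2 h3
    exact (hΘ φ ρ h3 h2).symm
  have hB0 : B (φ₀, 0) ≠ 0 := by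
    intro h0
    refine h ?_
    have := hlim φ₀ hB (hcurry.self_of_nhds.mono fun ρ h => h.2)
    rwa [h0, zero_div] at this
  refine ⟨⟨fun z => A z / B z, hA.div hB hB0, ?_⟩, ?_⟩
  · filter_upwards [he, hB.continuousAt.eventually_ne hB0] with z h1 h2 hz
    rw [polarF_eq X hp hq l hz, h1.1, h1.2]
    have hz' := hz.ne'
    have : z.2 ^ M = z.2 ^ (M - 1) * z.2 := by
      rw [← pow_succ, Nat.sub_add_cancel hM]
    rw [this]
    field_simp
  · have hB0' : ∀ᶠ φ in 𝓝 φ₀, B (φ, 0) ≠ 0 :=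
      ((Continuous.prodMk_left (0 : ℝ)).tendsto φ₀).eventually
        (hB.continuousAt.eventually_ne hB0)
    filter_upwards [hcurry, hBan, hB0'] with φ h1 h2 h3 hφ
    have := tendsto_nhds_unique hφ (hlim φ h2 (h1.mono fun ρ h => h.2))
    exact div_ne_zero h3 (hD φ) this.symm

end PlanarFamily

/-! ### The leading coefficient of an inverse integrating factor -/

theorem abs_integral_le_of_abs_le {α : ℝ → ℝ} {K : ℝ} (h : ∀ t ∈ Icc (0 : ℝ) 1, |α t| ≤ K) :
    |∫ t in (0 : ℝ)..1, α t| ≤ K := by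
  have := intervalIntegral.norm_integral_le_of_norm_le_const (a := 0) (b := 1) (f := α) (C := K)
    fun t ht => by
      rw [uIoc_of_le zero_le_one] at ht
      exact h t (Ioc_subset_Icc_self ht)
  simpa using this

/-- Near a point where the equation extends to `ρ = 0`, a factor changes along solutions by a
bounded multiple, and so does the radius. -/
theorem IsFactorOn.eventually_exists_transport {F V : ℝ → ℝ → ℝ} {ε : ℝ} (hε : 0 < ε)
    (h : IsFactorOn F V ε) {G : ℝ × ℝ → ℝ} (hG : AnalyticAt ℝ G (0, 0))
    (hFG : ∀ᶠ z in 𝓝 ((0, 0) : ℝ × ℝ), 0 < z.2 → F z.1 z.2 = z.2 * G z) :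
    ∃ K, ∀ᶠ z in 𝓝 ((0, 0) : ℝ × ℝ), 0 < z.2 → ∃ k₁ k₂ : ℝ, |k₁| ≤ K ∧ |k₂| ≤ K ∧
      V 0 (z.2 * Real.exp k₁) = V z.1 z.2 * Real.exp k₂ := by
  let H : ℝ × ℝ → ℝ := fun z => z.2 * G z
  have hH : AnalyticAt ℝ H (0, 0) := analyticAt_snd.mul hG
  let D : ℝ × ℝ → ℝ := fun z => fderiv ℝ H z (0, 1)
  have hD : AnalyticAt ℝ D (0, 0) :=
    ((ContinuousLinearMap.apply ℝ ℝ ((0, 1) : ℝ × ℝ)).analyticAt _).comp_of_eq hH.fderiv rfl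
  set K := max (|G (0, 0)| + 1) (|D (0, 0)| + 1) with hK
  have hU : ∀ᶠ z in 𝓝 ((0, 0) : ℝ × ℝ), AnalyticAt ℝ G z ∧ AnalyticAt ℝ D z ∧
      |G z| ≤ K ∧ |D z| ≤ K ∧ |z.1| < 1 ∧ z.2 < ε ∧
      (∀ᶠ u in 𝓝 z, 0 < u.2 → F u.1 u.2 = H u) := by
    have h1 : ∀ᶠ z in 𝓝 ((0, 0) : ℝ × ℝ), |G z| < |G (0, 0)| + 1 :=
      hG.continuousAt.abs.eventually_lt_const (lt_add_one _)
    have h2 : ∀ᶠ z in 𝓝 ((0, 0) : ℝ × ℝ), |D z| < |D (0, 0)| + 1 :=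
      hD.continuousAt.abs.eventually_lt_const (lt_add_one _)
    have h3 : ∀ᶠ z in 𝓝 ((0, 0) : ℝ × ℝ), |z.1| < 1 :=
      continuousAt_fst.abs.eventually_lt_const (by simp)
    have h4 : ∀ᶠ z in 𝓝 ((0, 0) : ℝ × ℝ), z.2 < ε := continuousAt_snd.eventually_lt_const hε
    filter_upwards [hG.eventually_analyticAt, hD.eventually_analyticAt, h1, h2, h3, h4,
      eventually_eventually_nhds.2 hFG] with z a1 a2 a3 a4 a5 a6 a7
    exact ⟨a1, a2, a3.le.trans (le_max_left _ _), a4.le.trans (le_max_right _ _), a5, a6, a7⟩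
  have hf : AnalyticAt ℝ (fun z : ℝ × ℝ => ((1 : ℝ), H z)) (0, 0) := analyticAt_const.prod hH
  obtain ⟨_, _, hflow⟩ := hf.exists_local_flow hU
  -- Flowing for time `-z.1` along `(1, H)` leads from the angle `z.1` to the angle 0. The
  -- logarithms of the factors gained by ρ and `V` are integrals of `-z.1 * G` and `-z.1 * D`,
  -- bounded by `K`.
  have ht : Tendsto (fun z : ℝ × ℝ => (-z.1, z)) (𝓝 (0, 0)) (𝓝 (0, (0, 0))) := by
    have : Continuous fun z : ℝ × ℝ => (-z.1, z) := by fun_prop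
    simpa using this.tendsto (0, 0)
  refine ⟨K, ?_⟩
  filter_upwards [ht.eventually hflow, hU] with z hz hzU hpos
  obtain ⟨y, hy0, -, hy⟩ := hz
  have hcont : ContinuousOn y (Icc 0 1) := fun t ht => (hy t ht).2.continuousWithinAt
  have h1 : ∀ t ∈ Icc (0 : ℝ) 1, HasDerivWithinAt (fun t => (y t).1) (-z.1) (Icc 0 1) t := by
    intro t ht
    have := (ContinuousLinearMap.fst ℝ ℝ ℝ).hasFDerivAt.comp_hasDerivWithinAt t (hy t ht).2
    refine HasDerivWithinAt.congr_deriv this ?_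
    simp
  have h2 : ∀ t ∈ Icc (0 : ℝ) 1,
      HasDerivWithinAt (fun t => (y t).2) (-z.1 * G (y t) * (y t).2) (Icc 0 1) t := by
    intro t ht
    have := (ContinuousLinearMap.snd ℝ ℝ ℝ).hasFDerivAt.comp_hasDerivWithinAt t (hy t ht).2
    refine HasDerivWithinAt.congr_deriv this ?_
    simp [H]; ring
  have hGc : ContinuousOn (fun t => -z.1 * G (y t)) (Icc 0 1) :=
    continuousOn_const.mul fun t ht =>
      (hy t ht).1.1.continuousAt.comp_continuousWithinAt (hcont t ht)
  have hDc : ContinuousOn (fun t => -z.1 * D (y t)) (Icc 0 1) :=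
    continuousOn_const.mul fun t ht =>
      (hy t ht).1.2.1.continuousAt.comp_continuousWithinAt (hcont t ht)
  have hbound : ∀ g : ℝ × ℝ → ℝ, (∀ t ∈ Icc (0 : ℝ) 1, |g (y t)| ≤ K) →
      |∫ t in (0 : ℝ)..1, -z.1 * g (y t)| ≤ K := by
    intro g hg
    refine abs_integral_le_of_abs_le fun t ht => ?_
    rw [abs_mul, abs_neg]
    have := mul_le_mul hzU.2.2.2.2.1.le (hg t ht) (abs_nonneg _) zero_le_one
    linarith
  have hrad : ∀ t ∈ Icc (0 : ℝ) 1, (y t).2 = z.2 * Real.exp (∫ s in (0 :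
      ℝ)..t, -z.1 * G (y s)) := by
    intro t ht
    have := eq_mul_exp_of_hasDerivWithinAt hGc h2 ht
    rwa [hy0] at this
  have hcyl : ∀ t ∈ Icc (0 : ℝ) 1, y t ∈ openCylinder ε := fun t ht =>
    ⟨by rw [hrad t ht]; positivity, (hy t ht).1.2.2.2.2.2.1⟩
  have h3 : ∀ t ∈ Icc (0 : ℝ) 1, HasDerivWithinAt (fun t => V (y t).1 (y t).2)
      (-z.1 * D (y t) * V (y t).1 (y t).2) (Icc 0 1) t := by
    intro t ht
    have hev : (fun u : ℝ × ℝ => F u.1 u.2) =ᶠ[𝓝 (y t)] H := by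
      filter_upwards [(hy t ht).1.2.2.2.2.2.2, (isOpen_openCylinder ε).mem_nhds (hcyl t ht)]
        with u hu hu'
      exact hu hu'.1
    have := (h.hasFDerivAt_factor (hcyl t ht)).comp_hasDerivWithinAt t (hy t ht).2
    refine HasDerivWithinAt.congr_deriv this ?_
    have hp := h.pde (y t) (hcyl t ht)
    rw [hev.fderiv_eq, show F (y t).1 (y t).2 = H (y t) from hev.self_of_nhds] at hp
    rw [map_smul, hp, smul_eq_mul]
    ring
  have one_mem : (1 : ℝ) ∈ Icc (0 : ℝ) 1 := right_mem_Icc.2 zero_le_one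
  have hang : (y 1).1 = 0 := by
    have := eqOn_of_hasDerivWithinAt_eq h1 (g₂ := fun t => z.1 - z.1 * t) (fun t ht => by
      refine HasDerivAt.hasDerivWithinAt ?_
      simpa using ((hasDerivAt_id t).const_mul z.1).const_sub z.1) (by simp [hy0]) one_mem
    simpa using this
  have hVend := eq_mul_exp_of_hasDerivWithinAt hDc h3 one_mem
  refine ⟨_, _, hbound G fun t ht => (hy t ht).1.2.2.1, hbound D fun t ht => (hy t ht).1.2.2.2.1, ?_⟩
  rw [← hrad 1 one_mem]
  rw [hang, hy0] at hVend
  exact hVend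

/-- The leading coefficient of a factor does not vanish where the equation extends to `ρ = 0`,
unless it vanishes locally. -/
theorem IsFactorOn.leading_ne_zero {F V : ℝ → ℝ → ℝ} {ε : ℝ} (hε : 0 < ε)
    (h : IsFactorOn F V ε) {G : ℝ × ℝ → ℝ} (hG : AnalyticAt ℝ G (0, 0))
    (hFG : ∀ᶠ z in 𝓝 ((0, 0) : ℝ × ℝ), 0 < z.2 → F z.1 z.2 = z.2 * G z) {m : ℤ} {c : ℝ → ℝ}
    (hc : ∀ᶠ s in 𝓝 (0 : ℝ), Tendsto (fun ρ => V s ρ / ρ ^ m) (𝓝[>] 0) (𝓝 (c s)))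
    (hne : ∃ᶠ s in 𝓝 (0 : ℝ), c s ≠ 0) : c 0 ≠ 0 := by
  intro h0
  obtain ⟨K, hK⟩ := h.eventually_exists_transport hε hG hFG
  have hcurry : ∀ᶠ s in 𝓝 (0 : ℝ), ∀ᶠ ρ in 𝓝 (0 : ℝ), 0 < ρ → ∃ k₁ k₂ : ℝ, |k₁| ≤ K ∧ |k₂| ≤ K ∧
      V 0 (ρ * Real.exp k₁) = V s ρ * Real.exp k₂ := by
    rw [nhds_prod_eq] at hK
    exact hK.curry
  -- An angle `s` with nonzero leading coefficient, close enough to 0 for transport from `s` to 0.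
  obtain ⟨s, hs, hsc, hsK⟩ := (hne.and_eventually (hc.and hcurry)).exists
  have hV0 : Tendsto (fun ρ => V 0 ρ / ρ ^ m) (𝓝[>] 0) (𝓝 0) := by
    simpa [h0] using hc.self_of_nhds
  have hex : ∃ k₁ k₂ : ℝ → ℝ, ∀ᶠ ρ in 𝓝[>] (0 : ℝ), |k₁ ρ| ≤ K ∧ |k₂ ρ| ≤ K ∧
      V 0 (ρ * Real.exp (k₁ ρ)) = V s ρ * Real.exp (k₂ ρ) := by
    have : ∀ ρ : ℝ, ∃ k₁ k₂ : ℝ, (0 < ρ → ∃ k₁ k₂ : ℝ, |k₁| ≤ K ∧ |k₂| ≤ K ∧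
        V 0 (ρ * Real.exp k₁) = V s ρ * Real.exp k₂) → 0 < ρ → |k₁| ≤ K ∧ |k₂| ≤ K ∧
        V 0 (ρ * Real.exp k₁) = V s ρ * Real.exp k₂ := by
      intro ρ
      by_cases hh : ∃ k₁ k₂ : ℝ, |k₁| ≤ K ∧ |k₂| ≤ K ∧
        V 0 (ρ * Real.exp k₁) = V s ρ * Real.exp k₂
      · obtain ⟨a, b, hab⟩ := hh
        exact ⟨a, b, fun _ _ => hab⟩
      · exact ⟨0, 0, fun h1 h2 => absurd (h1 h2) hh⟩
    choose k₁ k₂ hk using this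
    refine ⟨k₁, k₂, ?_⟩
    filter_upwards [hsK.filter_mono nhdsWithin_le_nhds, self_mem_nhdsWithin] with ρ h1 h2
    exact hk ρ h1 h2
  obtain ⟨k₁, k₂, hk⟩ := hex
  have htend : Tendsto (fun ρ => ρ * Real.exp (k₁ ρ)) (𝓝[>] (0 : ℝ)) (𝓝[>] 0) := by
    refine tendsto_nhdsWithin_iff.2 ⟨?_, ?_⟩
    · have h1 : Tendsto (fun ρ : ℝ => ρ * Real.exp K) (𝓝[>] 0) (𝓝 0) := by
        have : Tendsto (fun ρ : ℝ => ρ * Real.exp K) (𝓝 0) (𝓝 (0 * Real.exp K)) :=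
          tendsto_id.mul_const _
        rw [zero_mul] at this
        exact this.mono_left nhdsWithin_le_nhds
      refine tendsto_of_tendsto_of_tendsto_of_le_of_le' tendsto_const_nhds h1 ?_ ?_
      · filter_upwards [self_mem_nhdsWithin] with ρ hρ
        exact mul_nonneg (mem_Ioi.1 hρ).le (Real.exp_pos _).le
      · filter_upwards [hk, self_mem_nhdsWithin] with ρ h1 hρ
        exact mul_le_mul_of_nonneg_left (Real.exp_le_exp.2 ((le_abs_self _).trans h1.1))
          (mem_Ioi.1 hρ).le
    · filter_upwards [self_mem_nhdsWithin] with ρ hρ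
      exact mul_pos (mem_Ioi.1 hρ) (Real.exp_pos _)
  have hlim := hV0.comp htend
  -- Transport writes `V s ρ / ρ ^ m` as the same quotient at angle 0 and radius `ρ * exp k₁`, which
  -- tends to 0, times the bounded factor `exp (m k₁ - k₂)`. The coefficient at `s` would then
  -- vanish too.
  have hbd : Tendsto (fun ρ => V s ρ / ρ ^ m) (𝓝[>] 0) (𝓝 0) := by
    refine squeeze_zero_norm' (a := fun ρ => ‖((fun ρ => V 0 ρ / ρ ^ m) ∘
      fun ρ => ρ * Real.exp (k₁ ρ)) ρ‖ * Real.exp (|(m : ℝ)| * K + K)) ?_ ?_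
    · filter_upwards [hk, self_mem_nhdsWithin] with ρ h1 hρ
      have hρ0 : (0 : ℝ) < ρ := hρ
      obtain ⟨a1, a2, a3⟩ := h1
      have e : V s ρ / ρ ^ m = V 0 (ρ * Real.exp (k₁ ρ)) / (ρ * Real.exp (k₁ ρ)) ^ m *
          Real.exp (m * k₁ ρ - k₂ ρ) := by
        rw [a3, mul_zpow, Real.exp_sub, mul_comm (m : ℝ), Real.exp_mul, Real.rpow_intCast]
        have := Real.exp_pos (k₂ ρ)
        have := zpow_ne_zero m hρ0.ne'
        field_simp
      rw [e, norm_mul, Function.comp_apply]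
      refine mul_le_mul_of_nonneg_left ?_ (norm_nonneg _)
      rw [Real.norm_of_nonneg (Real.exp_pos _).le, Real.exp_le_exp]
      have b1 : m * k₁ ρ ≤ |(m : ℝ)| * K := (le_abs_self _).trans (by
        rw [abs_mul]; exact mul_le_mul_of_nonneg_left a1 (abs_nonneg _))
      linarith [neg_le_of_abs_le a2]
    · have := (hlim.norm).mul_const (Real.exp (|(m : ℝ)| * K + K))
      simpa using this
  exact hs (tendsto_nhds_unique hsc hbd)

/-- The leading term of a Laurent expansion. -/
theorem tendsto_div_zpow_of_hasSum {f : ℝ → ℝ} {m : ℤ} {c : ℕ → ℝ}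
    (h : ∀ᶠ ρ in 𝓝[>] (0 : ℝ), HasSum (fun k : ℕ => c k * ρ ^ (m + k : ℤ)) (f ρ)) :
    Tendsto (fun ρ => f ρ / ρ ^ m) (𝓝[>] 0) (𝓝 (c 0)) := by
  have h' : ∀ᶠ ρ in 𝓝[>] (0 : ℝ), HasSum (fun k : ℕ => c k * ρ ^ k) (f ρ / ρ ^ m) := by
    filter_upwards [h, self_mem_nhdsWithin] with ρ hρ hpos
    have hne := zpow_ne_zero m (mem_Ioi.1 hpos).ne'
    refine (hρ.div_const (ρ ^ m)).congr_fun ?_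
    intro k
    rw [zpow_add₀ (mem_Ioi.1 hpos).ne', zpow_natCast]
    field_simp
  -- Convergence at a single radius `r` bounds `|c k| * r ^ k`; for `ρ < r / 2` the tail is
  -- dominated by a geometric series of size O(ρ).
  obtain ⟨r, hr, hr0⟩ := (h'.and self_mem_nhdsWithin).exists
  have hr0 : 0 < r := hr0
  have hsum : Summable fun k : ℕ => c k * r ^ k := hr.summable
  obtain ⟨C, hC⟩ := hsum.tendsto_atTop_zero.norm.bddAbove_range
  have hC' : ∀ k, |c k| * r ^ k ≤ C := fun k => by
    have := hC ⟨k, rfl⟩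
    simpa [abs_mul, abs_of_pos hr0] using this
  have hC0 : 0 ≤ C := by have := hC' 0; exact (by positivity : 0 ≤ |c 0| * r ^ 0).trans this
  have hmain : ∀ᶠ ρ in 𝓝[>] (0 : ℝ), ‖f ρ / ρ ^ m - c 0‖ ≤ ρ * (2 * C / r) := by
    have hsm : ∀ᶠ ρ in 𝓝[>] (0 : ℝ), ρ < r / 2 :=
      (gt_mem_nhds (by positivity)).filter_mono nhdsWithin_le_nhds
    filter_upwards [h', self_mem_nhdsWithin, hsm] with ρ h1 h2 h3
    have h2 : 0 < ρ := h2
    have h4 : HasSum (fun k : ℕ => c (k + 1) * ρ ^ (k + 1)) (f ρ / ρ ^ m - c 0) := by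
      have := (hasSum_nat_add_iff' (f := fun k : ℕ => c k * ρ ^ k) 1).2 h1
      simpa using this
    have h5 : HasSum (fun k : ℕ => C * (ρ / r) * (1 / 2) ^ k) (C * (ρ / r) * 2) :=
      hasSum_geometric_two.mul_left _
    rw [← h4.tsum_eq]
    refine (tsum_of_norm_bounded h5 fun k => ?_).trans (by apply le_of_eq; ring)
    rw [Real.norm_eq_abs, abs_mul, abs_of_pos (pow_pos h2 _)]
    have e : ρ ^ (k + 1) = r ^ (k + 1) * ((ρ / r) * (ρ / r) ^ k) := by
      rw [← pow_succ', div_pow]; field_simp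
    rw [e, ← mul_assoc]
    have h6 : (ρ / r) ^ k ≤ (1 / 2) ^ k := by
      refine pow_le_pow_left₀ (by positivity) ?_ k
      rw [div_le_iff₀ hr0]; linarith
    calc |c (k + 1)| * r ^ (k + 1) * ((ρ / r) * (ρ / r) ^ k) ≤ C * ((ρ / r) * (1 / 2) ^ k) :=
          mul_le_mul (hC' _) (mul_le_mul_of_nonneg_left h6 (by positivity)) (by positivity) hC0
      _ = _ := by ring
  rw [tendsto_iff_norm_sub_tendsto_zero]
  refine squeeze_zero' (Eventually.of_forall fun _ => norm_nonneg _) hmain ?_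
  have : Tendsto (fun ρ : ℝ => ρ * (2 * C / r)) (𝓝 0) (𝓝 (0 * (2 * C / r))) :=
    tendsto_id.mul_const _
  rw [zero_mul] at this
  exact this.mono_left nhdsWithin_le_nhds

/-! ### Neighbourhoods in the parameter space -/

namespace PlanarFamily

variable {d : ℕ} {X : PlanarFamily d} {w : ℕ × ℕ} {l : Param d}

theorem analyticAt_polarF (hp : 0 < w.1) (hq : 0 < w.2) {φ ρ : ℝ} (hρ : 0 < ρ)
    (hP : AnalyticAt ℝ X.P (ρ ^ w.1 * Real.cos φ, ρ ^ w.2 * Real.sin φ, l))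
    (hQ : AnalyticAt ℝ X.Q (ρ ^ w.1 * Real.cos φ, ρ ^ w.2 * Real.sin φ, l))
    (h : X.angNum w l φ ρ ≠ 0) :
    AnalyticAt ℝ (fun z : ℝ × ℝ × Param d => X.polarF w z.2.2 z.1 z.2.1) (φ, ρ, l) := by
  have h1 : AnalyticAt ℝ (fun z : ℝ × ℝ × Param d => Real.cos z.1) (φ, ρ, l) :=
    Real.analyticAt_cos.comp_of_eq analyticAt_fst rfl
  have h2 : AnalyticAt ℝ (fun z : ℝ × ℝ × Param d => Real.sin z.1) (φ, ρ, l) :=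
    Real.analyticAt_sin.comp_of_eq analyticAt_fst rfl
  have h3 : AnalyticAt ℝ (fun z : ℝ × ℝ × Param d => z.2.1) (φ, ρ, l) :=
    analyticAt_fst.comp_of_eq analyticAt_snd rfl
  have h4 : AnalyticAt ℝ (fun z : ℝ × ℝ × Param d => z.2.2) (φ, ρ, l) :=
    analyticAt_snd.comp_of_eq analyticAt_snd rfl
  have hg : AnalyticAt ℝ (fun z : ℝ × ℝ × Param d =>
      (z.2.1 ^ w.1 * Real.cos z.1, z.2.1 ^ w.2 * Real.sin z.1, z.2.2)) (φ, ρ, l) :=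
    ((h3.pow _).mul h1).prod (((h3.pow _).mul h2).prod h4)
  have hP' : AnalyticAt ℝ (fun z : ℝ × ℝ × Param d => X.polarP w z.2.2 z.1 z.2.1) (φ, ρ, l) :=
    hP.comp_of_eq hg rfl
  have hQ' : AnalyticAt ℝ (fun z : ℝ × ℝ × Param d => X.polarQ w z.2.2 z.1 z.2.1) (φ, ρ, l) :=
    hQ.comp_of_eq hg rfl
  have hR : AnalyticAt ℝ (fun z : ℝ × ℝ × Param d => X.radNum w z.2.2 z.1 z.2.1) (φ, ρ, l) :=
    (((h3.pow _).mul h1).mul hP').add (((h3.pow _).mul h2).mul hQ')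
  have hA : AnalyticAt ℝ (fun z : ℝ × ℝ × Param d => X.angNum w z.2.2 z.1 z.2.1) (φ, ρ, l) :=
    (((analyticAt_const.mul (h3.pow _)).mul h1).mul hQ').sub
      (((analyticAt_const.mul (h3.pow _)).mul h2).mul hP')
  refine (hR.div hA h).congr ?_
  filter_upwards [h3.continuousAt.eventually_const_lt hρ] with z hz
  exact (polarF_eq X hp hq z.2.2 hz).symm

/-- All that is used of the family for the parameter `l` on the cylinder `0 < ρ < ε`. -/
structure IsRegularAt (X : PlanarFamily d) (w : ℕ × ℕ) (m : ℤ) (V : Param d → ℝ → ℝ → ℝ)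
    (W : ℝ × Param d → ℝ) (ε : ℝ) (l : Param d) : Prop where
  weights : 0 < w.1 ∧ 0 < w.2
  pos : 0 < ε
  le_one : ε ≤ 1
  mono : X.IsMonodromic l
  analytic : ∀ x y : ℝ, |x| < ε → |y| < ε → AnalyticAt ℝ X.P (x, y, l) ∧ AnalyticAt ℝ X.Q (x, y, l)
  angNum_ne : ∀ φ : ℝ, ∀ ρ ∈ Ioo 0 ε, X.angNum w l φ ρ ≠ 0
  factor : IsFactorOn (X.polarF w l) (V l) ε
  periodic : ∀ φ : ℝ, ∀ ρ ∈ Ioo 0 ε, V l (φ + 2 * Real.pi) ρ = V l φ ρ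
  factor_eq : ∀ ρ ∈ Ioo 0 ε, V l 0 ρ = ρ ^ m * W (ρ, l)
  cofactor : ∀ ρ ∈ Ico 0 ε, AnalyticAt ℝ W (ρ, l) ∧ W (ρ, l) ≠ 0

theorem abs_weightedPolar_lt (hp : 0 < w.1) (hq : 0 < w.2) {ε ρ : ℝ} (hε : ε ≤ 1)
    (hρ : ρ ∈ Ioo 0 ε) (φ : ℝ) : |ρ ^ w.1 * Real.cos φ| < ε ∧ |ρ ^ w.2 * Real.sin φ| < ε := by
  have h : ∀ n : ℕ, 0 < n → ∀ c : ℝ, |c| ≤ 1 → |ρ ^ n * c| < ε := by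
    intro n hn c hc
    rw [abs_mul, abs_of_pos (pow_pos hρ.1 n)]
    calc ρ ^ n * |c| ≤ ρ ^ n * 1 := mul_le_mul_of_nonneg_left hc (pow_pos hρ.1 n).le
      _ ≤ ρ := by rw [mul_one]; exact pow_le_of_le_one hρ.1.le (hρ.2.le.trans hε) hn.ne'
      _ < ε := hρ.2
  exact ⟨h _ hp _ (Real.abs_cos_le_one φ), h _ hq _ (Real.abs_sin_le_one φ)⟩

theorem analyticAt_polarF_of_small (hp : 0 < w.1) (hq : 0 < w.2) {ε : ℝ} (hε : ε ≤ 1)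
    (ha : ∀ x y : ℝ, |x| < ε → |y| < ε → AnalyticAt ℝ X.P (x, y, l) ∧ AnalyticAt ℝ X.Q (x, y, l))
    (hang : ∀ φ : ℝ, ∀ ρ ∈ Ioo 0 ε, X.angNum w l φ ρ ≠ 0) {φ ρ : ℝ} (hρ : ρ ∈ Ioo 0 ε) :
    AnalyticAt ℝ (fun z : ℝ × ℝ × Param d => X.polarF w z.2.2 z.1 z.2.1) (φ, ρ, l) := by
  obtain ⟨h1, h2⟩ := abs_weightedPolar_lt hp hq hε hρ φ
  obtain ⟨h3, h4⟩ := ha _ _ h1 h2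
  exact analyticAt_polarF hp hq hρ.1 h3 h4 (hang φ ρ hρ)

theorem isFactorOn (hp : 0 < w.1) (hq : 0 < w.2) {ε : ℝ} (hε : ε ≤ 1)
    (ha : ∀ x y : ℝ, |x| < ε → |y| < ε → AnalyticAt ℝ X.P (x, y, l) ∧ AnalyticAt ℝ X.Q (x, y, l))
    (hang : ∀ φ : ℝ, ∀ ρ ∈ Ioo 0 ε, X.angNum w l φ ρ ≠ 0) {ε' : ℝ} (hle : ε ≤ ε') {V : ℝ → ℝ → ℝ}
    (hV : X.IsInverseIntegratingFactor w l ε' V) :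
    IsFactorOn (X.polarF w l) V ε ∧ ∀ φ : ℝ, ∀ ρ ∈ Ioo 0 ε, V (φ + 2 * Real.pi) ρ = V φ ρ := by
  have hsub : openCylinder ε ⊆ X.punctCylinder w l ε' := fun z hz =>
    ⟨⟨hz.1, hz.2.trans_le hle⟩, (angularSpeed_ne_zero_iff X hp hq l hz.1).2 (hang z.1 z.2 hz)⟩
  have hF : ∀ z ∈ openCylinder ε, ContDiffAt ℝ 1 (fun z : ℝ × ℝ => X.polarF w l z.1 z.2) z := by
    intro z hz
    have hc : AnalyticAt ℝ (fun z : ℝ × ℝ => (z.1, z.2, l)) z :=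
      analyticAt_fst.prod (analyticAt_snd.prod analyticAt_const)
    have := (analyticAt_polarF_of_small hp hq hε ha hang (φ := z.1) hz).comp_of_eq hc rfl
    exact AnalyticAt.contDiffAt this
  have hVd : ContDiffOn ℝ 1 (fun z : ℝ × ℝ => V z.1 z.2) (openCylinder ε) := hV.contDiffOn.mono hsub
  refine ⟨⟨fun z hz => (hF z hz).contDiffWithinAt, hVd, fun z hz => ?_⟩,
    fun φ ρ hρ => hV.periodic (φ, ρ) (hsub hρ)⟩
  have hdV := ((hVd.contDiffAt ((isOpen_openCylinder ε).mem_nhds hz)).differentiableAt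
    one_ne_zero).hasFDerivAt
  have hdF := ((hF z hz).differentiableAt one_ne_zero).hasFDerivAt
  have e1 : HasDerivAt (fun φ => (φ, z.2)) ((1, 0) : ℝ × ℝ) z.1 :=
    (hasDerivAt_id _).prodMk (hasDerivAt_const _ _)
  have e2 : HasDerivAt (fun ρ => (z.1, ρ)) ((0, 1) : ℝ × ℝ) z.2 :=
    (hasDerivAt_const _ _).prodMk (hasDerivAt_id _)
  have d1 : deriv (fun φ => V φ z.2) z.1 = fderiv ℝ (fun z : ℝ × ℝ => V z.1 z.2) z (1, 0) :=
    (HasFDerivAt.comp_hasDerivAt (l := fun z : ℝ × ℝ => V z.1 z.2) z.1 hdV e1).deriv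
  have d2 : deriv (fun ρ => V z.1 ρ) z.2 = fderiv ℝ (fun z : ℝ × ℝ => V z.1 z.2) z (0, 1) :=
    (HasFDerivAt.comp_hasDerivAt (l := fun z : ℝ × ℝ => V z.1 z.2) z.2 hdV e2).deriv
  have d3 : deriv (fun ρ => X.polarF w l z.1 ρ) z.2 =
      fderiv ℝ (fun z : ℝ × ℝ => X.polarF w l z.1 z.2) z (0, 1) :=
    (HasFDerivAt.comp_hasDerivAt (l := fun z : ℝ × ℝ => X.polarF w l z.1 z.2) z.2 hdF e2).deriv
  have hp := hV.pde z (hsub hz)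
  rw [d1, d2, d3] at hp
  rw [← hp]
  have : ((1, X.polarF w l z.1 z.2) : ℝ × ℝ) = (1, 0) + X.polarF w l z.1 z.2 • ((0, 1) :
      ℝ × ℝ) := by
    simp
  rw [this, map_add, map_smul, smul_eq_mul]
  ring

/-- All hypotheses are brought onto one cylinder of common radius for parameters near `l₀`. The
substantial point is `W (0, l₀) ≠ 0`, from `IsFactorOn.leading_ne_zero` at the angle 0; continuity
then extends it to nearby radii and parameters. -/
theorem exists_isRegularAt {E : Set (Param d)} {m : ℤ} {V : Param d → ℝ → ℝ → ℝ}
    {v : ℤ → Param d → ℝ → ℝ} (hE : IsOpen E) (hX : ∀ l ∈ E, X.AnalyticNear l)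
    (hmono : E ⊆ X.monodromicSet) (hw : ∀ l ∈ E, w ∈ X.weights l)
    (h0 : ∀ l ∈ E, (0 : ℝ) ∉ X.charDirections w l) (hcrit : ∀ l ∈ E, X.NonCriticalNear w l)
    (hV : X.IsLaurentFactor w E m V v) {l₀ : Param d} (hl₀ : l₀ ∈ E) :
    ∃ (W : ℝ × Param d → ℝ) (ε : ℝ), ∀ᶠ l in 𝓝 l₀, X.IsRegularAt w m V W ε l := by
  obtain ⟨hp, hq, -⟩ := hw l₀ hl₀
  obtain ⟨ε₁, hε₁, h₁⟩ := hcrit l₀ hl₀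
  obtain ⟨ε₂, hε₂, h₂⟩ := hV.factor l₀ hl₀
  obtain ⟨W, hW, hWe⟩ := hV.analytic l₀ hl₀ 0 (h0 l₀ hl₀)
  have hPQ : ∀ᶠ z in 𝓝 ((0, 0, l₀) : ℝ × ℝ × Param d), AnalyticAt ℝ X.P z ∧ AnalyticAt ℝ X.Q z :=
    (hX l₀ hl₀).1.eventually_analyticAt.and (hX l₀ hl₀).2.eventually_analyticAt
  obtain ⟨r₁, hr₁, hb₁⟩ := Metric.eventually_nhds_iff.1 hPQ
  -- the leading coefficient does not vanish at `l₀`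
  have hW0 : W (0, l₀) ≠ 0 := by
    set ε := min (min ε₁ ε₂) (min r₁ 1) with hεdef
    have hε : 0 < ε := lt_min (lt_min hε₁ hε₂) (lt_min hr₁ one_pos)
    have hε1 : ε ≤ 1 := (min_le_right _ _).trans (min_le_right _ _)
    have hεr : ε ≤ r₁ := (min_le_right _ _).trans (min_le_left _ _)
    have ha : ∀ x y : ℝ, |x| < ε → |y| < ε →
        AnalyticAt ℝ X.P (x, y, l₀) ∧ AnalyticAt ℝ X.Q (x, y, l₀) := fun x y hx hy =>
      hb₁ (by simpa [Prod.dist_eq, hr₁] using ⟨hx.trans_le hεr, hy.trans_le hεr⟩)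
    have hang : ∀ φ : ℝ, ∀ ρ ∈ Ioo 0 ε, X.angNum w l₀ φ ρ ≠ 0 := fun φ ρ hρ =>
      (angularSpeed_ne_zero_iff X hp hq l₀ hρ.1).1 (h₁.self_of_nhds φ ρ
        ⟨hρ.1, hρ.2.trans_le ((min_le_left _ _).trans (min_le_left _ _))⟩)
    have hfac := (isFactorOn hp hq hε1 ha hang ((min_le_left _ _).trans (min_le_right _ _))
      h₂.self_of_nhds).1
    obtain ⟨⟨G, hG, hFG⟩, hchar⟩ := exists_polarF_eq_mul (hX l₀ hl₀) (hw l₀ hl₀) (h0 l₀ hl₀)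
    have hlim : ∀ s ∉ X.charDirections w l₀,
        Tendsto (fun ρ => V l₀ s ρ / ρ ^ m) (𝓝[>] 0) (𝓝 (v m l₀ s)) := fun s hs => by
      simpa using tendsto_div_zpow_of_hasSum (c := fun k : ℕ => v (m + k) l₀ s)
        (hV.expansion l₀ hl₀ s hs)
    have hv := hfac.leading_ne_zero hε hG hFG (hchar.mono hlim) (hV.leading l₀ hl₀ 0 (h0 l₀ hl₀))
    have hlim' : Tendsto (fun ρ => V l₀ 0 ρ / ρ ^ m) (𝓝[>] 0) (𝓝 (W (0, l₀))) := by
      have h1 : ContinuousAt (fun ρ : ℝ => W (ρ, l₀)) 0 :=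
        hW.continuousAt.comp_of_eq (Continuous.prodMk_left l₀).continuousAt rfl
      refine (h1.tendsto.mono_left nhdsWithin_le_nhds).congr' ?_
      have h2 : ∀ᶠ ρ in 𝓝 (0 : ℝ), 0 < ρ → V l₀ 0 ρ = ρ ^ m * W (ρ, l₀) :=
        ((Continuous.prodMk_left l₀).tendsto (0 : ℝ)).eventually hWe
      filter_upwards [h2.filter_mono nhdsWithin_le_nhds, self_mem_nhdsWithin] with ρ h3 h4
      have := zpow_ne_zero m (mem_Ioi.1 h4).ne'
      rw [h3 h4, mul_div_cancel_left₀ _ this]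
    rw [tendsto_nhds_unique hlim' (hlim 0 (h0 l₀ hl₀))]
    exact hv
  obtain ⟨r₂, hr₂, hb₂⟩ := Metric.eventually_nhds_iff.1
    ((hW.eventually_analyticAt.and (hW.continuousAt.eventually_ne hW0)).and hWe)
  set ε := min (min ε₁ ε₂) (min (min r₁ r₂) 1) with hεdef
  have hε : 0 < ε := lt_min (lt_min hε₁ hε₂) (lt_min (lt_min hr₁ hr₂) one_pos)
  have hε1 : ε ≤ 1 := (min_le_right _ _).trans (min_le_right _ _)
  have hεr₁ : ε ≤ r₁ := (min_le_right _ _).trans ((min_le_left _ _).trans (min_le_left _ _))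
  have hεr₂ : ε ≤ r₂ := (min_le_right _ _).trans ((min_le_left _ _).trans (min_le_right _ _))
  refine ⟨W, ε, ?_⟩
  filter_upwards [h₁, h₂, hE.mem_nhds hl₀, Metric.ball_mem_nhds l₀ (lt_min hr₁ hr₂)]
    with l a₁ a₂ hl hball
  rw [Metric.mem_ball, lt_min_iff] at hball
  have ha : ∀ x y : ℝ, |x| < ε → |y| < ε →
      AnalyticAt ℝ X.P (x, y, l) ∧ AnalyticAt ℝ X.Q (x, y, l) := fun x y hx hy =>
    hb₁ (by simpa [Prod.dist_eq] using ⟨hx.trans_le hεr₁, hy.trans_le hεr₁, hball.1⟩)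
  have hang : ∀ φ : ℝ, ∀ ρ ∈ Ioo 0 ε, X.angNum w l φ ρ ≠ 0 := fun φ ρ hρ =>
    (angularSpeed_ne_zero_iff X hp hq l hρ.1).1 (a₁ φ ρ
      ⟨hρ.1, hρ.2.trans_le ((min_le_left _ _).trans (min_le_left _ _))⟩)
  obtain ⟨hfac, hper⟩ := isFactorOn hp hq hε1 ha hang
    ((min_le_left _ _).trans (min_le_right _ _)) a₂
  have hWl : ∀ ρ ∈ Ico 0 ε, dist ((ρ, l) : ℝ × Param d) (0, l₀) < r₂ := fun ρ hρ => by
    simpa [Prod.dist_eq, abs_of_nonneg hρ.1] using ⟨hρ.2.trans_le hεr₂, hball.2⟩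
  exact ⟨⟨hp, hq⟩, hε, hε1, hmono hl, ha, hang, hfac, hper,
    fun ρ hρ => (hb₂ (hWl ρ ⟨hρ.1.le, hρ.2⟩)).2 hρ.1, fun ρ hρ => (hb₂ (hWl ρ hρ)).1⟩

end PlanarFamily

/-! ### The Poincaré map -/

namespace PlanarFamily

variable {d : ℕ} {X : PlanarFamily d} {w : ℕ × ℕ} {m : ℤ} {V : Param d → ℝ → ℝ → ℝ}
  {W : ℝ × Param d → ℝ} {ε : ℝ} {l : Param d}

theorem IsRegularAt.analyticAt_polarF (h : X.IsRegularAt w m V W ε l) {φ ρ : ℝ}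
    (hρ : ρ ∈ Ioo 0 ε) :
    AnalyticAt ℝ (fun z : ℝ × ℝ × Param d => X.polarF w z.2.2 z.1 z.2.1) (φ, ρ, l) :=
  analyticAt_polarF_of_small h.weights.1 h.weights.2 h.le_one h.analytic h.angNum_ne hρ

/-- Solutions of `dρ/dφ = F` depend analytically on the initial value and the parameter. -/
theorem exists_analytic_transition {l₀ : Param d} (h : ∀ᶠ l in 𝓝 l₀, X.IsRegularAt w m V W ε l)
    {a b : ℝ} (hab : a ≤ b) {Φ₀ : ℝ → ℝ} (hΦ₀ : IsSolutionOn (X.polarF w l₀) ε a b Φ₀)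
    {O : Set (ℝ × ℝ)} (hO : IsOpen O) (hΦO : ∀ t ∈ Icc a b, (t, Φ₀ t) ∈ O) :
    ∃ g : ℝ × Param d → ℝ, AnalyticAt ℝ g (Φ₀ a, l₀) ∧ g (Φ₀ a, l₀) = Φ₀ b ∧
      ∀ᶠ z in 𝓝 ((Φ₀ a, l₀) : ℝ × Param d), ∃ Φ : ℝ → ℝ, Φ a = z.1 ∧ Φ b = g z ∧
        IsSolutionOn (X.polarF w z.2) ε a b Φ ∧ ∀ t ∈ Icc a b, (t, Φ t) ∈ O := by
  let f : ℝ × ℝ × Param d → ℝ × ℝ × Param d := fun z => (1, X.polarF w z.2.2 z.1 z.2.1, 0)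
  let N : Set (Param d) := interior {l | X.IsRegularAt w m V W ε l}
  have hl₀ : l₀ ∈ N := mem_interior_iff_mem_nhds.2 h
  let O' : Set (ℝ × ℝ × Param d) := {z | z.2.1 ∈ Ioo 0 ε ∧ z.2.2 ∈ N ∧ (z.1, z.2.1) ∈ O}
  have hO' : IsOpen O' :=
    (isOpen_Ioo.preimage (by fun_prop)).inter ((isOpen_interior.preimage (by fun_prop)).inter
      (hO.preimage (by fun_prop)))
  have hf : AnalyticOnNhd ℝ f O' := fun z hz =>
    analyticAt_const.prod (((interior_subset hz.2.1 :
        X.IsRegularAt w m V W ε z.2.2).analyticAt_polarF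
      hz.1).prod analyticAt_const)
  obtain ⟨g, hg, hgb, hev⟩ := hasAnalyticFlow hO' hf hab (γ := fun t => (t, Φ₀ t, l₀))
    (fun t ht => ⟨(hΦ₀ t ht).1, hl₀, hΦO t ht⟩)
    (fun t ht => (hasDerivWithinAt_id _ _).prodMk ((hΦ₀ t ht).2.prodMk (hasDerivWithinAt_const _ _ _)))
  have hi : AnalyticAt ℝ (fun z : ℝ × Param d => (a, z.1, z.2)) (Φ₀ a, l₀) :=
    analyticAt_const.prod (analyticAt_fst.prod analyticAt_snd)
  refine ⟨fun z => (g (a, z.1, z.2)).2.1, ?_, congrArg (fun z => z.2.1) hgb, ?_⟩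
  · exact (((ContinuousLinearMap.fst ℝ ℝ (Param d)).comp
      (ContinuousLinearMap.snd ℝ ℝ (ℝ × Param d))).analyticAt _).comp_of_eq
        (hg.comp_of_eq hi rfl) rfl
  · filter_upwards [hi.continuousAt.tendsto.eventually hev] with z hz
    obtain ⟨y, hya, hyb, hy⟩ := hz
    have e1 : EqOn (fun t => (y t).1) (fun t => t) (Icc a b) := by
      refine eqOn_of_hasDerivWithinAt_eq (g' := fun _ => 1) (fun t ht => ?_)
        (fun t ht => hasDerivWithinAt_id _ _) (by simp [hya])
      exact (ContinuousLinearMap.fst ℝ ℝ (ℝ × Param d)).hasFDerivAt.comp_hasDerivWithinAt t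
        (hy t ht).2
    have e3 : EqOn (fun t => (y t).2.2) (fun _ => z.2) (Icc a b) := by
      have hd : ∀ t ∈ Icc a b, HasDerivWithinAt (fun t => (y t).2.2) 0 (Icc a b) t := fun t ht =>
        ((ContinuousLinearMap.snd ℝ ℝ (Param d)).comp
          (ContinuousLinearMap.snd ℝ ℝ (ℝ × Param d))).hasFDerivAt.comp_hasDerivWithinAt t (hy t ht).2
      intro t ht
      have hz2 : (y a).2.2 = z.2 := by rw [hya]
      refine Eq.trans ?_ hz2
      refine constant_of_has_deriv_right_zero (fun t ht => (hd t ht).continuousWithinAt)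
        (fun t ht => ?_) t ht
      exact (hd t ⟨ht.1, ht.2.le⟩).mono_of_mem_nhdsWithin (Icc_mem_nhdsGE_of_mem ht)
    refine ⟨fun t => (y t).2.1, congrArg (fun z => z.2.1) hya, congrArg (fun z => z.2.1) hyb,
      fun t ht => ⟨(hy t ht).1.1, ?_⟩, fun t ht => ?_⟩
    · have := ((ContinuousLinearMap.fst ℝ ℝ (Param d)).comp
        (ContinuousLinearMap.snd ℝ ℝ (ℝ × Param d))).hasFDerivAt.comp_hasDerivWithinAt t (hy t ht).2
      refine HasDerivWithinAt.congr_deriv this ?_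
      change X.polarF w (y t).2.2 (y t).1 (y t).2.1 = _
      rw [show (y t).1 = t from e1 ht, show (y t).2.2 = z.2 from e3 ht]
    · have := (hy t ht).1.2.2
      rwa [show (y t).1 = t from e1 ht] at this

theorem IsRegularAt.isTurn (h : X.IsRegularAt w m V W ε l) {Φ : ℝ → ℝ}
    (hΦ : IsSolutionOn (X.polarF w l) ε 0 (2 * Real.pi) Φ) : X.IsTurn w l (Φ 0) Φ :=
  ⟨rfl, fun φ hφ => ⟨(hΦ φ hφ).1.1, (angularSpeed_ne_zero_iff X h.weights.1 h.weights.2 l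
    (hΦ φ hφ).1.1).2 (h.angNum_ne _ _ (hΦ φ hφ).1), (hΦ φ hφ).2⟩⟩

/-- The competing turn need not stay below `ε`; uniqueness uses regularity of the field only along
`Φ`. So the value of `poincareMap` does not depend on the chosen solution. -/
theorem IsRegularAt.turn_unique (h : X.IsRegularAt w m V W ε l) {Φ Ψ : ℝ → ℝ}
    (hΦ : IsSolutionOn (X.polarF w l) ε 0 (2 * Real.pi) Φ) (hΨ : X.IsTurn w l (Φ 0) Ψ) :
    Ψ (2 * Real.pi) = Φ (2 * Real.pi) := by
  have := ODE_solution_unique_of_contDiffAt (f := fun z : ℝ × ℝ => ((1 : ℝ), X.polarF w l z.1 z.2))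
    (y₁ := fun t => (t, Φ t)) (y₂ := fun t => (t, Ψ t)) (a := 0) (b := 2 * Real.pi)
    (fun t ht => (hasDerivWithinAt_id _ _).prodMk (hΦ t ht).2)
    (fun t ht => (hasDerivWithinAt_id _ _).prodMk (hΨ.2 t ht).2.2)
    (fun t ht => contDiffAt_const.prodMk
      (h.factor.field.contDiffAt ((isOpen_openCylinder ε).mem_nhds (hΦ t ht).1)))
    (by simp [hΨ.1])
  exact (congrArg Prod.snd (this (right_mem_Icc.2 (by positivity)))).symm

theorem IsRegularAt.poincareMap_eq (h : X.IsRegularAt w m V W ε l) {Φ : ℝ → ℝ}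
    (hΦ : IsSolutionOn (X.polarF w l) ε 0 (2 * Real.pi) Φ) :
    X.poincareMap w l (Φ 0) = Φ (2 * Real.pi) := by
  have hex : ∃ Ψ : ℝ → ℝ, X.IsTurn w l (Φ 0) Ψ := ⟨Φ, h.isTurn hΦ⟩
  rw [poincareMap, dif_pos hex]
  exact h.turn_unique hΦ hex.choose_spec

theorem IsRegularAt.eventually_exists_turn (h : X.IsRegularAt w m V W ε l) {e : ℝ} (he : 0 < e)
    (hle : e ≤ ε) : ∀ᶠ ρ in 𝓝[>] (0 : ℝ), ∃ Φ : ℝ → ℝ, Φ 0 = ρ ∧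
      IsSolutionOn (X.polarF w l) e 0 (2 * Real.pi) Φ := by
  obtain ⟨δ, hδ, H⟩ := h.mono.exists_turn h.weights.1 h.weights.2 h.angNum_ne he hle
  filter_upwards [Ioo_mem_nhdsGT hδ] with ρ hρ
  exact H ρ hρ

theorem IsRegularAt.poincareWellDefined (h : X.IsRegularAt w m V W ε l) :
    X.PoincareWellDefined w l := by
  filter_upwards [h.eventually_exists_turn h.pos le_rfl] with ρ hρ
  obtain ⟨Φ, rfl, hΦ⟩ := hρ
  refine ⟨⟨Φ, h.isTurn hΦ⟩, fun Ψ hΨ => ?_⟩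
  rw [h.turn_unique hΦ hΨ, h.poincareMap_eq hΦ]

theorem IsRegularAt.factor_ne (h : X.IsRegularAt w m V W ε l) : ∀ ρ ∈ Ioo 0 ε, V l 0 ρ ≠ 0 := by
  intro ρ hρ
  rw [h.factor_eq ρ hρ]
  exact mul_ne_zero (zpow_ne_zero _ hρ.1.ne') (h.cofactor ρ ⟨hρ.1.le, hρ.2⟩).2

/-- The translation length of the Poincaré map in the coordinate `∫ dρ / V(0, ρ)`. -/
theorem IsRegularAt.exists_period (h : X.IsRegularAt w m V W ε l) :
    ∃ T, ∀ Φ, IsSolutionOn (X.polarF w l) ε 0 (2 * Real.pi) Φ →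
      ∫ s in (Φ 0)..(Φ (2 * Real.pi)), (V l 0 s)⁻¹ = T :=
  h.factor.exists_period (by positivity) h.factor_ne fun ρ hρ => by
    simpa using h.periodic 0 ρ hρ

theorem IsRegularAt.integral_eq (h : X.IsRegularAt w m V W ε l) {a b : ℝ} (ha : a ∈ Ioo 0 ε)
    (hb : b ∈ Ioo 0 ε) : ∫ s in a..b, (V l 0 s)⁻¹ = ∫ s in a..b, (s ^ m * W (s, l))⁻¹ := by
  refine intervalIntegral.integral_congr fun s hs => ?_
  rw [h.factor_eq s (ordConnected_Ioo.uIcc_subset ha hb hs)]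

/-- Every turn has the same period, so it may be measured from one fixed radius `c > 0`, where the
transition map is analytic in the parameter. Rescaling the interval from `c` to its image to [0, 1]
leaves an analytic integrand, away from ρ = 0. -/
theorem analyticAt_period {l₀ : Param d} (h : ∀ᶠ l in 𝓝 l₀, X.IsRegularAt w m V W ε l)
    {T : Param d → ℝ} (hT : ∀ᶠ l in 𝓝 l₀, ∀ Φ, IsSolutionOn (X.polarF w l) ε 0 (2 * Real.pi) Φ →
      ∫ s in (Φ 0)..(Φ (2 * Real.pi)), (V l 0 s)⁻¹ = T l) : AnalyticAt ℝ T l₀ := by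
  have h₀ := h.self_of_nhds
  obtain ⟨Φ₀, hΦ₀⟩ := (h₀.eventually_exists_turn h₀.pos le_rfl).exists
  obtain ⟨Φ₀, -, hΦ₀⟩ := hΦ₀
  set c := Φ₀ 0 with hc
  have hc0 : c ∈ Ioo 0 ε := (hΦ₀ 0 (left_mem_Icc.2 (by positivity))).1
  obtain ⟨g, hg, hgb, hev⟩ := exists_analytic_transition h (by positivity) hΦ₀ isOpen_univ
    fun _ _ => mem_univ _
  let P : Param d → ℝ := fun l => g (c, l)
  have hP : AnalyticAt ℝ P l₀ := hg.comp_of_eq (analyticAt_const.prod analyticAt_id) rfl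
  have hP0 : P l₀ ∈ Ioo 0 ε := by
    rw [show P l₀ = _ from hgb]
    exact (hΦ₀ _ (right_mem_Icc.2 (by positivity))).1
  have hsl : ContinuousAt (fun l : Param d => (c, l)) l₀ := by fun_prop
  have hTl : ∀ᶠ l in 𝓝 l₀, ∫ s in (0 : ℝ)..1, (P l - c) *
      ((c + (P l - c) * s) ^ m * W (c + (P l - c) * s, l))⁻¹ = T l := by
    filter_upwards [h, hT, hsl.tendsto.eventually hev] with l h1 h2 h3
    obtain ⟨Φ, hΦa, hΦb, hΦ, -⟩ := h3
    have := h2 Φ hΦ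
    rw [h1.integral_eq (hΦ _ (left_mem_Icc.2 (by positivity))).1
      (hΦ _ (right_mem_Icc.2 (by positivity))).1, hΦa, hΦb] at this
    rw [← this, intervalIntegral.integral_const_mul]
    have e := intervalIntegral.smul_integral_comp_add_mul (a := 0) (b := 1)
      (fun s => (s ^ m * W (s, l))⁻¹) (P l - c) c
    rw [smul_eq_mul] at e
    rw [e]
    simp [P]
  refine AnalyticAt.congr ?_ hTl
  refine AnalyticAt.integral_unitInterval (g := fun z : ℝ × Param d => (P z.2 - c) *
      ((c + (P z.2 - c) * z.1) ^ m * W (c + (P z.2 - c) * z.1, z.2))⁻¹) fun s hs => ?_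
  have a1 : AnalyticAt ℝ (fun z : ℝ × Param d => P z.2) (s, l₀) := hP.comp_of_eq analyticAt_snd rfl
  have a2 : AnalyticAt ℝ (fun z : ℝ × Param d => c + (P z.2 - c) * z.1) (s, l₀) :=
    analyticAt_const.add ((a1.sub analyticAt_const).mul analyticAt_fst)
  have hmem : c + (P l₀ - c) * s ∈ Ioo 0 ε := by
    have := (convex_Ioo 0 ε).add_smul_sub_mem hc0 hP0 hs
    rwa [smul_eq_mul, mul_comm s] at this
  obtain ⟨b1, b2⟩ := h₀.cofactor _ ⟨hmem.1.le, hmem.2⟩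
  refine (a1.sub analyticAt_const).mul (AnalyticAt.inv ((a2.fun_zpow hmem.1.ne').mul
    (b1.comp_of_eq (a2.prod analyticAt_snd) rfl)) ?_)
  exact mul_ne_zero (zpow_ne_zero _ hmem.1.ne') b2

/-- The Poincaré map is a translation in the coordinate `∫ dρ / V(0, ρ)`. -/
theorem exists_isTranslationNear {l₀ : Param d} (h : ∀ᶠ l in 𝓝 l₀, X.IsRegularAt w m V W ε l) :
    ∃ T : Param d → ℝ, IsTranslationNear m W T (X.poincareMap w) ε l₀ := by
  have hex : ∀ l, ∃ T, X.IsRegularAt w m V W ε l → ∀ Φ,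
      IsSolutionOn (X.polarF w l) ε 0 (2 * Real.pi) Φ →
        ∫ s in (Φ 0)..(Φ (2 * Real.pi)), (V l 0 s)⁻¹ = T := by
    intro l
    by_cases hl : X.IsRegularAt w m V W ε l
    · obtain ⟨T, hT⟩ := hl.exists_period
      exact ⟨T, fun _ => hT⟩
    · exact ⟨0, fun h' => absurd h' hl⟩
  choose T hT using hex
  have h₀ := h.self_of_nhds
  have h0 : (0 : ℝ) ∈ Ico 0 ε := ⟨le_rfl, h₀.pos⟩
  refine ⟨T, h₀.pos, (h₀.cofactor 0 h0).1, (h₀.cofactor 0 h0).2, ?_,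
    analyticAt_period h (h.mono hT), ?_⟩
  · filter_upwards [h] with l hl
    refine ⟨fun s hs => ?_, fun s hs => (hl.cofactor s ⟨hs.1.le, hs.2⟩).2⟩
    exact ((hl.cofactor s ⟨hs.1.le, hs.2⟩).1.continuousAt.comp_of_eq
      (Continuous.prodMk_left l).continuousAt rfl).continuousWithinAt
  · filter_upwards [h] with l hl
    constructor
    · refine tendsto_order.2 ⟨fun a ha => ?_, fun a ha => ?_⟩
      · filter_upwards [hl.eventually_exists_turn hl.pos le_rfl] with ρ hρ
        obtain ⟨Φ, rfl, hΦ⟩ := hρ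
        rw [hl.poincareMap_eq hΦ]
        exact ha.trans (hΦ _ (right_mem_Icc.2 (by positivity))).1.1
      -- Monodromy provides turns inside any prescribed cylinder, so the return map tends to 0.
      · filter_upwards [hl.eventually_exists_turn (lt_min ha hl.pos) (min_le_right _ _)] with ρ hρ
        obtain ⟨Φ, rfl, hΦ⟩ := hρ
        rw [hl.poincareMap_eq (hΦ.mono_radius (min_le_right _ _))]
        exact (hΦ _ (right_mem_Icc.2 (by positivity))).1.2.trans_le (min_le_left _ _)
    · filter_upwards [hl.eventually_exists_turn hl.pos le_rfl] with ρ hρ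
      obtain ⟨Φ, rfl, hΦ⟩ := hρ
      have hb := (hΦ _ (right_mem_Icc.2 (by positivity : (0 : ℝ) ≤ 2 * Real.pi))).1
      rw [hl.poincareMap_eq hΦ, ← hl.integral_eq (hΦ _ (left_mem_Icc.2 (by positivity))).1 hb]
      exact ⟨hb, hT l hl Φ hΦ⟩

end PlanarFamily

/-! ### Closed orbits -/

/-- A solution of an autonomous equation that returns to its initial value closes up. -/
theorem exists_periodic_extension {E : Type*} [NormedAddCommGroup E] [NormedSpace ℝ E]
    {f : E → E} {z : ℝ → E} {τ : ℝ} (hτ : 0 < τ) (h0 : z τ = z 0)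
    (hz : ∀ t ∈ Icc 0 τ, HasDerivWithinAt z (f (z t)) (Icc 0 τ) t) :
    ∃ y : ℝ → E, (∀ t, HasDerivAt y (f (y t)) t) ∧ Function.Periodic y τ ∧ y 0 = z 0 ∧
      ∀ t, ∃ s ∈ Icc 0 τ, y t = z s := by
  -- Time is reduced modulo `τ`. At multiples of `τ` the one-sided derivatives match because the
  -- equation is autonomous and `z τ = z 0`.
  let y : ℝ → E := fun t => z (t - ⌊t / τ⌋ * τ)
  have hfl : ∀ t : ℝ, ⌊t / τ⌋ * τ ≤ t ∧ t < (⌊t / τ⌋ + 1) * τ := fun t =>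
    ⟨(le_div_iff₀ hτ).1 (Int.floor_le _), (div_lt_iff₀ hτ).1 (Int.lt_floor_add_one _)⟩
  have hy : ∀ (n : ℤ), ∀ t ∈ Icc (n * τ) ((n + 1) * τ), y t = z (t - n * τ) := by
    intro n t ht
    rcases ht.2.lt_or_eq with hlt | heq
    · have : ⌊t / τ⌋ = n := Int.floor_eq_iff.2 ⟨(le_div_iff₀ hτ).2 ht.1, (div_lt_iff₀ hτ).2 hlt⟩
      simp only [y, this]
    · have : ⌊t / τ⌋ = n + 1 := by
        rw [heq, mul_div_cancel_right₀ _ hτ.ne']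
        exact_mod_cast Int.floor_intCast (n + 1)
      simp only [y, this]
      rw [heq]
      push_cast
      rw [sub_self, show (n + 1 : ℝ) * τ - n * τ = τ by ring, h0]
  have hd : ∀ (n : ℤ), ∀ t ∈ Icc (n * τ) ((n + 1) * τ),
      HasDerivWithinAt y (f (y t)) (Icc (n * τ) ((n + 1) * τ)) t := by
    intro n t ht
    have hmaps : MapsTo (fun s => s - n * τ) (Icc (n * τ) ((n + 1) * τ)) (Icc 0 τ) :=
      fun s hs => ⟨by linarith [hs.1], by linarith [hs.2]⟩
    have h1 := HasDerivWithinAt.scomp t (hz _ (hmaps ht))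
      ((hasDerivAt_id t).sub_const (n * τ)).hasDerivWithinAt hmaps
    rw [one_smul, id, ← hy n t ht] at h1
    exact h1.congr (hy n) (hy n t ht)
  refine ⟨y, fun t => ?_, fun t => ?_, ?_, fun t => ?_⟩
  · obtain ⟨h1, h2⟩ := hfl t
    set n := ⌊t / τ⌋
    rcases h1.lt_or_eq with hlt | heq
    · exact (hd n t ⟨h1, h2.le⟩).hasDerivAt (Icc_mem_nhds hlt h2)
    · have hr := hd n t ⟨h1, h2.le⟩
      have hl := hd (n - 1) t ⟨by push_cast; linarith, by push_cast; linarith⟩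
      refine (hl.union hr).hasDerivAt ?_
      refine mem_of_superset (Icc_mem_nhds (a := t - τ) (by linarith) h2) fun s hs => ?_
      rcases le_total s t with hst | hst
      · exact Or.inl ⟨by push_cast; linarith [hs.1], by push_cast; linarith⟩
      · exact Or.inr ⟨h1.trans hst, hs.2⟩
  · have : ⌊(t + τ) / τ⌋ = ⌊t / τ⌋ + 1 := by
      rw [add_div, div_self hτ.ne', Int.floor_add_one]
    simp only [y, this]
    congr 1
    push_cast
    ring
  · simp [y]
  · obtain ⟨h1, h2⟩ := hfl t
    exact ⟨_, ⟨by linarith, by linarith⟩, rfl⟩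

theorem hasDerivWithinAt_weightedPolar {w : ℕ × ℕ} {φ ρ : ℝ → ℝ} {a b t : ℝ} {s : Set ℝ}
    (hφ : HasDerivWithinAt φ a s t) (hρ : HasDerivWithinAt ρ b s t) :
    HasDerivWithinAt (fun u => weightedPolar w (φ u, ρ u))
      (w.1 * ρ t ^ (w.1 - 1) * Real.cos (φ t) * b - ρ t ^ w.1 * Real.sin (φ t) * a,
        w.2 * ρ t ^ (w.2 - 1) * Real.sin (φ t) * b + ρ t ^ w.2 * Real.cos (φ t) * a) s t := by
  have := (hasFDerivAt_weightedPolar w (φ t, ρ t)).comp_hasDerivWithinAt t (hφ.prodMk hρ)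
  refine HasDerivWithinAt.congr_deriv this ?_
  simp

/-- Weighted polar coordinates are unique up to full turns. -/
theorem weightedPolar_inj {w : ℕ × ℕ} (hp : 0 < w.1) (hq : 0 < w.2) {φ φ' ρ ρ' : ℝ} (hρ : 0 < ρ)
    (hρ' : 0 < ρ') (h : weightedPolar w (φ, ρ) = weightedPolar w (φ', ρ')) :
    ρ = ρ' ∧ Real.cos φ = Real.cos φ' ∧ Real.sin φ = Real.sin φ' := by
  have hnorm : ∀ φ ρ : ℝ, 0 < ρ → (weightedPolar w (φ, ρ)).1 ^ 2 / ρ ^ (2 * w.1) +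
      (weightedPolar w (φ, ρ)).2 ^ 2 / ρ ^ (2 * w.2) = 1 := by
    intro φ ρ hρ
    have h1 := (pow_pos hρ w.1).ne'
    have h2 := (pow_pos hρ w.2).ne'
    simp only [weightedPolar, mul_comm 2, pow_mul]
    rw [mul_pow, mul_pow, mul_div_cancel_left₀ _ (pow_ne_zero 2 h1),
      mul_div_cancel_left₀ _ (pow_ne_zero 2 h2)]
    linarith [Real.sin_sq_add_cos_sq φ]
  have hne : ((weightedPolar w (φ, ρ)).1, (weightedPolar w (φ, ρ)).2) ≠ ((0, 0) : ℝ × ℝ) := by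
    intro h0
    have h1 := hnorm φ ρ hρ
    rw [(Prod.ext_iff.1 h0).1, (Prod.ext_iff.1 h0).2] at h1
    simp at h1
  have e1 := hnorm φ ρ hρ
  have e2 := hnorm φ' ρ' hρ'
  rw [← h] at e2
  have hρρ : ρ = ρ' := by
    rcases lt_trichotomy ρ ρ' with hlt | heq | hlt
    · have := weighted_radius_lt hp hq hne hρ hlt
      rw [e1, e2] at this
      exact absurd this (lt_irrefl _)
    · exact heq
    · have := weighted_radius_lt hp hq hne hρ' hlt
      rw [e1, e2] at this
      exact absurd this (lt_irrefl _)
  subst hρρ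
  refine ⟨rfl, ?_, ?_⟩
  · exact mul_left_cancel₀ (pow_pos hρ w.1).ne' (Prod.ext_iff.1 h).1
  · exact mul_left_cancel₀ (pow_pos hρ w.2).ne' (Prod.ext_iff.1 h).2

namespace PlanarFamily

variable {d : ℕ} {X : PlanarFamily d} {w : ℕ × ℕ} {m : ℤ} {V : Param d → ℝ → ℝ → ℝ}
  {W : ℝ × Param d → ℝ} {ε : ℝ} {l : Param d}

theorem IsRegularAt.contDiffAt_field (h : X.IsRegularAt w m V W ε l) {z : ℝ × ℝ} (h1 : |z.1| < ε)
    (h2 : |z.2| < ε) : ContDiffAt ℝ 1 (X.field l) z := by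
  obtain ⟨hP, hQ⟩ := h.analytic z.1 z.2 h1 h2
  have hc : AnalyticAt ℝ (fun z : ℝ × ℝ => (z.1, z.2, l)) z :=
    analyticAt_fst.prod (analyticAt_snd.prod analyticAt_const)
  exact ((hP.comp_of_eq hc rfl).prod (hQ.comp_of_eq hc rfl) : AnalyticAt ℝ (X.field l) z).contDiffAt

theorem IsRegularAt.continuousOn_angNum (h : X.IsRegularAt w m V W ε l) :
    ContinuousOn (fun z : ℝ × ℝ => X.angNum w l z.1 z.2) (openCylinder ε) := by
  intro z hz
  obtain ⟨h1, h2⟩ := abs_weightedPolar_lt h.weights.1 h.weights.2 h.le_one hz z.1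
  have hf : ContinuousAt (fun z : ℝ × ℝ => X.field l (weightedPolar w z)) z :=
    (h.contDiffAt_field (z := weightedPolar w z) h1 h2).continuousAt.comp_of_eq
      (hasFDerivAt_weightedPolar w z).continuousAt rfl
  have hP : ContinuousAt (fun z : ℝ × ℝ => X.polarP w l z.1 z.2) z := continuousAt_fst.comp hf
  have hQ : ContinuousAt (fun z : ℝ × ℝ => X.polarQ w l z.1 z.2) z := continuousAt_snd.comp hf
  refine ContinuousAt.continuousWithinAt ?_
  refine ContinuousAt.sub (ContinuousAt.mul ?_ hQ) (ContinuousAt.mul ?_ hP)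
  · fun_prop
  · fun_prop

/-- The angular speed has a constant sign. -/
theorem IsRegularAt.exists_sign (h : X.IsRegularAt w m V W ε l) :
    ∃ σ : ℝ, (σ = 1 ∨ σ = -1) ∧ ∀ φ : ℝ, ∀ ρ ∈ Ioo 0 ε, 0 < σ * X.angNum w l φ ρ := by
  have hconn : IsPreconnected (openCylinder ε) :=
    ((convex_Ioo 0 ε).linear_preimage (LinearMap.snd ℝ ℝ ℝ)).isPreconnected
  by_cases hpos : ∀ φ : ℝ, ∀ ρ ∈ Ioo 0 ε, 0 < X.angNum w l φ ρ
  · exact ⟨1, Or.inl rfl, fun φ ρ hρ => by rw [one_mul]; exact hpos φ ρ hρ⟩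
  · push Not at hpos
    obtain ⟨φ₁, ρ₁, hρ₁, hle⟩ := hpos
    refine ⟨-1, Or.inr rfl, fun φ ρ hρ => ?_⟩
    by_contra! hge
    have hge' : 0 ≤ X.angNum w l φ ρ := by linarith
    obtain ⟨z, hz, hz0⟩ := hconn.intermediate_value (a := (φ₁, ρ₁)) (b := (φ, ρ)) hρ₁ hρ
      h.continuousOn_angNum ⟨hle, hge'⟩
    exact h.angNum_ne z.1 z.2 hz hz0

/-- A solution of `dρ/dφ = F` that closes up after one turn is a periodic orbit. -/
theorem IsRegularAt.exists_isPeriodicOrbit (h : X.IsRegularAt w m V W ε l) {Φ : ℝ → ℝ}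
    (hΦ : IsSolutionOn (X.polarF w l) ε 0 (2 * Real.pi) Φ) (hclosed : Φ (2 * Real.pi) = Φ 0) :
    ∃ Γ, X.IsPeriodicOrbit l Γ ∧
      ∀ z ∈ Γ, ∃ s ∈ Icc 0 (2 * Real.pi), z = weightedPolar w (s, Φ s) := by
  obtain ⟨hp, hq⟩ := h.weights
  obtain ⟨σ, hσ, hpos⟩ := h.exists_sign
  have hσσ : σ * σ = 1 := by rcases hσ with rfl | rfl <;> norm_num
  have hpi : (0 : ℝ) < 2 * Real.pi := by positivity
  have hcyl : ∀ t ∈ Icc 0 (2 * Real.pi), (t, Φ t) ∈ openCylinder ε := fun t ht => (hΦ t ht).1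
  have hJ : ∀ t ∈ Icc 0 (2 * Real.pi), 0 < polarJac w t (Φ t) := fun t ht =>
    polarJac_pos hp hq (hΦ t ht).1.1
  have hA : ∀ t ∈ Icc 0 (2 * Real.pi), 0 < σ * X.angNum w l t (Φ t) := fun t ht =>
    hpos t _ (hΦ t ht).1
  have hcont : ContinuousOn (fun t => polarJac w t (Φ t) / (σ * X.angNum w l t (Φ t)))
      (Icc 0 (2 * Real.pi)) := by
    refine ContinuousOn.div ?_ (continuousOn_const.mul ?_) fun t ht => (hA t ht).ne'
    · have := hΦ.continuousOn
      unfold polarJac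
      fun_prop
    · exact h.continuousOn_angNum.comp (continuousOn_id.prodMk hΦ.continuousOn) hcyl
  -- Time is recovered as a function of the angle by integrating the reciprocal of the angular
  -- velocity; its inverse `k` gives the angle at a given time. The sign `σ` makes time increase
  -- with the angle.
  obtain ⟨hlt, k, hka, hkb, hk⟩ := exists_inverse_of_hasDerivWithinAt_pos hpi
    (fun t ht => hasDerivWithinAt_primitive hcont ht) fun t ht => div_pos (hJ t ht) (hA t ht)
  simp only [intervalIntegral.integral_same] at hlt hka hk
  set τ := ∫ s in (0 : ℝ)..(2 * Real.pi), polarJac w s (Φ s) / (σ * X.angNum w l s (Φ s)) with hτ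
  let z : ℝ → ℝ × ℝ := fun s => weightedPolar w (k s, Φ (k s))
  have hz : ∀ s ∈ Icc 0 τ, HasDerivWithinAt z (σ • X.field l (z s)) (Icc 0 τ) s := by
    intro s hs
    obtain ⟨h1, -, h3⟩ := hk s hs
    have h4 := HasDerivWithinAt.scomp s (hΦ _ h1).2 h3 fun u hu => (hk u hu).1
    refine (hasDerivWithinAt_weightedPolar h3 h4).congr_deriv ?_
    have hA' := (hA _ h1).ne'
    have hA'' : X.angNum w l (k s) (Φ (k s)) ≠ 0 := right_ne_zero_of_mul hA'
    have hJ' := (hJ _ h1).ne'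
    have hσ0 : σ ≠ 0 := left_ne_zero_of_mul hA'
    simp only [z, field_weightedPolar, Function.comp_apply, smul_eq_mul, inv_div]
    rw [polarF_eq X hp hq l (hΦ _ h1).1.1]
    generalize hρ : Φ (k s) = ρ at *
    generalize k s = φ at *
    have e1 : ρ ^ (w.1 - 1) * ρ ^ w.2 = ρ ^ (w.1 + w.2 - 1) := by
      rw [← pow_add]; congr 1; omega
    have e2 : ρ ^ (w.2 - 1) * ρ ^ w.1 = ρ ^ (w.1 + w.2 - 1) := by
      rw [← pow_add]; congr 1; omega
    have hJe : polarJac w φ ρ = ρ ^ (w.1 + w.2 - 1) *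
      ((w.1 : ℝ) * Real.cos φ ^ 2 + (w.2 : ℝ) * Real.sin φ ^ 2) := rfl
    have ea : ∀ A : ℝ, A ≠ 0 → σ * A / polarJac w φ ρ * (X.radNum w l φ ρ / A) =
        σ * X.radNum w l φ ρ / polarJac w φ ρ := fun A hA => by field_simp
    rw [ea _ hA'']
    refine Prod.ext ?_ ?_
    · simp only [Prod.smul_mk, smul_eq_mul]
      rw [← mul_div_assoc, ← mul_div_assoc, ← sub_div, div_eq_iff hJ', hJe]
      simp only [radNum, angNum]
      linear_combination (σ * w.1 * Real.cos φ ^ 2 * X.polarP w l φ ρ) * e1 +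
        (σ * w.2 * Real.sin φ ^ 2 * X.polarP w l φ ρ) * e2
    · simp only [Prod.smul_mk, smul_eq_mul]
      rw [← mul_div_assoc, ← mul_div_assoc, ← add_div, div_eq_iff hJ', hJe]
      simp only [radNum, angNum]
      linear_combination (σ * w.1 * Real.cos φ ^ 2 * X.polarQ w l φ ρ) * e1 +
        (σ * w.2 * Real.sin φ ^ 2 * X.polarQ w l φ ρ) * e2
  obtain ⟨y, hy, hper, hy0, hyr⟩ := exists_periodic_extension (f := fun x => σ • X.field l x) hlt
    (z := z) (by
      simp only [z]
      rw [hkb, hka, hclosed]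
      simp [weightedPolar]) hz
  let γ : ℝ → ℝ × ℝ := fun t => y (σ * t)
  have hγ : ∀ t, HasDerivAt γ (X.field l (γ t)) t := by
    intro t
    have := HasDerivAt.scomp t (hy (σ * t)) ((hasDerivAt_id t).const_mul σ)
    refine HasDerivAt.congr_deriv this ?_
    rw [mul_one, smul_smul, hσσ, one_smul]
  have hγ0 : γ 0 = weightedPolar w (0, Φ 0) := by
    simp only [γ, mul_zero, hy0, z, hka]
  refine ⟨range γ, ⟨γ, τ, hlt, hγ, fun t => ?_, ?_, rfl⟩, ?_⟩
  · rcases hσ with rfl | rfl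
    · simpa [γ] using hper t
    · have := hper (-t - τ)
      simp only [γ, neg_one_mul]
      rw [sub_add_cancel] at this
      rw [this]
      congr 1
      ring
  -- A constant solution would be an equilibrium, where both components and hence the angular
  -- numerator vanish.
  · by_contra! hconst
    have h1 : γ = fun _ => γ 0 := funext hconst
    have h2 := hγ 0
    rw [h1] at h2
    have h3 := h2.unique (hasDerivAt_const _ _)
    rw [hγ0, field_weightedPolar] at h3
    have h0 : (0 : ℝ) ∈ Icc 0 (2 * Real.pi) := left_mem_Icc.2 hpi.le
    refine h.angNum_ne 0 (Φ 0) (hΦ 0 h0).1 ?_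
    have hP : X.polarP w l 0 (Φ 0) = 0 := congrArg Prod.fst h3
    have hQ : X.polarQ w l 0 (Φ 0) = 0 := congrArg Prod.snd h3
    simp [angNum, hP, hQ]
  · rintro _ ⟨t, rfl⟩
    obtain ⟨s, hs, he⟩ := hyr (σ * t)
    exact ⟨k s, (hk s hs).1, he⟩

end PlanarFamily

/-! ### Absence of limit cycles -/

/-- A continuous curve in the punctured plane has continuous polar coordinates. -/
theorem exists_polar_coordinates {γ : ℝ → ℝ × ℝ} (hγ : Continuous γ) (h : ∀ t, γ t ≠ (0, 0)) :
    ∃ r θ : ℝ → ℝ, Continuous r ∧ Continuous θ ∧ ∀ t, 0 < r t ∧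
      γ t = (r t * Real.cos (θ t), r t * Real.sin (θ t)) := by
  let g : ℝ → ℂ := fun t => ⟨(γ t).1, (γ t).2⟩
  have hg : Continuous g := by
    have : g = fun t => Complex.equivRealProdCLM.symm (γ t) := by
      funext t
      simp only [g]
      apply Complex.ext <;> simp
    rw [this]
    exact Complex.equivRealProdCLM.symm.continuous.comp hγ
  -- Polar coordinates come from a continuous logarithm of the curve, read in ℂ, along the simply
  -- connected line.
  have hs : IsSimplyConnected (univ : Set ℝ) := by
    have := (convex_univ (𝕜 := ℝ) (E := ℝ)).contractibleSpace univ_nonempty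
    exact SimplyConnectedSpace.ofContractible _
  obtain ⟨f, hf, hfe⟩ := Complex.exists_continuousOn_eqOn_exp_comp hs isOpen_univ hg.continuousOn
    (by
      rintro ⟨t, -, ht⟩
      exact h t (Prod.ext (congrArg Complex.re ht) (congrArg Complex.im ht)))
  rw [continuousOn_univ] at hf
  refine ⟨fun t => Real.exp (f t).re, fun t => (f t).im,
    Real.continuous_exp.comp (Complex.continuous_re.comp hf), Complex.continuous_im.comp hf,
    fun t => ⟨Real.exp_pos _, ?_⟩⟩
  have he : Complex.exp (f t) = g t := hfe (mem_univ t)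
  refine Prod.ext ?_ ?_
  · have := congrArg Complex.re he
    rw [Complex.exp_re] at this
    exact this.symm
  · have := congrArg Complex.im he
    rw [Complex.exp_im] at this
    exact this.symm

namespace PlanarFamily

variable {d : ℕ} {X : PlanarFamily d} {w : ℕ × ℕ} {m : ℤ} {V : Param d → ℝ → ℝ → ℝ}
  {W : ℝ × Param d → ℝ} {ε : ℝ} {l : Param d}

theorem polarF_add_nat_mul_two_pi (X : PlanarFamily d) (w : ℕ × ℕ) (l : Param d) (φ ρ : ℝ)
    (n : ℕ) : X.polarF w l (φ + n * (2 * Real.pi)) ρ = X.polarF w l φ ρ := by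
  simp only [polarF, radialSpeed, angularSpeed, polarP, polarQ, polarJac,
    Real.cos_add_nat_mul_two_pi, Real.sin_add_nat_mul_two_pi]

/-- A nonconstant periodic solution does not pass through the singularity. -/
theorem IsRegularAt.periodic_ne_zero (h : X.IsRegularAt w m V W ε l) {γ : ℝ → ℝ × ℝ} {T : ℝ}
    (hT : 0 < T) (hγ : ∀ t, HasDerivAt γ (X.field l (γ t)) t) (hper : Function.Periodic γ T)
    (hne : ∃ t, γ t ≠ γ 0) (t : ℝ) : γ t ≠ (0, 0) := by
  intro h0
  have hall : ∀ s, γ s = (0, 0) := by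
    intro s
    obtain ⟨n, hn⟩ := exists_nat_gt ((t - s) / T)
    have hns : t ≤ s + n * T := by linarith [(div_lt_iff₀ hT).1 hn]
    have := ODE_solution_unique_of_contDiffAt (f := X.field l) (y₁ := fun _ => (0, 0)) (y₂ := γ)
      (a := t) (b := s + n * T)
      (fun u _ => by rw [h.mono.1]; exact hasDerivWithinAt_const u _ ((0, 0) : ℝ × ℝ))
      (fun u _ => (hγ u).hasDerivWithinAt)
      (fun u _ => h.contDiffAt_field (by simpa using h.pos) (by simpa using h.pos)) h0.symm
      (right_mem_Icc.2 hns)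
    rw [← hper.nat_mul n s]
    exact this.symm
  obtain ⟨s, hs⟩ := hne
  exact hs (by rw [hall, hall])

/-- If some solution closes up after several turns, every solution closes up after one turn. -/
theorem IsRegularAt.closed_of_closed (h : X.IsRegularAt w m V W ε l) {k : ℕ} (hk : 0 < k)
    {Φ : ℝ → ℝ} (hΦ : IsSolutionOn (X.polarF w l) ε 0 (k * (2 * Real.pi)) Φ)
    (hclosed : Φ (k * (2 * Real.pi)) = Φ 0) {Ψ : ℝ → ℝ}
    (hΨ : IsSolutionOn (X.polarF w l) ε 0 (2 * Real.pi) Ψ) : Ψ (2 * Real.pi) = Ψ 0 := by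
  obtain ⟨T, hT⟩ := h.exists_period
  have hpi : (0 : ℝ) < 2 * Real.pi := by positivity
  have hinv := h.factor.continuousOn_inv h.factor_ne
  have hmem : ∀ j ≤ k, (j : ℝ) * (2 * Real.pi) ∈ Icc 0 (k * (2 * Real.pi)) := fun j hj =>
    ⟨by positivity, mul_le_mul_of_nonneg_right (by exact_mod_cast hj) hpi.le⟩
  have hturn : ∀ j < k, IsSolutionOn (X.polarF w l) ε 0 (2 * Real.pi)
      fun t => Φ (t + j * (2 * Real.pi)) := by
    intro j hj t ht
    have hmaps : MapsTo (fun t => t + j * (2 * Real.pi)) (Icc 0 (2 * Real.pi))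
        (Icc 0 (k * (2 * Real.pi))) := by
      intro s hs
      have h1 := (hmem (j + 1) hj).2
      push_cast at h1
      exact ⟨add_nonneg hs.1 (by positivity), by linarith [hs.2]⟩
    refine ⟨(hΦ _ (hmaps ht)).1, ?_⟩
    have := HasDerivWithinAt.scomp t (hΦ _ (hmaps ht)).2
      ((hasDerivAt_id t).add_const (j * (2 * Real.pi))).hasDerivWithinAt hmaps
    refine HasDerivWithinAt.congr_deriv this ?_
    rw [one_smul]
    exact polarF_add_nat_mul_two_pi X w l t _ j
  -- The integrals over the `k` turns add up to the integral from `Φ 0` back to itself. Each equals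
  -- `T`, so `k T = 0`.
  have hsum := intervalIntegral.sum_integral_adjacent_intervals (μ := MeasureTheory.volume)
    (f := fun s => (V l 0 s)⁻¹) (a := fun j : ℕ => Φ (j * (2 * Real.pi))) (n := k)
    fun j hj => intervalIntegrable_of_continuousOn_Ioo hinv (hΦ _ (hmem j hj.le)).1
      (hΦ _ (hmem (j + 1) hj)).1
  have hT0 : T = 0 := by
    have h1 : ∀ j ∈ Finset.range k, ∫ s in (Φ (j * (2 * Real.pi)))..(Φ ((j + 1 :
        ℕ) * (2 * Real.pi))),
        (V l 0 s)⁻¹ = T := by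
      intro j hj
      have := hT _ (hturn j (Finset.mem_range.1 hj))
      rw [zero_add] at this
      rw [← this]
      congr 2
      push_cast
      ring
    rw [Finset.sum_congr rfl h1] at hsum
    simp only [Finset.sum_const, Finset.card_range, nsmul_eq_mul, Nat.cast_zero, zero_mul, hclosed,
      intervalIntegral.integral_same] at hsum
    exact (mul_eq_zero.1 hsum).resolve_left (by exact_mod_cast hk.ne')
  have h2 := hT Ψ hΨ
  rw [hT0] at h2
  exact (eq_of_integral_eq_zero hinv (fun s hs => inv_ne_zero (h.factor_ne s hs))
    (hΨ _ (left_mem_Icc.2 hpi.le)).1 (hΨ _ (right_mem_Icc.2 hpi.le)).1 h2).symm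

/-- A return to the same point becomes a whole number of turns. That this number is 1 is not needed,
because `IsRegularAt.closed_of_closed` treats any positive `k`. -/
theorem exists_two_pi_mul_of_weightedPolar {w : ℕ × ℕ} (hp : 0 < w.1) (hq : 0 < w.2)
    {φ φ' ρ ρ' : ℝ} (hρ : 0 < ρ) (hρ' : 0 < ρ')
    (h : weightedPolar w (φ, ρ) = weightedPolar w (φ', ρ')) (hlt : φ' < φ) :
    ρ = ρ' ∧ ∃ k : ℕ, 0 < k ∧ φ - φ' = k * (2 * Real.pi) := by
  obtain ⟨h1, h2, h3⟩ := weightedPolar_inj hp hq hρ hρ' h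
  obtain ⟨k, hk⟩ := Real.Angle.angle_eq_iff_two_pi_dvd_sub.1 (Real.Angle.cos_sin_inj h2 h3)
  have hk0 : 0 < k := by
    have : (0 : ℝ) < 2 * Real.pi * k := by linarith
    exact_mod_cast pos_of_mul_pos_right this (by positivity)
  refine ⟨h1, k.toNat, by omega, ?_⟩
  have : ((k.toNat : ℕ) : ℝ) = (k : ℝ) := by exact_mod_cast Int.toNat_of_nonneg hk0.le
  rw [this, hk]; ring

/-- A periodic orbit near the singularity is a solution of `dρ/dφ = F` that closes up. -/
theorem IsRegularAt.exists_closed_solution (h : X.IsRegularAt w m V W ε l) {Γ : Set (ℝ × ℝ)}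
    (hΓ : X.IsPeriodicOrbit l Γ)
    (hsmall : ∀ z ∈ Γ, z.1 ^ 2 + z.2 ^ 2 < (min (ε ^ w.1) (ε ^ w.2)) ^ 2) :
    ∃ k : ℕ, 0 < k ∧ ∃ Φ : ℝ → ℝ, IsSolutionOn (X.polarF w l) ε 0 (k * (2 * Real.pi)) Φ ∧
      Φ (k * (2 * Real.pi)) = Φ 0 ∧
      ∀ s ∈ Icc 0 (k * (2 * Real.pi)), weightedPolar w (s, Φ s) ∈ Γ := by
  obtain ⟨hp, hq⟩ := h.weights
  obtain ⟨γ, T, hT, hγ, hper, hne, rfl⟩ := hΓ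
  obtain ⟨σ, hσ, hpos⟩ := h.exists_sign
  have hγc : Continuous γ := continuous_iff_continuousAt.2 fun t => (hγ t).continuousAt
  obtain ⟨r, θ, hr, hθ, hrθ⟩ := exists_polar_coordinates hγc (h.periodic_ne_zero hT hγ hper hne)
  obtain ⟨φ, ρ, hφ, hρ, hlift⟩ := exists_weightedPolar_lift hp hq (s := univ) hr.continuousOn
    hθ.continuousOn fun t _ => (hrθ t).1
  rw [continuousOn_univ] at hφ hρ
  have hmin : 0 < min (ε ^ w.1) (ε ^ w.2) := lt_min (pow_pos h.pos _) (pow_pos h.pos _)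
  have hρε : ∀ t, ρ t ∈ Ioo 0 ε := by
    intro t
    refine ⟨(hlift t (mem_univ t)).1, weightedPolar_radius_lt h.pos ⟨(hrθ t).1, ?_⟩
      (hlift t (mem_univ t)).2.2⟩
    have h1 := hsmall _ ⟨t, rfl⟩
    rw [(hrθ t).2] at h1
    refine lt_of_pow_lt_pow_left₀ 2 hmin.le (lt_of_eq_of_lt ?_ h1)
    simp only
    linear_combination (-(r t ^ 2)) * Real.sin_sq_add_cos_sq (θ t)
  have hwp : ∀ t, weightedPolar w (φ t, ρ t) = γ t := fun t => by
    rw [(hlift t (mem_univ t)).2.2, (hrθ t).2]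
  -- run in the direction of increasing angle
  have hperσ : Function.Periodic (fun t => γ (σ * t)) T := by
    intro t
    rcases hσ with rfl | rfl
    · simpa using hper t
    · have := hper (-t - T)
      simp only [neg_one_mul]
      rw [sub_add_cancel] at this
      rw [this]
      congr 1
      ring
  have hd : ∀ a t, HasDerivAt (fun t => γ (σ * (a + t))) (σ • X.field l (γ (σ * (a + t)))) t := by
    intro a t
    have := HasDerivAt.scomp t (hγ (σ * (a + t))) (((hasDerivAt_id t).const_add a).const_mul σ)
    rw [mul_one] at this
    exact this
  -- One period of the orbit started at time `a`, with the angle shifted by a multiple `c` of 2π;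
  -- the shift lets the graph begin at angle 0.
  have hsol : ∀ a c : ℝ, ∀ n : ℤ, c = n * (2 * Real.pi) →
      φ (σ * a) - c < φ (σ * (a + T)) - c ∧ ∃ Φ : ℝ → ℝ, Φ (φ (σ * a) - c) = ρ (σ * a) ∧
        Φ (φ (σ * (a + T)) - c) = ρ (σ * (a + T)) ∧
        IsSolutionOn (X.polarF w l) ε (φ (σ * a) - c) (φ (σ * (a + T)) - c) Φ ∧
        ∀ s ∈ Icc (φ (σ * a) - c) (φ (σ * (a + T)) - c), ∃ t, weightedPolar w (s, Φ s) = γ t := by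
    intro a c n hc
    have := exists_isSolutionOn_of_curve (X := X) (l := l) hp hq (ε := ε) (σ := σ) hT
      (z := fun t => γ (σ * (a + t))) (φ := fun t => φ (σ * (a + t)) - c)
      (ρ := fun t => ρ (σ * (a + t))) (by fun_prop) (by fun_prop) (fun t _ => hρε _)
      (fun t _ => by
        rw [← hwp, hc]
        simp only [weightedPolar, Real.cos_sub_int_mul_two_pi, Real.sin_sub_int_mul_two_pi])
      (fun t _ => (hd a t).hasDerivWithinAt) (fun t _ => hpos _ _ (hρε _))
    simp only [add_zero] at this
    obtain ⟨h1, Φ, h2, h3, h4, h5⟩ := this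
    refine ⟨h1, Φ, h2, h3, h4, fun s hs => ?_⟩
    obtain ⟨t, -, ht⟩ := h5 s hs
    exact ⟨_, ht⟩
  have hturns : ∀ a, ρ (σ * (a + T)) = ρ (σ * a) ∧
      ∃ k : ℕ, 0 < k ∧ φ (σ * (a + T)) - φ (σ * a) = k * (2 * Real.pi) := fun a =>
    exists_two_pi_mul_of_weightedPolar hp hq (hρε _).1 (hρε _).1
      (by rw [hwp, hwp]; exact hperσ a) (by linarith [(hsol a 0 0 (by simp)).1])
  -- a time at which the angle is a multiple of `2π`
  obtain ⟨a, n, ha⟩ : ∃ (a : ℝ) (n : ℤ), φ (σ * a) = n * (2 * Real.pi) := by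
    obtain ⟨-, k, hk, hkT⟩ := hturns 0
    have hpi : (0 : ℝ) < 2 * Real.pi := by positivity
    have hk1 : (1 : ℝ) ≤ k := by exact_mod_cast hk
    have hc := Int.le_ceil (φ (σ * 0) / (2 * Real.pi))
    have hc' := Int.ceil_lt_add_one (φ (σ * 0) / (2 * Real.pi))
    set n := ⌈φ (σ * 0) / (2 * Real.pi)⌉
    rw [div_le_iff₀ hpi] at hc
    rw [← sub_lt_iff_lt_add, lt_div_iff₀ hpi] at hc'
    have hle := mul_le_mul_of_nonneg_right hk1 hpi.le
    rw [zero_add] at hkT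
    -- Over one period the angle grows by at least 2π, so it crosses the next multiple of 2π.
    obtain ⟨a, -, ha⟩ := intermediate_value_Icc hT.le
      (f := fun t => φ (σ * t)) (by fun_prop) (show (n : ℝ) * (2 * Real.pi) ∈ _ from
        ⟨hc, by linarith⟩)
    exact ⟨a, n, ha⟩
  obtain ⟨h1, k, hk, h2⟩ := hturns a
  obtain ⟨-, Φ, h3, h4, h5, h6⟩ := hsol a (φ (σ * a)) n ha
  rw [sub_self] at h3 h5 h6
  rw [h2] at h4 h5 h6
  exact ⟨k, hk, Φ, h5, by rw [h3, h4, h1], fun s hs => by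
    obtain ⟨t, ht⟩ := h6 s hs
    exact ⟨t, ht.symm⟩⟩

/-- A periodic orbit forces the period `T` to vanish, so a solution started at a nearby radius `c ≠
Φ 0` closes as well. Its orbit stays in the isolating set by continuous dependence, yet cannot be
`Γ`. -/
theorem not_isLimitCycle (h : ∀ᶠ l' in 𝓝 l, X.IsRegularAt w m V W ε l') {Γ : Set (ℝ × ℝ)}
    (hsmall : ∀ z ∈ Γ, z.1 ^ 2 + z.2 ^ 2 < (min (ε ^ w.1) (ε ^ w.2)) ^ 2) :
    ¬ X.IsLimitCycle l Γ := by
  rintro ⟨hΓ, U, hU, hΓU, hiso⟩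
  have hl := h.self_of_nhds
  obtain ⟨hp, hq⟩ := hl.weights
  have hpi : (0 : ℝ) < 2 * Real.pi := by positivity
  obtain ⟨k, hk, Φ, hΦ, hclosed, hmem⟩ := hl.exists_closed_solution hΓ hsmall
  have hk1 : (1 : ℝ) ≤ k := by exact_mod_cast hk
  have hle : 2 * Real.pi ≤ k * (2 * Real.pi) := by nlinarith
  have hΦ1 := hΦ.mono le_rfl hle
  have hO : IsOpen {z : ℝ × ℝ | weightedPolar w z ∈ U} :=
    hU.preimage (continuous_iff_continuousAt.2 fun z => (hasFDerivAt_weightedPolar w z).continuousAt)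
  obtain ⟨g, -, -, hev⟩ := exists_analytic_transition h hpi.le hΦ1 hO
    fun t ht => hΓU (hmem t ⟨ht.1, ht.2.trans hle⟩)
  have hsl : Tendsto (fun c : ℝ => (c, l)) (𝓝[≠] (Φ 0)) (𝓝 (Φ 0, l)) :=
    ((Continuous.prodMk_left l).tendsto (Φ 0)).mono_left nhdsWithin_le_nhds
  obtain ⟨c, ⟨Ψ, hΨ0, -, hΨ, hΨO⟩, hc⟩ :=
    ((hsl.eventually hev).and self_mem_nhdsWithin).exists
  simp only at hΨ0 hΨ
  have hΨc := hl.closed_of_closed hk hΦ hclosed hΨ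
  obtain ⟨Γ', hΓ', hpts⟩ := hl.exists_isPeriodicOrbit hΨ hΨc
  have heq : Γ' = Γ := hiso Γ' (fun z hz => by
    obtain ⟨s, hs, rfl⟩ := hpts z hz
    exact hΨO s hs) hΓ'
  have h0 : (0 : ℝ) ∈ Icc 0 (k * (2 * Real.pi)) := left_mem_Icc.2 (by positivity)
  have hp0 := hmem 0 h0
  rw [← heq] at hp0
  obtain ⟨s, hs, he⟩ := hpts _ hp0
  obtain ⟨e1, e2, -⟩ := weightedPolar_inj hp hq (hΦ 0 h0).1.1 (hΨ s hs).1.1 he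
  rw [Real.cos_zero] at e2
  -- If the orbits coincided, the starting point of `Φ` would lie on the graph of `Ψ` at an angle of
  -- cosine 1, that is at 0 or 2π, where `Ψ` has the value `c`.
  have hs' : s = 0 ∨ s = 2 * Real.pi := by
    obtain ⟨n, hn⟩ := (Real.cos_eq_one_iff s).1 e2.symm
    have h1 : (0 : ℝ) ≤ n := by
      by_contra! hlt
      nlinarith [hs.1]
    have h2 : (n : ℝ) ≤ 1 := by
      by_contra! hlt
      nlinarith [hs.2]
    have h1' : 0 ≤ n := by exact_mod_cast h1
    have h2' : n ≤ 1 := by exact_mod_cast h2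
    interval_cases n
    · left; simpa using hn.symm
    · right; simpa using hn.symm
  refine hc ?_
  rw [mem_singleton_iff, ← hΨ0, e1]
  rcases hs' with rfl | rfl
  · rfl
  · exact hΨc.symm

theorem cyclicity_eq_zero {l₀ : Param d} (h : ∀ᶠ l in 𝓝 l₀, X.IsRegularAt w m V W ε l)
    (E : Set (Param d)) : X.cyclicity E l₀ = 0 := by
  have hε := h.self_of_nhds.pos
  have hmin : 0 < min (ε ^ w.1) (ε ^ w.2) := lt_min (pow_pos hε _) (pow_pos hε _)
  have hU : {z : ℝ × ℝ | z.1 ^ 2 + z.2 ^ 2 < (min (ε ^ w.1) (ε ^ w.2)) ^ 2} ∈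
      𝓝 ((0, 0) : ℝ × ℝ) :=
    (isOpen_lt (by fun_prop) continuous_const).mem_nhds (by
      simpa using pow_pos hmin 2)
  refine le_antisymm (iInf₂_le_of_le _ hU (iInf₂_le_of_le _ (eventually_eventually_nhds.2 h)
    (iSup₂_le fun l hl => ?_))) zero_le
  refine le_of_eq (encard_eq_zero.2 (eq_empty_of_forall_notMem fun Γ hΓ => ?_))
  exact not_isLimitCycle (mem_ofPred_eq ▸ hl.1) (fun z hz => hΓ.2 hz) hΓ.1

end PlanarFamily

/-! ### The theorem -/

theorem theorem4 {d : ℕ} (X : PlanarFamily d) (E : Set (Param d)) (w : ℕ × ℕ) (m : ℤ)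
    (V : Param d → ℝ → ℝ → ℝ) (v : ℤ → Param d → ℝ → ℝ)
    (hE : IsOpen E)
    (hX : ∀ l ∈ E, X.AnalyticNear l)
    (hmono : E ⊆ X.monodromicSet)
    (hN : ∀ l ∈ E, ∀ l' ∈ E, X.newtonDiagram l = X.newtonDiagram l')
    (hw : ∀ l ∈ E, w ∈ X.weights l)
    (h0 : ∀ l ∈ E, (0 : ℝ) ∉ X.charDirections w l)
    (hcrit : ∀ l ∈ E, X.NonCriticalNear w l)
    (hV : X.IsLaurentFactor w E m V v) :
    ∃ η : ℕ → Param d → ℝ,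
      -- the Poincaré map, its formal expansion, and analyticity of its coefficients
      (∀ l ∈ E, X.PoincareWellDefined w l ∧
        HasFormalExpansion (X.poincareMap w l) (fun i => η i l)) ∧
      (∀ i, 1 ≤ i → AnalyticOnNhd ℝ (η i) E) ∧
      -- the Bautin ideal
      (∀ l ∈ E, (bautinIdeal η l).IsPrincipal ∧
        (m = 1 → bautinIdeal η l = germIdeal l {fun l' => η 1 l' - 1}) ∧
        (∀ k : ℕ, 2 ≤ k → m = k → bautinIdeal η l = germIdeal l {η k})) ∧
      -- (i)
      (∀ l ∈ E, 1 < m → laurentResidue (laurentFrom m fun i => v i l 0)⁻¹ = 0 →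
        IsAnalyticAtZero (X.poincareMap w l)) ∧
      -- (ii)
      (∀ l ∈ E, IsAnalyticAtZero (X.poincareMap w l) → X.cyclicity E l = 0) ∧
      -- (iii)
      (m = 1 → ∀ l ∈ E, IsAnalyticAtZero (X.poincareMap w l)) := by
  choose! W ε hreg using fun l (hl : l ∈ E) =>
    PlanarFamily.exists_isRegularAt hE hX hmono hw h0 hcrit hV hl
  choose! T hT using fun l (hl : l ∈ E) => PlanarFamily.exists_isTranslationNear (hreg l hl)
  -- The coefficients are chosen separately for each parameter, while `W`, `ε` and `T` depend on the
  -- base point. `IsTranslationNear.bautinIdeal` then gives analyticity near every parameter.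
  choose! c hc using fun l (hl : l ∈ E) => (hT l hl).exists_hasFormalExpansion
  have hideal := fun l (hl : l ∈ E) => (hT l hl).bautinIdeal (η := fun i l => c l i)
    (Filter.mem_of_superset (hE.mem_nhds hl) hc)
  exact ⟨fun i l => c l i,
    fun l hl => ⟨(hreg l hl).self_of_nhds.poincareWellDefined, hc l hl⟩,
    fun i hi l hl => (hideal l hl).1 i hi,
    fun l hl => (hideal l hl).2,
    fun l hl _ _ => (hT l hl).isAnalyticAtZero,
    fun l hl _ => PlanarFamily.cyclicity_eq_zero (hreg l hl) E,
    fun _ l hl => (hT l hl).isAnalyticAtZero⟩
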